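/- Let $n,\ell\ge 2$ and $s\ge 0$ be integers. A column is a finite set of positive integers, and $F(s)$ is the set of tensor products $b=c_\ell\otimes\cdots\otimes c_1$ of $\ell$ columns $c_j\subseteq\{1,\dots,n\}$ with $\sum_j|c_j|=s$; $\dot F(s)$ is defined in the same way with $n$ and $\ell$ exchanged, its elements being written $d_1\otimes\cdots\otimes d_n$ with $d_i\subseteq\{1,\dots,\ell\}$. *Crystals.* The word of a tensor product is obtained by reading its factors from left to right, each in increasing order. Its $i$-signature is obtained by keeping only the letters $i$ (written $+$) and $i+1$ (written $-$) and deleting recursively all factors $+-$. The operator $e_i$ changes the entry $i+1$ of the rightmost $-$ of the $i$-signature into $i$, and $f_i$ changes the entry $i$ of the leftmost $+$ into $i+1$ (the result being $0$ if there is no such sign). This gives $F(s)$ the structure of an $A_{n-1}$-crystal and $\dot F(s)$ that of an $A_{\ell-1}$-crystal. *Tableaux.* $b=c_\ell\otimes\cdots\otimes c_1$ is a tableau if the top-aligned juxtaposition $c_1\cdots c_\ell$ is a semistandard Young tableau; it is a column if moreover $c_j=\emptyset$ for $j\ge2$. For $b\in F(s)$, $P(b)$ is the unique tableau in $F(s)$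 that is the image of $b$ under an $A_{n-1}$-crystal isomorphism from the connected component of $b$ to that of $P(b)$. *Duality.* $b^*=d(1)\otimes\cdots\otimes d(n)\in\dot F(s)$, where $d(i)=\{j\mid i\in c_j\}$. *Charge.* The cyclage of $b=c_\ell\otimes\cdots\otimes c_1$ is $\xi(b)=c_{\ell-1}\otimes\cdots\otimes c_1\otimes c_\ell$. It is authorised for $b$ if either (a) $b$ contains no more letters $k+1$ than $k$ for $1\le k<n$, and $1\notin c_\ell$, or (b) $b$ is a tableau and no letter appears in every column $c_j$. If some letter appears in every column and $k_0$ is the smallest one, $\mathrm{red}(b)$ is obtained by deleting all letters $k_0$ and replacing each $k>k_0$ by $k-1$ (so that $n$ becomes $n-1$). The charge is defined by the following recursive rules, in which $n$ and $\ell$ vary: $\mathrm{ch}(b)=0$ if $b$ is a column; if $b$ is a tableau, its empty columns may be dropped without changing $\mathrm{ch}(b)$, one has $\mathrm{ch}(b)=\mathrm{ch}(\xi(b))+|c_\ell|$ if $c_\ell\neq\emptyset$ and the cyclage is authorised for $b$, and $\mathrm{ch}(b)=\mathrm{ch}(\mathrm{red}(b))$ if some letter appears in every column of $b$; in general, $\mathrm{ch}(b)=\mathrm{ch}(P(b))$.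 *Energy.* The combinatorial $R$-matrix is the unique isomorphism of $A_{\ell-1}$-crystals $B(\omega_p)\otimes B(\omega_q)\to B(\omega_q)\otimes B(\omega_p)$, where $B(\omega_p)$ is the crystal of columns of size $p$ with entries in $\{1,\dots,\ell\}$; $R_j$ denotes its action on the factors $j$ and $j+1$ of an element of $\dot F(s)$. For columns with $|d|\ge|d'|$, $\mathrm H(d\otimes d')$ is the number of boxes of the left column having no box to their right in the semistandard skew tableau of minimal shape with right column $d$ and left column $d'$; if $|d|<|d'|$, then $\mathrm H(d\otimes d')=\mathrm H(R_1(d\otimes d'))$. The energy of $d_1\otimes\cdots\otimes d_n$ is $$\mathrm D(d_1\otimes\cdots\otimes d_n)=\sum_{1\le i<j\le n}\mathrm H\bigl(d_i\otimes d_{i+1}^{(j)}\bigr),$$ where $d_{i+1}^{(j)}$ is the $(i+1)$-st factor of the element obtained by applying successively $R_{j-1},\dots,R_{i+1}$. **Theorem.** For every $b\in F(s)$, the rules above assign exactly one value $\mathrm{ch}(b)$ to $b$, and $$\mathrm{ch}(b)=\mathrm D(b^*).$$ -/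

import Mathlib

/-!
# Tensor products of columns: crystals, duality, charge and energy

A column is a finite set of positive integers.  A tensor product of columns is a list of columns,
written in tensor order: the list `[c_ℓ, …, c_1]` stands for `c_ℓ ⊗ ⋯ ⊗ c_1`, and the list
`[d_1, …, d_n]` stands for `d_1 ⊗ ⋯ ⊗ d_n`.
-/

namespace ColumnCrystal

/-- A tensor product of columns, listed from the leftmost tensor factor to the rightmost one. -/
abbrev ColProd : Type := List (Finset ℕ)

/-- The combinatorial Fock space `F(s)`: tensor products of `ℓ` columns with entries in
`{1, …, n}` and with `s` entries in total.  (Exchanging `n` and `ℓ` gives the dual Fock space.) -/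
def Fock (n ℓ s : ℕ) : Set ColProd :=
  {b | b.length = ℓ ∧ (∀ c ∈ b, c ⊆ Finset.Icc 1 n) ∧ (b.map Finset.card).sum = s}

/-- Number of occurrences of the letter `k` in `b`. -/
def mult (k : ℕ) (b : ColProd) : ℕ := b.countP (fun c => decide (k ∈ c))

/-! ## Crystal structure -/

/-- The word of `b` (columns from left to right, each read increasingly).  Each letter comes with
the position (starting from `0`) of the tensor factor that contains it: `(letter, position)`. -/
def word (b : ColProd) : List (ℕ × ℕ) :=
  b.zipIdx.flatMap fun cp => (cp.1.sort (· ≤ ·)).map fun a => (a, cp.2)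

/-- Delete recursively all factors `i, i+1` (that is, `+-`) from a word in the letters
`i` (that is, `+`) and `i+1` (that is, `-`). -/
def cancel (i : ℕ) : List (ℕ × ℕ) → List (ℕ × ℕ)
  | [] => []
  | x :: w =>
    match cancel i w with
    | [] => [x]
    | y :: v => if x.1 = i ∧ y.1 = i + 1 then v else x :: y :: v

/-- The `i`-signature of `b`; a letter `i` stands for `+` and a letter `i+1` stands for `-`. -/
def signature (i : ℕ) (b : ColProd) : List (ℕ × ℕ) :=
  cancel i ((word b).filter fun x => decide (x.1 = i ∨ x.1 = i + 1))

/-- The raising crystal operator: change the entry `i+1` of the rightmost `-` of the `i`-signature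
into `i`; the value `none` stands for `0`. -/
def raise (i : ℕ) (b : ColProd) : Option ColProd :=
  ((signature i b).filter fun x => decide (x.1 = i + 1)).getLast?.map fun x =>
    b.modify x.2 fun c => insert i (c.erase (i + 1))

/-- The lowering crystal operator: change the entry `i` of the leftmost `+` of the `i`-signature
into `i+1`; the value `none` stands for `0`. -/
def lower (i : ℕ) (b : ColProd) : Option ColProd :=
  ((signature i b).filter fun x => decide (x.1 = i)).head?.map fun x =>
    b.modify x.2 fun c => insert (i + 1) (c.erase i)

/-- The `i`-th coordinate of the `𝔰𝔩`-weight of `b` in the basis of fundamental weights. -/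
def weight (i : ℕ) (b : ColProd) : ℤ := (mult i b : ℤ) - (mult (i + 1) b : ℤ)

/-- `φ` restricts to an isomorphism of `A_{n-1}`-crystals from `A` to `B`, where `A` and `B` are
sets of tensor products of columns with entries in `{1, …, n}` that are stable under the crystal
operators. -/
structure IsCrystalIso (n : ℕ) (A B : Set ColProd) (φ : ColProd → ColProd) : Prop where
  bijOn : Set.BijOn φ A B
  map_lower : ∀ i, 1 ≤ i → i < n → ∀ x ∈ A, lower i (φ x) = (lower i x).map φ
  map_raise : ∀ i, 1 ≤ i → i < n → ∀ x ∈ A, raise i (φ x) = (raise i x).map φ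
  map_weight : ∀ i, 1 ≤ i → i < n → ∀ x ∈ A, weight i (φ x) = weight i x

/-- The connected component of `b` in the `A_{n-1}`-crystal. -/
def component (n : ℕ) (b : ColProd) : Set ColProd :=
  {x | Relation.EqvGen (fun y z => ∃ i, 1 ≤ i ∧ i < n ∧ lower i y = some z) b x}

/-! ## Tableaux and the map `P` -/

/-- The column `x` may stand directly to the right of the column `y` in a top-aligned
semistandard tableau. -/
def RightOf (x y : Finset ℕ) : Prop :=
  x.card ≤ y.card ∧
    ∀ r < x.card, (y.sort (· ≤ ·)).getD r 0 ≤ (x.sort (· ≤ ·)).getD r 0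

/-- `b = c_ℓ ⊗ ⋯ ⊗ c_1` is a tableau: the top-aligned juxtaposition `c_1 ⋯ c_ℓ` is
semistandard. -/
def IsTableau (b : ColProd) : Prop := List.IsChain RightOf b

/-- `t` is a tableau in the same `F(s)` as `b`, and `b ↦ t` is induced by an isomorphism of
`A_{n-1}`-crystals between connected components. -/
def IsTableauOf (n : ℕ) (b t : ColProd) : Prop :=
  t ∈ Fock n b.length (b.map Finset.card).sum ∧ IsTableau t ∧
    ∃ φ, IsCrystalIso n (component n b) (component n t) φ ∧ φ b = t

/-- The tableau `P(b)`, that is, the unique `t` with `IsTableauOf n b t`. -/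
noncomputable def tableauOf (n : ℕ) (b : ColProd) : ColProd := Classical.epsilon (IsTableauOf n b)

/-! ## Duality -/

/-- The column `c_j` of `b = c_ℓ ⊗ ⋯ ⊗ c_1`, for `1 ≤ j ≤ ℓ`. -/
def col (b : ColProd) (j : ℕ) : Finset ℕ := b.reverse.getD (j - 1) ∅

/-- The dual `b^* = d(1) ⊗ ⋯ ⊗ d(n)` of `b = c_ℓ ⊗ ⋯ ⊗ c_1`, where
`d(i) = {j ∈ {1, …, ℓ} | i ∈ c_j}`. -/
def dual (n : ℕ) (b : ColProd) : ColProd :=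
  (List.range' 1 n).map fun i => (Finset.Icc 1 b.length).filter fun j => i ∈ col b j

/-! ## Cyclage, reduction and charge -/

/-- The cyclage `c_{ℓ-1} ⊗ ⋯ ⊗ c_1 ⊗ c_ℓ` of `c_ℓ ⊗ c_{ℓ-1} ⊗ ⋯ ⊗ c_1`. -/
def cyclage (b : ColProd) : ColProd := b.rotate 1

/-- `b` has no more letters `k+1` than `k`, for `k = 1, …, n-1`. -/
def DominantEvaluation (n : ℕ) (b : ColProd) : Prop :=
  ∀ k, 1 ≤ k → k < n → mult (k + 1) b ≤ mult k b

/-- The letter `k` appears in every column of `b`. -/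
def IsFullLetter (n : ℕ) (b : ColProd) (k : ℕ) : Prop :=
  k ∈ Finset.Icc 1 n ∧ ∀ c ∈ b, k ∈ c

/-- The cyclage is authorised for `b = c_ℓ ⊗ ⋯ ⊗ c_1`. -/
def CyclageAuthorised (n : ℕ) (b : ColProd) : Prop :=
  (DominantEvaluation n b ∧ 1 ∉ b.headD ∅) ∨ (IsTableau b ∧ ¬ ∃ k, IsFullLetter n b k)

/-- Delete all letters `k₀` in `b` and replace each letter `k > k₀` by `k - 1`. -/
def deleteLetter (k₀ : ℕ) (b : ColProd) : ColProd :=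
  b.map fun c => (c.erase k₀).image fun k => if k₀ < k then k - 1 else k

/-- `IsCharge n b m` means that the recursive rules defining the charge of the tensor product
`b = c_ℓ ⊗ ⋯ ⊗ c_1`, with entries in `{1, …, n}`, give the value `m`.
A tableau is identified with the semistandard Young tableau it represents, so that its empty
columns `c_ℓ` are dropped (rule `dropEmpty`) before a cyclage or a reduction is performed. -/
inductive IsCharge : ℕ → ColProd → ℕ → Prop
  /-- A column, that is, `∅ ⊗ ⋯ ⊗ ∅ ⊗ c_1`, has charge `0`. -/
  | column (n : ℕ) (b : ColProd) (h : ∀ c ∈ b.dropLast, c = ∅) : IsCharge n b 0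
  | dropEmpty (n m : ℕ) (b : ColProd) (hb : IsTableau (∅ :: b)) (h : IsCharge n b m) :
      IsCharge n (∅ :: b) m
  /-- For a tableau with a nonempty last column `c_ℓ` and for which the cyclage is authorised,
  `ch(b) = ch(ξ(b)) + |c_ℓ|`. -/
  | cyclage (n m : ℕ) (b : ColProd) (hb : IsTableau b) (hne : b.headD ∅ ≠ ∅)
      (ha : CyclageAuthorised n b) (h : IsCharge n (cyclage b) m) :
      IsCharge n b (m + (b.headD ∅).card)
  /-- For a tableau with a letter in every column, `ch(red(b)) = ch(b)`; the reduction deletes the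
  smallest such letter, and has its entries in `{1, …, n-1}`. -/
  | reduction (n m k₀ : ℕ) (b : ColProd) (hb : IsTableau b) (hne : b ≠ [])
      (hk : IsLeast {k | IsFullLetter n b k} k₀)
      (h : IsCharge (n - 1) (deleteLetter k₀ b) m) : IsCharge n b m
  /-- In general, `ch(b) = ch(P(b))`. -/
  | general (n m : ℕ) (b : ColProd) (h : IsCharge n (tableauOf n b) m) : IsCharge n b m

/-- The charge of `b`, that is, the unique `m` with `IsCharge n b m`. -/
noncomputable def charge (n : ℕ) (b : ColProd) : ℕ := Classical.epsilon (IsCharge n b)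

/-! ## Combinatorial `R`-matrix and energy

Here tensor products `d_1 ⊗ ⋯ ⊗ d_n` of columns with entries in `{1, …, m}` are considered. -/

/-- The tensor product `B(ω_p) ⊗ B(ω_q)` of two column crystals of type `A_{m-1}`. -/
def twoCols (m p q : ℕ) : Set ColProd :=
  {d | ∃ x ∈ (Finset.Icc 1 m).powersetCard p, ∃ y ∈ (Finset.Icc 1 m).powersetCard q, d = [x, y]}

/-- The combinatorial `R`-matrix, that is, the unique isomorphism of `A_{m-1}`-crystals
`B(ω_p) ⊗ B(ω_q) → B(ω_q) ⊗ B(ω_p)`. -/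
noncomputable def rMatrix (m p q : ℕ) : ColProd → ColProd :=
  Classical.epsilon (IsCrystalIso m (twoCols m p q) (twoCols m q p))

/-- The factor `d_i` of `d = d_1 ⊗ ⋯ ⊗ d_n`, for `1 ≤ i ≤ n`. -/
def factor (d : ColProd) (i : ℕ) : Finset ℕ := d.getD (i - 1) ∅

/-- The `R`-matrix `R_j` acting on the factors `j` and `j+1` of `d = d_1 ⊗ ⋯ ⊗ d_n`. -/
noncomputable def applyR (m j : ℕ) (d : ColProd) : ColProd :=
  d.take (j - 1)
    ++ rMatrix m (factor d j).card (factor d (j + 1)).card [factor d j, factor d (j + 1)]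
    ++ d.drop (j + 1)

/-- The column `d_{i+1}^{(j)}`: the `(i+1)`-st factor of the element obtained from `d` by applying
successively `R_{j-1}, …, R_{i+1}` (in this order). -/
noncomputable def movedFactor (m i j : ℕ) (d : ColProd) : Finset ℕ :=
  factor ((List.range' (i + 1) (j - 1 - i)).foldr (applyR m) d) (i + 1)

/-- Put the column `y` to the left of the column `x` so that exactly `k` boxes of `y` lie below the
last box of `x`, and the first box of `y` does not lie above the first box of `x`: this is a
semistandard skew tableau. -/
def IsSkewPair (x y : Finset ℕ) (k : ℕ) : Prop :=
  k ≤ y.card ∧ y.card ≤ x.card + k ∧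
    ∀ r < y.card - k,
      (y.sort (· ≤ ·)).getD r 0 ≤ (x.sort (· ≤ ·)).getD (x.card + k - y.card + r) 0

/-- `leg(x ⊗ y)`: the number of boxes of the left column `y` having no box to their right, in the
skew tableau of minimal shape associated to `x ⊗ y`. -/
noncomputable def leg (x y : Finset ℕ) : ℕ := sInf {k | IsSkewPair x y k}

/-- The local energy `H(x ⊗ y)` of two columns with entries in `{1, …, m}`. -/
noncomputable def localEnergy (m : ℕ) (x y : Finset ℕ) : ℕ :=
  if y.card ≤ x.card then leg x y
  else leg (factor (rMatrix m x.card y.card [x, y]) 1) (factor (rMatrix m x.card y.card [x, y]) 2)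

/-- The energy `D(d) = ∑_{1 ≤ i < j ≤ n} H(d_i ⊗ d_{i+1}^{(j)})` of `d = d_1 ⊗ ⋯ ⊗ d_n`. -/
noncomputable def energy (m : ℕ) (d : ColProd) : ℕ :=
  ∑ j ∈ Finset.Icc 1 d.length, ∑ i ∈ Finset.Ico 1 j,
    localEnergy m (factor d i) (movedFactor m i j d)

end ColumnCrystal

/-! The function `b ↦ D(b^*)` obeys every rule that defines the charge, and the rules can always be
applied until they stop. The first fact makes the value unique and equal to the energy, the second
makes it exist.

The common tool is the bracketing of two columns `x`, `y`. Reading the letters in order, `gap`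
counts the letters of `y` that still wait for a partner in `x`, and `moved` collects the letters of
`x` met when nobody waits. Sliding these from `x` to `y` commutes with the crystal operators for
every starting value `θ` (`lower_slide`). With `θ` the number of unmatched letters of `y`, a fixed
point of the reading, sliding is the R-matrix and `θ` is the local energy when the left column is
the larger one. With `θ` one less than the number of letters that can be slid, it moves a single
letter, and `raise_dual` identifies this with a raising operator on `b^*`.

The rule `ch(b) = ch(P(b))`: slides are raising operators of the dual crystal and commute with the
operators of the original one, so climbing to a dual highest weight, which means a tableau
(`isTableau_iff`), leads from `b` to `P(b)` through crystal isomorphisms. The energy is constant on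
dual components (`energy_lower`). A highest weight tableau is determined by its weight once its
length and size are given, which makes the energy independent of the chosen tableau.

The cyclage: on `b^*` it is the promotion `a ↦ a + 1` modulo `ℓ` of every factor. A fixed point
makes the bracketing cyclic, so the R-matrix commutes with promotion, and `localEnergy_promote`
computes the change of one local energy by looking at the letter `ℓ` only. These changes telescope
while a factor travels to the front. If `b` is a tableau, the travelling factor arrives as an
initial segment, which misses `ℓ` unless it is full. The total drop is the multiplicity of `ℓ` in
`b^*`, that is, `|c_ℓ|` (`energy_promote`).

The remaining rules are inclusions: the R-matrix swaps comparable columns at no cost. Hence a full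
letter, which is a full factor of `b^*`, can be removed, and the dual of a column has energy zero.
An empty last column only changes the bound on the entries of `b^*`.

Termination: cyclage lowers the energy, dropping an empty column lowers `ℓ`, reduction lowers `n`,
and passing to `P(b)` changes none of the three. -/

namespace ColumnCrystal

/-! ## The signature rule as a recursion on the tensor factors -/

/-- The column `c` contributes a `-` to the `i`-signature. -/
def IsMinus (i : ℕ) (c : Finset ℕ) : Prop := i + 1 ∈ c ∧ i ∉ c

/-- The column `c` contributes a `+` to the `i`-signature. -/
def IsPlus (i : ℕ) (c : Finset ℕ) : Prop := i ∈ c ∧ i + 1 ∉ c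

instance (i : ℕ) (c : Finset ℕ) : Decidable (IsMinus i c) := by unfold IsMinus; infer_instance

instance (i : ℕ) (c : Finset ℕ) : Decidable (IsPlus i c) := by unfold IsPlus; infer_instance

theorem IsMinus.not_isPlus {i : ℕ} {c : Finset ℕ} (h : IsMinus i c) : ¬ IsPlus i c :=
  fun h' => h.2 h'.1

/-- Change the letter `i + 1` of a column into `i`. -/
def up (i : ℕ) (c : Finset ℕ) : Finset ℕ := insert i (c.erase (i + 1))

/-- Change the letter `i` of a column into `i + 1`. -/
def dn (i : ℕ) (c : Finset ℕ) : Finset ℕ := insert (i + 1) (c.erase i)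

/-- Number of `-` in the `i`-signature. -/
def eps (i : ℕ) : ColProd → ℕ
  | [] => 0
  | c :: b => if IsMinus i c then eps i b + 1 else if IsPlus i c then eps i b - 1 else eps i b

/-- Number of `+` in the `i`-signature. -/
def phi (i : ℕ) : ColProd → ℕ
  | [] => 0
  | c :: b => if IsPlus i c ∧ eps i b = 0 then phi i b + 1 else phi i b

/-- Recursive form of `raise`. -/
def raiseRec (i : ℕ) : ColProd → Option ColProd
  | [] => none
  | c :: b =>
    if IsMinus i c ∧ eps i b = 0 then some (up i c :: b)
    else if IsPlus i c ∧ eps i b = 1 then none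
    else (raiseRec i b).map (c :: ·)

/-- Recursive form of `lower`. -/
def lowerRec (i : ℕ) : ColProd → Option ColProd
  | [] => none
  | c :: b => if IsPlus i c ∧ eps i b = 0 then some (dn i c :: b) else (lowerRec i b).map (c :: ·)

theorem mem_up {i a : ℕ} {c : Finset ℕ} : a ∈ up i c ↔ a = i ∨ (a ≠ i + 1 ∧ a ∈ c) := by
  simp [up]

theorem mem_dn {i a : ℕ} {c : Finset ℕ} : a ∈ dn i c ↔ a = i + 1 ∨ (a ≠ i ∧ a ∈ c) := by
  simp [dn]

/-- The signed letters contributed by one column. -/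
def letters (i k : ℕ) (c : Finset ℕ) : List (ℕ × ℕ) :=
  (if i ∈ c then [(i, k)] else []) ++ (if i + 1 ∈ c then [(i + 1, k)] else [])

theorem filter_sort_eq (i : ℕ) (c : Finset ℕ) :
    (c.sort (· ≤ ·)).filter (fun a => decide (a = i ∨ a = i + 1)) =
      (if i ∈ c then [i] else []) ++ (if i + 1 ∈ c then [i + 1] else []) := by
  refine List.Perm.eq_of_pairwise' (r := (· ≤ ·))
    ((Finset.pairwise_sort c (· ≤ ·)).sublist List.filter_sublist) ?_ ?_
  · split_ifs <;> simp
  · refine (List.perm_ext_iff_of_nodup ((Finset.sort_nodup c (· ≤ ·)).filter _) ?_).2 ?_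
    · split_ifs <;> simp
    · intro a
      simp only [List.mem_filter, Finset.mem_sort, decide_eq_true_eq, List.mem_append]
      split_ifs <;> simp <;> grind

theorem filter_map_sort (i k : ℕ) (c : Finset ℕ) :
    ((c.sort (· ≤ ·)).map fun a => (a, k)).filter (fun x => decide (x.1 = i ∨ x.1 = i + 1)) =
      letters i k c := by
  rw [List.filter_map]
  have := filter_sort_eq i c
  have h2 : ((fun x : ℕ × ℕ => decide (x.1 = i ∨ x.1 = i + 1)) ∘ fun a : ℕ => (a, k)) =
    fun a => decide (a = i ∨ a = i + 1) := rfl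
  rw [h2, this, letters]
  split_ifs <;> rfl

/-- The `i`-signature of `b`, the tensor factors being numbered from `k` on. -/
def signatureFrom (i k : ℕ) (b : ColProd) : List (ℕ × ℕ) :=
  cancel i ((b.zipIdx k).flatMap fun cp => letters i cp.2 cp.1)

theorem signature_eq (i : ℕ) (b : ColProd) : signature i b = signatureFrom i 0 b := by
  unfold signature signatureFrom word
  rw [List.filter_flatMap]
  simp only [filter_map_sort]

/-- One step of the cancellation. -/
def cancelStep (i : ℕ) (x : ℕ × ℕ) : List (ℕ × ℕ) → List (ℕ × ℕ)
  | [] => [x]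
  | y :: v => if x.1 = i ∧ y.1 = i + 1 then v else x :: y :: v

theorem cancel_cons (i : ℕ) (x : ℕ × ℕ) (w : List (ℕ × ℕ)) :
    cancel i (x :: w) = cancelStep i x (cancel i w) := by
  rw [cancel]
  rcases cancel i w with _ | ⟨y, v⟩ <;> rfl

/-- A column containing both letters contributes an adjacent `+-`, which vanishes. A `-` put in
front of a reduced word survives, and a `+` can cancel only against the first sign of that word. -/
theorem signatureFrom_cons (i k : ℕ) (c : Finset ℕ) (b : ColProd) :
    signatureFrom i k (c :: b) =
      if IsMinus i c then (i + 1, k) :: signatureFrom i (k + 1) b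
      else if IsPlus i c then cancelStep i (i, k) (signatureFrom i (k + 1) b)
      else signatureFrom i (k + 1) b := by
  have key : ∀ s : List (ℕ × ℕ), cancelStep i (i + 1, k) s = (i + 1, k) :: s := by
    intro s
    cases s <;> simp [cancelStep]
  by_cases h1 : i ∈ c <;> by_cases h2 : i + 1 ∈ c <;>
    simp [signatureFrom, letters, h1, h2, cancel_cons, IsMinus, IsPlus, key]
  simp [cancelStep]

/-- The positions of the signs `-` and of the signs `+` in the `i`-signature. -/
def signs (i k : ℕ) : ColProd → List ℕ × List ℕ
  | [] => ([], [])
  | c :: b =>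
    let s := signs i (k + 1) b
    if IsMinus i c then (k :: s.1, s.2)
    else if IsPlus i c then
      match s.1 with
      | [] => ([], k :: s.2)
      | _ :: l => (l, s.2)
    else s

/-- A word without a factor `+-` has the shape `-⋯-+⋯+`, so the positions of the two kinds of signs
determine it. -/
theorem signatureFrom_eq_signs (i k : ℕ) (b : ColProd) :
    signatureFrom i k b = (signs i k b).1.map (fun p => (i + 1, p)) ++
      (signs i k b).2.map (fun p => (i, p)) := by
  induction b generalizing k with
  | nil => simp [signatureFrom, signs, cancel]
  | cons c b ih =>
    rw [signatureFrom_cons, signs, ih (k + 1)]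
    split_ifs with h1 h2
    · simp
    · rcases h : (signs i (k + 1) b).1 with _ | ⟨a, l⟩
      · rcases h' : (signs i (k + 1) b).2 with _ | ⟨a', l'⟩ <;> simp [cancelStep]
      · simp [cancelStep]
    · rfl

theorem length_signs (i k : ℕ) (b : ColProd) : (signs i k b).1.length = eps i b := by
  induction b generalizing k with
  | nil => simp [signs, eps]
  | cons c b ih =>
    rw [signs, eps, ← ih (k + 1)]
    split_ifs with h1 h2
    · simp
    · rcases h : (signs i (k + 1) b).1 with _ | ⟨a, l⟩ <;> simp
    · rfl

theorem signs_one_ge (i k : ℕ) (b : ColProd) : ∀ p ∈ (signs i k b).1 ++ (signs i k b).2, k ≤ p := by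
  induction b generalizing k with
  | nil => simp [signs]
  | cons c b ih =>
    have := ih (k + 1)
    rw [signs]
    split_ifs with h1 h2
    · simp at this ⊢; grind
    · rcases h : (signs i (k + 1) b).1 with _ | ⟨a, l⟩ <;> simp [h] at this ⊢ <;> grind
    · grind

theorem raise_eq_getLast (i : ℕ) (b : ColProd) :
    raise i b = (signs i 0 b).1.getLast?.map fun p => b.modify p (up i) := by
  rw [raise, signature_eq, signatureFrom_eq_signs, List.filter_append, List.filter_map,
    List.filter_map]
  simp only [Function.comp_def]
  simp [List.getLast?_map, Option.map_map, Function.comp_def]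
  rfl

theorem lower_eq_head (i : ℕ) (b : ColProd) :
    lower i b = (signs i 0 b).2.head?.map fun p => b.modify p (dn i) := by
  rw [lower, signature_eq, signatureFrom_eq_signs, List.filter_append, List.filter_map,
    List.filter_map]
  simp only [Function.comp_def]
  simp [List.head?_map, Option.map_map, Function.comp_def]
  rfl

theorem map_modify_cons {g : Finset ℕ → Finset ℕ} (o : Option ℕ) (k : ℕ) (c : Finset ℕ)
    (b : ColProd) (h : ∀ p ∈ o, k + 1 ≤ p) :
    o.map (fun p => (c :: b).modify (p - k) g) =
      (o.map fun p => b.modify (p - (k + 1)) g).map (c :: ·) := by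
  cases o with
  | none => rfl
  | some p =>
    have : k + 1 ≤ p := h p rfl
    obtain ⟨q, rfl⟩ := Nat.exists_eq_add_of_le this
    simp [show k + 1 + q - k = q + 1 by omega]

/-- The rightmost `-` sits in the head column only if the tail has none. A `+` in the head cancels
the first `-` of the tail, which is also the last one exactly when there is only one. -/
theorem getLast_signs (i k : ℕ) (b : ColProd) :
    ((signs i k b).1.getLast?.map fun p => b.modify (p - k) (up i)) = raiseRec i b := by
  induction b generalizing k with
  | nil => simp [signs, raiseRec]
  | cons c b ih =>
    have hl := length_signs i (k + 1) b
    have hge := signs_one_ge i (k + 1) b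
    rw [signs, raiseRec, ← ih (k + 1)]
    have gen : ∀ o : Option ℕ, (∀ p ∈ o, p ∈ (signs i (k + 1) b).1) →
        o.map (fun p => (c :: b).modify (p - k) (up i)) =
        (o.map fun p => b.modify (p - (k + 1)) (up i)).map (c :: ·) := fun o ho =>
      map_modify_cons o k c b fun p hp => hge p (List.mem_append_left _ (ho p hp))
    have gl := gen ((signs i (k + 1) b).1.getLast?) (fun p hp => List.mem_of_getLast? hp)
    by_cases h1 : IsMinus i c
    · have h1' : ¬ IsPlus i c := h1.not_isPlus
      rcases h : (signs i (k + 1) b).1 with _ | ⟨a, l⟩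
      · simp [h1, ← hl, h]
      · rw [h] at gl hl
        simp only [h1, h1', ← hl]
        simpa using gl
    · by_cases h2 : IsPlus i c
      · rcases h : (signs i (k + 1) b).1 with _ | ⟨a, _ | ⟨a', l⟩⟩
        · simp [h1, h2, ← hl, h]
        · simp [h1, h2, ← hl, h]
        · rw [h] at gl hl
          simp only [h1, h2, ← hl]
          simpa using gl
      · simpa [h1, h2] using gl

theorem head_signs (i k : ℕ) (b : ColProd) :
    ((signs i k b).2.head?.map fun p => b.modify (p - k) (dn i)) = lowerRec i b := by
  induction b generalizing k with
  | nil => simp [signs, lowerRec]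
  | cons c b ih =>
    have hl := length_signs i (k + 1) b
    have hge := signs_one_ge i (k + 1) b
    rw [signs, lowerRec, ← ih (k + 1)]
    have gl := map_modify_cons (g := dn i) ((signs i (k + 1) b).2.head?) k c b
      fun p hp => hge p (List.mem_append_right _ (List.mem_of_head? hp))
    by_cases h1 : IsMinus i c
    · have h1' : ¬ IsPlus i c := h1.not_isPlus
      simpa [h1, h1'] using gl
    · by_cases h2 : IsPlus i c
      · rcases h : (signs i (k + 1) b).1 with _ | ⟨a, l⟩
        · simp [h1, h2, ← hl, h]
        · simpa [h1, h2, ← hl, h] using gl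
      · simpa [h1, h2] using gl

theorem raise_eq (i : ℕ) (b : ColProd) : raise i b = raiseRec i b := by
  rw [raise_eq_getLast, ← getLast_signs i 0]; rfl

theorem lower_eq (i : ℕ) (b : ColProd) : lower i b = lowerRec i b := by
  rw [lower_eq_head, ← head_signs i 0]; rfl

theorem raise_nil (i : ℕ) : raise i [] = none := by rw [raise_eq]; rfl
theorem lower_nil (i : ℕ) : lower i [] = none := by rw [lower_eq]; rfl

theorem raise_cons (i : ℕ) (c : Finset ℕ) (b : ColProd) :
    raise i (c :: b) = if IsMinus i c ∧ eps i b = 0 then some (up i c :: b)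
      else if IsPlus i c ∧ eps i b = 1 then none else (raise i b).map (c :: ·) := by
  simp only [raise_eq]; rfl

theorem lower_cons (i : ℕ) (c : Finset ℕ) (b : ColProd) :
    lower i (c :: b) = if IsPlus i c ∧ eps i b = 0 then some (dn i c :: b)
      else (lower i b).map (c :: ·) := by
  simp only [lower_eq]; rfl

/-! ## Tensor product rule -/

/-- The surviving `+` of `u` cancel against the surviving `-` of `v`, and truncated subtraction
counts what is left. The rules below for `phi`, `raise` and `lower` on a tensor product have the
same source. -/
theorem eps_append (i : ℕ) (u v : ColProd) : eps i (u ++ v) = eps i u + (eps i v - phi i u) := by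
  induction u with
  | nil => simp [eps, phi]
  | cons c u ih =>
    simp only [List.cons_append, eps, phi, ih]
    split_ifs <;> first | omega | grind [IsMinus.not_isPlus]

theorem phi_append (i : ℕ) (u v : ColProd) : phi i (u ++ v) = phi i v + (phi i u - eps i v) := by
  induction u with
  | nil => simp [phi]
  | cons c u ih =>
    simp only [List.cons_append, phi, ih, eps_append]
    split_ifs <;> first | omega | grind [IsMinus.not_isPlus]

theorem raise_eq_none (i : ℕ) (b : ColProd) : raise i b = none ↔ eps i b = 0 := by
  induction b with
  | nil => simp [raise_nil, eps]
  | cons c b ih =>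
    rw [raise_cons, eps]
    split_ifs <;> simp [ih] <;> grind [IsMinus.not_isPlus]

theorem lower_eq_none (i : ℕ) (b : ColProd) : lower i b = none ↔ phi i b = 0 := by
  induction b with
  | nil => simp [lower_nil, phi]
  | cons c b ih =>
    rw [lower_cons, phi]
    split_ifs <;> simp [ih]

theorem raise_append (i : ℕ) (u v : ColProd) :
    raise i (u ++ v) = if eps i v ≤ phi i u then (raise i u).map (· ++ v)
      else (raise i v).map (u ++ ·) := by
  induction u with
  | nil =>
    by_cases h : eps i v = 0
    · simp [phi, raise_nil, h, (raise_eq_none i v).2 h]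
    · simp [phi, h]
  | cons c u ih =>
    rw [List.cons_append, raise_cons, ih, phi, eps_append, raise_cons]
    by_cases h1 : IsMinus i c
    · have h2 : ¬ IsPlus i c := h1.not_isPlus
      by_cases h3 : eps i u = 0 <;> by_cases h4 : eps i v ≤ phi i u <;>
        simp [h1, h2, h3, h4, Option.map_map, Function.comp_def] <;> omega
    · by_cases h2 : IsPlus i c
      · by_cases h3 : eps i u = 0
        · have hn := (raise_eq_none i u).2 h3
          rcases lt_trichotomy (eps i v) (phi i u + 1) with h4 | h4 | h4
          · simp [h1, h2, h3, hn, show eps i v ≤ phi i u by omega,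
              show eps i v ≤ phi i u + 1 by omega]
          · simp [h1, h2, h3, hn, h4]
          · simp [h1, h2, h3, show ¬ eps i v ≤ phi i u by omega,
              show ¬ eps i v ≤ phi i u + 1 by omega, show ¬ eps i v - phi i u = 1 by omega,
              Option.map_map, Function.comp_def]
        · by_cases h4 : eps i v ≤ phi i u
          · by_cases h5 : eps i u = 1 <;>
              simp [h1, h2, h3, h4, h5, Option.map_map, Function.comp_def]
          · have : ¬ (eps i u + (eps i v - phi i u) = 1) := by omega
            simp [h1, h2, h3, h4, this, Option.map_map, Function.comp_def]
      · by_cases h4 : eps i v ≤ phi i u <;>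
          simp [h1, h2, h4, Option.map_map, Function.comp_def]

theorem lower_append (i : ℕ) (u v : ColProd) :
    lower i (u ++ v) = if eps i v < phi i u then (lower i u).map (· ++ v)
      else (lower i v).map (u ++ ·) := by
  induction u with
  | nil => simp [phi]
  | cons c u ih =>
    rw [List.cons_append, lower_cons, ih, phi, eps_append, lower_cons]
    by_cases h2 : IsPlus i c
    · by_cases h3 : eps i u = 0
      · rcases lt_trichotomy (eps i v) (phi i u) with h4 | h4 | h4
        · simp [h2, h3, show eps i v ≤ phi i u by omega, show eps i v < phi i u + 1 by omega]
        · simp [h2, h3, h4]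
        · simp [h2, h3, show ¬ eps i v - phi i u = 0 by omega,
            show ¬ eps i v < phi i u + 1 by omega, show ¬ eps i v < phi i u by omega,
            Option.map_map, Function.comp_def]
      · by_cases h4 : eps i v < phi i u <;>
          simp [h3, h4, Option.map_map, Function.comp_def]
    · by_cases h4 : eps i v < phi i u <;>
          simp [h2, h4, Option.map_map, Function.comp_def]


/-! ### Raising and lowering are partial inverses. -/

theorem isPlus_up {i : ℕ} {c : Finset ℕ} : IsPlus i (up i c) := by simp [IsPlus, mem_up]

theorem isMinus_dn {i : ℕ} {c : Finset ℕ} : IsMinus i (dn i c) := by simp [IsMinus, mem_dn]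

theorem dn_up {i : ℕ} {c : Finset ℕ} (h : IsMinus i c) : dn i (up i c) = c := by
  ext a; simp only [mem_dn, mem_up]; have := h.1; have := h.2; grind

theorem up_dn {i : ℕ} {c : Finset ℕ} (h : IsPlus i c) : up i (dn i c) = c := by
  ext a; simp only [mem_dn, mem_up]; have := h.1; have := h.2; grind

theorem eps_of_raise {i : ℕ} {b b' : ColProd} (h : raise i b = some b') :
    eps i b' + 1 = eps i b := by
  induction b generalizing b' with
  | nil => simp [raise_nil] at h
  | cons c b ih =>
    rw [raise_cons] at h
    split_ifs at h with h1 h2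
    · obtain rfl := Option.some.inj h
      have := (isPlus_up (i := i) (c := c))
      have h3 : ¬ IsMinus i (up i c) := fun h => h.not_isPlus this
      simp [eps, h1.1, h3, this, h1.2]
    · rcases hr : raise i b with _ | b1
      · simp [hr] at h
      · obtain rfl : c :: b1 = b' := by simpa [hr] using h
        have := ih hr
        rw [eps, eps]
        split_ifs <;> grind

theorem lower_of_raise {i : ℕ} {b b' : ColProd} (h : raise i b = some b') :
    lower i b' = some b := by
  induction b generalizing b' with
  | nil => simp [raise_nil] at h
  | cons c b ih =>
    rw [raise_cons] at h
    split_ifs at h with h1 h2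
    · obtain rfl := Option.some.inj h
      rw [lower_cons, if_pos ⟨isPlus_up, h1.2⟩, dn_up h1.1]
    · rcases hr : raise i b with _ | b1
      · simp [hr] at h
      · obtain rfl : c :: b1 = b' := by simpa [hr] using h
        have := eps_of_raise hr
        rw [lower_cons, if_neg, ih hr]
        · rfl
        · grind

theorem raise_of_lower {i : ℕ} {b b' : ColProd} (h : lower i b = some b') :
    raise i b' = some b := by
  induction b generalizing b' with
  | nil => simp [lower_nil] at h
  | cons c b ih =>
    rw [lower_cons] at h
    split_ifs at h with h1
    · obtain rfl := Option.some.inj h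
      rw [raise_cons, if_pos ⟨isMinus_dn, h1.2⟩, up_dn h1.1]
    · rcases hr : lower i b with _ | b1
      · simp [hr] at h
      · obtain rfl : c :: b1 = b' := by simpa [hr] using h
        have := eps_of_raise (ih hr)
        rw [raise_cons, if_neg, if_neg, ih hr]
        · rfl
        · grind
        · grind

/-- Each crystal operator changes a letter of one column. -/
theorem raise_eq_some {i : ℕ} {b b' : ColProd} (h : raise i b = some b') :
    ∃ u c v, b = u ++ c :: v ∧ IsMinus i c ∧ b' = u ++ up i c :: v := by
  induction b generalizing b' with
  | nil => simp [raise_nil] at h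
  | cons c b ih =>
    rw [raise_cons] at h
    split_ifs at h with h1 h2
    · obtain rfl := Option.some.inj h
      exact ⟨[], c, b, rfl, h1.1, rfl⟩
    · rcases hr : raise i b with _ | b1
      · simp [hr] at h
      · obtain rfl : c :: b1 = b' := by simpa [hr] using h
        obtain ⟨u, c', v, rfl, h3, rfl⟩ := ih hr
        exact ⟨c :: u, c', v, rfl, h3, rfl⟩

/-- All columns have their entries in `{1, …, n}`. -/
def Bounded (n : ℕ) (b : ColProd) : Prop := ∀ c ∈ b, c ⊆ Finset.Icc 1 n

theorem card_up {i : ℕ} {c : Finset ℕ} (h : IsMinus i c) : (up i c).card = c.card := by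
  rw [up, Finset.card_insert_of_notMem (by simp [h.2]), Finset.card_erase_add_one h.1]

theorem up_subset {n i : ℕ} {c : Finset ℕ} (h1 : 1 ≤ i) (hn : i < n) (h : c ⊆ Finset.Icc 1 n) :
    up i c ⊆ Finset.Icc 1 n := by
  intro a ha
  rcases mem_up.1 ha with rfl | ha
  · simp; omega
  · exact h ha.2

theorem dn_subset {n i : ℕ} {c : Finset ℕ} (hn : i < n) (h : c ⊆ Finset.Icc 1 n) :
    dn i c ⊆ Finset.Icc 1 n := by
  intro a ha
  rcases mem_dn.1 ha with rfl | ha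
  · simp; omega
  · exact h ha.2

theorem map_card_of_raise {i : ℕ} {b b' : ColProd} (h : raise i b = some b') :
    b'.map Finset.card = b.map Finset.card := by
  obtain ⟨u, c, v, rfl, h3, rfl⟩ := raise_eq_some h
  simp [card_up h3]

theorem map_card_of_lower {i : ℕ} {b b' : ColProd} (h : lower i b = some b') :
    b'.map Finset.card = b.map Finset.card := (map_card_of_raise (raise_of_lower h)).symm

theorem length_of_raise {i : ℕ} {b b' : ColProd} (h : raise i b = some b') :
    b'.length = b.length := by simpa using congrArg List.length (map_card_of_raise h)

theorem length_of_lower {i : ℕ} {b b' : ColProd} (h : lower i b = some b') :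
    b'.length = b.length := (length_of_raise (raise_of_lower h)).symm

theorem Bounded.raise {n i : ℕ} {b b' : ColProd} (hb : Bounded n b) (h1 : 1 ≤ i) (hn : i < n)
    (h : raise i b = some b') : Bounded n b' := by
  obtain ⟨u, c, v, rfl, h3, rfl⟩ := raise_eq_some h
  intro d hd
  rcases List.mem_append.1 hd with hd | hd
  · exact hb d (by simp [hd])
  · rcases List.mem_cons.1 hd with rfl | hd
    · exact up_subset h1 hn (hb c (by simp))
    · exact hb d (by simp [hd])

theorem Bounded.lower {n i : ℕ} {b b' : ColProd} (hb : Bounded n b) (hn : i < n)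
    (h : lower i b = some b') : Bounded n b' := by
  obtain ⟨u, c, v, rfl, h3, rfl⟩ := raise_eq_some (raise_of_lower h)
  intro d hd
  rcases List.mem_append.1 hd with hd | hd
  · exact hb d (by simp [hd])
  · rcases List.mem_cons.1 hd with rfl | hd
    · rw [← dn_up h3]
      exact dn_subset hn (hb _ (by simp))
    · exact hb d (by simp [hd])

/-- The sum of all letters. -/
def letterSum (b : ColProd) : ℕ := (b.map fun c => ∑ a ∈ c, a).sum

/-- The measure for every climb to a highest weight element. -/
theorem letterSum_of_raise {i : ℕ} {b b' : ColProd} (h : raise i b = some b') :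
    letterSum b' < letterSum b := by
  obtain ⟨u, c, v, rfl, h3, rfl⟩ := raise_eq_some h
  have : ∑ a ∈ up i c, a < ∑ a ∈ c, a := by
    rw [up, Finset.sum_insert (by simp [h3.2]), ← Finset.add_sum_erase c _ h3.1]
    omega
  simp [letterSum]
  omega

/-- The number of `+` minus the number of `-` is the weight. -/
theorem weight_eq (i : ℕ) (b : ColProd) : weight i b = phi i b - eps i b := by
  induction b with
  | nil => simp [weight, mult, phi, eps]
  | cons c b ih =>
    simp only [weight, mult, List.countP_cons, phi, eps] at ih ⊢
    by_cases h1 : i ∈ c <;> by_cases h2 : i + 1 ∈ c <;> by_cases h3 : eps i b = 0 <;>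
      simp only [h1, h2, h3, IsMinus, IsPlus] <;> simp <;> omega

/-! ## Sliding letters between two columns -/

/-- Read the letters `1, …, a` of the pair `(x, y)`, starting from `θ`: add one for every letter
that is only in `y`, and subtract one (if possible) for every letter that is only in `x`. -/
def gap (θ : ℕ) (x y : Finset ℕ) : ℕ → ℕ
  | 0 => θ
  | a + 1 =>
    if a + 1 ∈ x ∧ a + 1 ∉ y then gap θ x y a - 1
    else if a + 1 ∈ y ∧ a + 1 ∉ x then gap θ x y a + 1 else gap θ x y a

/-- The letters of `x` that are not in `y` and that are met when the gap is zero. -/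
def moved (m θ : ℕ) (x y : Finset ℕ) : Finset ℕ :=
  (Finset.Icc 1 m).filter fun a => (a ∈ x ∧ a ∉ y) ∧ gap θ x y (a - 1) = 0

/-- The left column after sliding. -/
def slideL (m θ : ℕ) (x y : Finset ℕ) : Finset ℕ := x \ moved m θ x y

/-- The right column after sliding. -/
def slideR (m θ : ℕ) (x y : Finset ℕ) : Finset ℕ := y ∪ moved m θ x y

theorem mem_moved {m θ a : ℕ} {x y : Finset ℕ} :
    a ∈ moved m θ x y ↔ (1 ≤ a ∧ a ≤ m) ∧ (a ∈ x ∧ a ∉ y) ∧ gap θ x y (a - 1) = 0 := by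
  simp [moved]

theorem mem_slideL {m θ a : ℕ} {x y : Finset ℕ} :
    a ∈ slideL m θ x y ↔ a ∈ x ∧ a ∉ moved m θ x y := Finset.mem_sdiff

theorem mem_slideR {m θ a : ℕ} {x y : Finset ℕ} :
    a ∈ slideR m θ x y ↔ a ∈ y ∨ a ∈ moved m θ x y := Finset.mem_union

theorem eps_pair (i : ℕ) (x y : Finset ℕ) : eps i [x, y] =
    if IsMinus i x then (if IsMinus i y then 2 else 1)
    else if IsMinus i y ∧ ¬ IsPlus i x then 1 else 0 := by
  simp only [eps]
  split_ifs <;> simp_all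

theorem phi_pair (i : ℕ) (x y : Finset ℕ) : phi i [x, y] =
    if IsPlus i y then (if IsPlus i x then 2 else 1)
    else if IsPlus i x ∧ ¬ IsMinus i y then 1 else 0 := by
  simp only [eps, phi]
  by_cases h : IsMinus i y
  · have := h.not_isPlus
    simp [h, this]
  · simp [h]
    split_ifs <;> simp_all

theorem lower_pair (i : ℕ) (x y : Finset ℕ) : lower i [x, y] =
    if IsPlus i x ∧ ¬ IsMinus i y then some [dn i x, y]
    else if IsPlus i y then some [x, dn i y] else none := by
  simp only [lower_cons, lower_nil, eps]
  by_cases h : IsMinus i y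
  · have := h.not_isPlus
    simp [h, this]
  · simp [h]

theorem gap_congr {θ k : ℕ} {x y x' y' : Finset ℕ}
    (h : ∀ a ≤ k, (a ∈ x' ↔ a ∈ x) ∧ (a ∈ y' ↔ a ∈ y)) : gap θ x' y' k = gap θ x y k := by
  induction k with
  | zero => rfl
  | succ k ih =>
    have h1 := h (k + 1) le_rfl
    simp only [gap, h1, ih fun a ha => h a (by omega)]

theorem gap_congr_from {θ k l : ℕ} {x y x' y' : Finset ℕ} (h0 : gap θ x' y' k = gap θ x y k)
    (hkl : k ≤ l) (h : ∀ a, k < a → (a ∈ x' ↔ a ∈ x) ∧ (a ∈ y' ↔ a ∈ y)) :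
    gap θ x' y' l = gap θ x y l := by
  induction l, hkl using Nat.le_induction with
  | base => exact h0
  | succ l hl ih =>
    have h1 := h (l + 1) (by omega)
    simp only [gap, h1, ih]

/-- Two pairs that differ only in the letters `i` and `i + 1`, and with the same gap at `i + 1`. -/
structure SameOff (θ i : ℕ) (x y x' y' : Finset ℕ) : Prop where
  mem_iff : ∀ a, a ≠ i → a ≠ i + 1 → (a ∈ x' ↔ a ∈ x) ∧ (a ∈ y' ↔ a ∈ y)
  gap_eq : gap θ x' y' (i + 1) = gap θ x y (i + 1)

theorem SameOff.gap {θ i : ℕ} {x y x' y' : Finset ℕ} (h : SameOff θ i x y x' y') {k : ℕ}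
    (hk : k ≠ i) : gap θ x' y' k = gap θ x y k := by
  rcases lt_or_gt_of_ne hk with hk | hk
  · exact gap_congr fun a ha => h.mem_iff a (by omega) (by omega)
  · exact gap_congr_from h.gap_eq hk fun a ha => h.mem_iff a (by omega) (by omega)

theorem SameOff.mem_moved {θ i m : ℕ} {x y x' y' : Finset ℕ} (h : SameOff θ i x y x' y') {a : ℕ}
    (h1 : a ≠ i) (h2 : a ≠ i + 1) : a ∈ moved m θ x' y' ↔ a ∈ moved m θ x y := by
  rw [ColumnCrystal.mem_moved, ColumnCrystal.mem_moved, (h.mem_iff a h1 h2).1,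
    (h.mem_iff a h1 h2).2]
  refine and_congr_right fun h3 => ?_
  rw [h.gap (by omega)]

theorem mem_moved_self {m θ i : ℕ} {x y : Finset ℕ} (h1 : 1 ≤ i) (hm : i < m) :
    i ∈ moved m θ x y ↔ (i ∈ x ∧ i ∉ y) ∧ gap θ x y (i - 1) = 0 := by
  rw [mem_moved]; simp; omega

theorem mem_moved_succ {m θ i : ℕ} {x y : Finset ℕ} (hm : i < m) :
    i + 1 ∈ moved m θ x y ↔ (i + 1 ∈ x ∧ i + 1 ∉ y) ∧ gap θ x y i = 0 := by
  rw [mem_moved]; simp; omega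

theorem gap_self {θ i : ℕ} {x y : Finset ℕ} (h1 : 1 ≤ i) : gap θ x y i =
    if i ∈ x ∧ i ∉ y then gap θ x y (i - 1) - 1
    else if i ∈ y ∧ i ∉ x then gap θ x y (i - 1) + 1 else gap θ x y (i - 1) := by
  obtain ⟨k, rfl⟩ := Nat.exists_eq_add_of_le' h1
  rfl

/-- Only the memberships of `i` and `i + 1` and the gap before `i` enter, and of this gap only
whether it is `0`, `1` or larger: a finite check. -/
theorem eps_phi_slide {m θ i : ℕ} (x y : Finset ℕ) (h1 : 1 ≤ i) (hm : i < m) :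
    eps i [slideL m θ x y, slideR m θ x y] = eps i [x, y] ∧
      phi i [slideL m θ x y, slideR m θ x y] = phi i [x, y] := by
  simp only [eps_pair, phi_pair, IsMinus, IsPlus, mem_slideL, mem_slideR, mem_moved_self h1 hm,
    mem_moved_succ hm, gap_self h1]
  generalize gap θ x y (i - 1) = g
  by_cases a1 : i ∈ x <;> by_cases a2 : i ∈ y <;> by_cases a3 : i + 1 ∈ x <;>
    by_cases a4 : i + 1 ∈ y <;> rcases g with _ | _ | g <;> simp [a1, a2, a3, a4]

/-- Both before and after the change, the two letters together have the same effect on the gap. The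
excluded configuration (`i` only in `x`, `i + 1` only in `y`) is the one where a decrement precedes
an increment, so that truncation at zero would be felt; in the companion lemma for the right factor
this would happen after the change. -/
theorem sameOff_dn_left {θ i : ℕ} {x y : Finset ℕ} (h1 : 1 ≤ i) (hP : IsPlus i x)
    (hM : ¬ IsMinus i y) : SameOff θ i x y (dn i x) y := by
  have g0 : gap θ (dn i x) y (i - 1) = gap θ x y (i - 1) :=
    gap_congr fun a ha => ⟨by rw [mem_dn]; grind, Iff.rfl⟩
  obtain ⟨a1, a2⟩ := hP
  refine ⟨fun a ha ha' => ⟨by simp [mem_dn, ha, ha'], Iff.rfl⟩, ?_⟩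
  have b1 : i ∉ dn i x := by simp [mem_dn]
  have b2 : i + 1 ∈ dn i x := by simp [mem_dn]
  simp only [gap, gap_self h1, g0, b1, b2, a1, a2]
  generalize gap θ x y (i - 1) = g
  simp only [IsMinus] at hM
  by_cases c1 : i ∈ y <;> by_cases c2 : i + 1 ∈ y <;> simp_all

theorem sameOff_dn_right {θ i : ℕ} {x y : Finset ℕ} (h1 : 1 ≤ i) (hP : IsPlus i y)
    (hM : ¬ IsPlus i x) : SameOff θ i x y x (dn i y) := by
  have g0 : gap θ x (dn i y) (i - 1) = gap θ x y (i - 1) :=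
    gap_congr fun a ha => ⟨Iff.rfl, by rw [mem_dn]; grind⟩
  obtain ⟨a1, a2⟩ := hP
  refine ⟨fun a ha ha' => ⟨Iff.rfl, by simp [mem_dn, ha, ha']⟩, ?_⟩
  have b1 : i ∉ dn i y := by simp [mem_dn]
  have b2 : i + 1 ∈ dn i y := by simp [mem_dn]
  simp only [gap, gap_self h1, g0, b1, b2, a1, a2]
  generalize gap θ x y (i - 1) = g
  simp only [IsPlus] at hM
  by_cases c1 : i ∈ x <;> by_cases c2 : i + 1 ∈ x <;> simp_all

theorem lower_slide_left {m θ i : ℕ} {x y : Finset ℕ} (h1 : 1 ≤ i) (hm : i < m)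
    (hP : IsPlus i x) (hM : ¬ IsMinus i y) :
    lower i [slideL m θ x y, slideR m θ x y] =
      some [slideL m θ (dn i x) y, slideR m θ (dn i x) y] := by
  have hs := sameOff_dn_left (θ := θ) h1 hP hM
  have e5 := fun a => hs.mem_moved (m := m) (a := a)
  have e1 : i ∈ moved m θ x y ↔ _ := mem_moved_self h1 hm
  have e2 : i + 1 ∈ moved m θ x y ↔ _ := mem_moved_succ hm
  have e3 : i ∈ moved m θ (dn i x) y ↔ _ := mem_moved_self h1 hm
  have e4 : i + 1 ∈ moved m θ (dn i x) y ↔ _ := mem_moved_succ hm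
  rw [gap_self h1] at e2 e4
  rw [hs.gap (by omega)] at e3 e4
  obtain ⟨a1, a2⟩ := hP
  have b1 : i ∉ dn i x := by simp [mem_dn]
  have b2 : i + 1 ∈ dn i x := by simp [mem_dn]
  rw [lower_pair]
  simp only [IsMinus, IsPlus, mem_slideL, mem_slideR] at hM ⊢
  simp only [a1, a2, b1, b2] at e1 e2 e3 e4 ⊢
  -- All memberships are now expressed through the gap before `i`, and only its vanishing matters.
  generalize gap θ x y (i - 1) = g at *
  clear hs
  by_cases c1 : i ∈ y <;> by_cases c2 : i + 1 ∈ y <;> by_cases hg : g = 0 <;>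
    simp [c1, c2, hg] at e1 e2 e3 e4 hM ⊢ <;> simp only [e1, e2] <;> simp <;>
    (constructor <;> ext a <;> by_cases p : a = i <;>
      by_cases q : a = i + 1 <;> grind [mem_dn, mem_slideL, mem_slideR])

theorem lower_slide_right {m θ i : ℕ} {x y : Finset ℕ} (h1 : 1 ≤ i) (hm : i < m)
    (hP : IsPlus i y) (hM : ¬ IsPlus i x) :
    lower i [slideL m θ x y, slideR m θ x y] =
      some [slideL m θ x (dn i y), slideR m θ x (dn i y)] := by
  have hs := sameOff_dn_right (θ := θ) h1 hP hM
  have e5 := fun a => hs.mem_moved (m := m) (a := a)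
  have e1 : i ∈ moved m θ x y ↔ _ := mem_moved_self h1 hm
  have e2 : i + 1 ∈ moved m θ x y ↔ _ := mem_moved_succ hm
  have e3 : i ∈ moved m θ x (dn i y) ↔ _ := mem_moved_self h1 hm
  have e4 : i + 1 ∈ moved m θ x (dn i y) ↔ _ := mem_moved_succ hm
  rw [gap_self h1] at e2 e4
  rw [hs.gap (by omega)] at e3 e4
  obtain ⟨a1, a2⟩ := hP
  have b1 : i ∉ dn i y := by simp [mem_dn]
  have b2 : i + 1 ∈ dn i y := by simp [mem_dn]
  rw [lower_pair]
  simp only [IsMinus, IsPlus, mem_slideL, mem_slideR] at hM ⊢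
  simp only [a1, a2, b1, b2] at e1 e2 e3 e4 ⊢
  generalize gap θ x y (i - 1) = g at *
  clear hs
  by_cases c1 : i ∈ x <;> by_cases c2 : i + 1 ∈ x <;> by_cases hg : g = 0 <;>
    simp [c1, c2, hg] at e1 e2 e3 e4 hM ⊢ <;> simp only [e1, e2] <;> simp <;>
    (constructor <;> ext a <;> by_cases p : a = i <;>
      by_cases q : a = i + 1 <;> grind [mem_dn, mem_slideL, mem_slideR])

/-- The pair `x'`, `y'` is the result of `lower` itself, hence the same for all `θ`. The freedom in
`θ` serves both the R-matrix and the sliding of a single letter. -/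
theorem lower_slide {m θ i : ℕ} {x y : Finset ℕ} (h1 : 1 ≤ i) (hm : i < m) {z : ColProd}
    (h : lower i [x, y] = some z) :
    ∃ x' y', z = [x', y'] ∧ gap θ x' y' m = gap θ x y m ∧
      lower i [slideL m θ x y, slideR m θ x y] = some [slideL m θ x' y', slideR m θ x' y'] := by
  rw [lower_pair] at h
  split_ifs at h with hA hB
  · obtain rfl := Option.some.inj h
    exact ⟨_, _, rfl, (sameOff_dn_left h1 hA.1 hA.2).gap (by omega),
      lower_slide_left h1 hm hA.1 hA.2⟩
  · obtain rfl := Option.some.inj h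
    have hx : ¬ IsPlus i x := fun h => hA ⟨h, fun h' => h'.not_isPlus hB⟩
    exact ⟨_, _, rfl, (sameOff_dn_right h1 hB hx).gap (by omega), lower_slide_right h1 hm hB hx⟩

/-! ## Counting functions, tableaux and legs -/

/-- Number of elements of `x` that are at most `a`. -/
def cnt (x : Finset ℕ) (a : ℕ) : ℕ := (x.filter (· ≤ a)).card

theorem cnt_succ (x : Finset ℕ) (a : ℕ) :
    cnt x (a + 1) = cnt x a + if a + 1 ∈ x then 1 else 0 := by
  unfold cnt
  have : x.filter (· ≤ a + 1) = x.filter (· ≤ a) ∪ x.filter (· = a + 1) := by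
    ext b; simp; grind
  rw [this, Finset.card_union_of_disjoint, Finset.filter_eq']
  · split_ifs <;> simp
  · rw [Finset.disjoint_left]; intro b; simp; grind

theorem cnt_zero {x : Finset ℕ} {m : ℕ} (hx : x ⊆ Finset.Icc 1 m) : cnt x 0 = 0 := by
  unfold cnt
  rw [Finset.card_eq_zero, Finset.filter_eq_empty_iff]
  intro a ha
  have := Finset.mem_Icc.1 (hx ha)
  omega

theorem cnt_eq_card {x : Finset ℕ} {m t : ℕ} (hx : x ⊆ Finset.Icc 1 m) (ht : m ≤ t) :
    cnt x t = x.card := by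
  unfold cnt
  rw [Finset.filter_true_of_mem]
  intro a ha
  have := Finset.mem_Icc.1 (hx ha)
  omega

theorem cnt_le_card (x : Finset ℕ) (t : ℕ) : cnt x t ≤ x.card := Finset.card_filter_le _ _

theorem getD_le_iff_lt_countP {l : List ℕ} (hl : l.Pairwise (· ≤ ·)) {r t : ℕ}
    (hr : r < l.length) : l.getD r 0 ≤ t ↔ r < l.countP (fun a => decide (a ≤ t)) := by
  induction l generalizing r with
  | nil => simp at hr
  | cons a l ih =>
    rw [List.pairwise_cons] at hl
    rw [List.countP_cons]
    by_cases ha : a ≤ t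
    · rcases r with _ | r
      · simp [ha]
      · simp only [List.getD_cons_succ, ha]
        rw [ih hl.2 (by simpa using hr)]
        simp
    · have h0 : l.countP (fun a => decide (a ≤ t)) = 0 := by
        rw [List.countP_eq_zero]
        intro b hb
        have := hl.1 b hb
        simp; omega
      rcases r with _ | r
      · simp only [List.getD_cons_zero, ha, h0]; simp
      · simp only [List.getD_cons_succ, ha]
        rw [ih hl.2 (by simpa using hr)]
        simp [h0]

theorem countP_sort (x : Finset ℕ) (t : ℕ) :
    (x.sort (· ≤ ·)).countP (fun a => decide (a ≤ t)) = cnt x t := by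
  have h : ((x.sort (· ≤ ·) : List ℕ) : Multiset ℕ).countP (· ≤ t) = cnt x t := by
    rw [Finset.sort_eq, Multiset.countP_eq_card_filter]
    rfl
  rw [← h, Multiset.coe_countP]

theorem sort_getD_le_iff (x : Finset ℕ) {r t : ℕ} (hr : r < x.card) :
    (x.sort (· ≤ ·)).getD r 0 ≤ t ↔ r < cnt x t := by
  rw [← countP_sort]
  exact getD_le_iff_lt_countP (Finset.pairwise_sort x _) (by simpa using hr)

/-- The entry in row `r` is at most `t` exactly when more than `r` letters are at most `t`, so
comparing rows amounts to comparing counting functions. -/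
theorem rightOf_iff (x y : Finset ℕ) : RightOf x y ↔ ∀ t, cnt x t ≤ cnt y t := by
  constructor
  · rintro ⟨hc, h⟩ t
    by_contra! hlt
    have h1 := cnt_le_card x t
    -- Rows are numbered from zero, so `cnt y t` is the first row whose entry in `y` exceeds `t`.
    have h2 := h (cnt y t) (by omega)
    have h3 := (sort_getD_le_iff x (r := cnt y t) (t := t) (by omega)).2 hlt
    have h4 := (sort_getD_le_iff y (r := cnt y t) (t := t) (by omega)).1 (h2.trans h3)
    omega
  · intro h
    have hc : x.card ≤ y.card := by
      have h1 := h (x.sup id)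
      have : cnt x (x.sup id) = x.card := by
        unfold cnt
        rw [Finset.filter_true_of_mem]
        intro a ha
        exact Finset.le_sup (f := id) ha
      have := cnt_le_card y (x.sup id)
      omega
    refine ⟨hc, fun r hr => ?_⟩
    rw [sort_getD_le_iff y (by omega)]
    exact lt_of_lt_of_le ((sort_getD_le_iff x hr).1 le_rfl) (h _)

theorem isSkewPair_iff {x y : Finset ℕ} {k : ℕ} : IsSkewPair x y k ↔
    k ≤ y.card ∧ y.card ≤ x.card + k ∧ ∀ t, cnt x t + y.card ≤ cnt y t + x.card + k := by
  unfold IsSkewPair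
  refine and_congr_right fun h1 => and_congr_right fun h2 => ?_
  constructor
  · intro h t
    by_contra! hlt
    have h3 := cnt_le_card x t
    have h4 := h (cnt y t) (by omega)
    have h5 := (sort_getD_le_iff x (r := x.card + k - y.card + cnt y t) (t := t) (by omega)).2
      (by omega)
    have h6 := (sort_getD_le_iff y (r := cnt y t) (t := t) (by omega)).1 (h4.trans h5)
    omega
  · intro h r hr
    rw [sort_getD_le_iff y (by omega)]
    have h3 := (sort_getD_le_iff x (r := x.card + k - y.card + r) (by omega)).1 le_rfl
    have h4 := h ((x.sort (· ≤ ·)).getD (x.card + k - y.card + r) 0)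
    omega

/-! ### The gap as a running maximum. -/

theorem gap_le (x y : Finset ℕ) (θ a : ℕ) : gap θ x y a ≤ θ + cnt y a := by
  induction a with
  | zero => simp [gap]
  | succ a ih =>
    rw [gap, cnt_succ]
    split_ifs <;> simp_all <;> omega

/-- The largest value, up to `a`, of the difference of the counting functions. -/
theorem cnt_le_gap {x y : Finset ℕ} {m : ℕ} (hx : x ⊆ Finset.Icc 1 m) (θ : ℕ) {s t : ℕ}
    (hst : s ≤ t) : cnt x s + cnt y t ≤ gap θ x y t + cnt x t + cnt y s := by
  induction t, hst using Nat.le_induction with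
  | base => omega
  | succ t ht ih =>
    rw [gap, cnt_succ, cnt_succ]
    have := cnt_zero hx
    split_ifs <;> simp_all <;> omega

/-- Together with `cnt_le_gap`: `gap 0 x y k + cnt x k - cnt y k` is the maximum of `cnt x - cnt y`
on `{0, …, k}`. It grows only when a letter of `x` alone is met at gap zero. -/
theorem gap_le_of_cnt {x y : Finset ℕ} {m k : ℕ} {d : ℤ} (hx : x ⊆ Finset.Icc 1 m)
    (hy : y ⊆ Finset.Icc 1 m) (hd : 0 ≤ d) (h : ∀ t, (cnt x t : ℤ) - cnt y t ≤ d) :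
    (gap 0 x y k : ℤ) + cnt x k - cnt y k ≤ d := by
  induction k with
  | zero => simpa [gap, cnt_zero hx, cnt_zero hy] using hd
  | succ k ih =>
    have := h (k + 1)
    rw [gap]
    rw [cnt_succ, cnt_succ] at *
    split_ifs at * <;> simp_all <;> omega

/-- A shift by `k` is admissible when `cnt x - cnt y` never exceeds `|x| - |y| + k`. The least such
`k` is the maximum minus `|x| - |y|`, which is the final gap. -/
theorem leg_eq {x y : Finset ℕ} {m : ℕ} (hx : x ⊆ Finset.Icc 1 m) (hy : y ⊆ Finset.Icc 1 m) :
    leg x y = gap 0 x y m := by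
  have cx : ∀ t, m ≤ t → cnt x t = x.card := fun t ht => cnt_eq_card hx ht
  have cy : ∀ t, m ≤ t → cnt y t = y.card := fun t ht => cnt_eq_card hy ht
  refine (IsLeast.csInf_eq ⟨?_, ?_⟩)
  · rw [Set.mem_ofPred_eq, isSkewPair_iff]
    have key : ∀ t, cnt x t + y.card ≤ cnt y t + x.card + gap 0 x y m := by
      intro t
      rcases le_total t m with ht | ht
      · have := cnt_le_gap (y := y) hx 0 ht
        rw [cx m le_rfl, cy m le_rfl] at this
        omega
      · rw [cx t ht, cy t ht]; omega
    refine ⟨?_, ?_, key⟩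
    · have := gap_le x y 0 m
      rw [cy m le_rfl] at this
      omega
    · have := key 0
      rw [cnt_zero hx, cnt_zero hy] at this
      omega
  · intro k hk
    rw [Set.mem_ofPred_eq, isSkewPair_iff] at hk
    obtain ⟨_, h2, h3⟩ := hk
    have := gap_le_of_cnt (k := m) (d := x.card + k - y.card) hx hy (by omega)
      (fun t => by have := h3 t; omega)
    rw [cx m le_rfl, cy m le_rfl] at this
    omega

/-- A starting value acts as a floor for the running maximum. -/
theorem gap_add {x y : Finset ℕ} {m : ℕ} (hx : x ⊆ Finset.Icc 1 m) (hy : y ⊆ Finset.Icc 1 m)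
    (θ a : ℕ) : (gap θ x y a : ℤ) + cnt x a - cnt y a =
      max (θ : ℤ) (gap 0 x y a + cnt x a - cnt y a) := by
  induction a with
  | zero => simp [gap, cnt_zero hx, cnt_zero hy]
  | succ a ih =>
    rw [gap, gap, cnt_succ, cnt_succ]
    by_cases h1 : a + 1 ∈ x <;> by_cases h2 : a + 1 ∈ y <;> simp [h1, h2] <;> omega

theorem gap_mono {x y : Finset ℕ} {θ θ' : ℕ} (h : θ ≤ θ') (a : ℕ) :
    gap θ x y a ≤ gap θ' x y a := by
  induction a with
  | zero => exact h
  | succ a ih => simp only [gap]; split_ifs <;> omega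

theorem moved_succ {x y : Finset ℕ} (a θ : ℕ) : moved (a + 1) θ x y =
    if (a + 1 ∈ x ∧ a + 1 ∉ y) ∧ gap θ x y a = 0 then insert (a + 1) (moved a θ x y)
    else moved a θ x y := by
  split_ifs with h <;> ext b <;> by_cases hb : b = a + 1 <;>
    simp only [mem_moved, Finset.mem_insert, hb] <;> simp [h] <;> omega

/-- The moved letters are exactly those at which the running maximum rises above its floor `θ`, each
time by one. -/
theorem card_moved {x y : Finset ℕ} {θ m : ℕ} (a : ℕ) (hx : x ⊆ Finset.Icc 1 m)
    (hy : y ⊆ Finset.Icc 1 m) :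
    ((moved a θ x y).card : ℤ) + θ = gap θ x y a + cnt x a - cnt y a := by
  induction a with
  | zero => simp [gap, cnt_zero hx, cnt_zero hy, moved]
  | succ a ih =>
    have h1 : a + 1 ∉ moved a θ x y := by simp [mem_moved]
    rw [moved_succ, gap, cnt_succ, cnt_succ]
    by_cases h1 : a + 1 ∈ x <;> by_cases h2 : a + 1 ∈ y <;> by_cases h3 : gap θ x y a = 0 <;>
      simp [*] at ih ⊢ <;> omega

/-! ## Highest weight elements and crystal isomorphisms -/

/-- `b` is a highest weight element. -/
def IsHighest (n : ℕ) (b : ColProd) : Prop := ∀ i, 1 ≤ i → i < n → eps i b = 0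

theorem sum_mult {n : ℕ} {b : ColProd} (hb : Bounded n b) :
    ∑ i ∈ Finset.Icc 1 n, mult i b = (b.map Finset.card).sum := by
  induction b with
  | nil => simp [mult]
  | cons c b ih =>
    have h1 : ∑ i ∈ Finset.Icc 1 n, (if i ∈ c then 1 else 0) = c.card := by
      rw [← Finset.sum_filter, Finset.filter_mem_eq_inter,
        Finset.inter_eq_right.2 (hb c (by simp))]
      simp
    rw [List.map_cons, List.sum_cons, ← ih fun d hd => hb d (by simp [hd]), ← h1,
      ← Finset.sum_add_distrib]
    refine Finset.sum_congr rfl fun i _ => ?_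
    simp [mult, List.countP_cons, add_comm]

/-- Equal weights make all the multiplicities differ by one common constant; the total number of
letters forces it to vanish. -/
theorem mult_eq_of_weight {n : ℕ} {z z' : ColProd} (hz : Bounded n z) (hz' : Bounded n z')
    (hc : (z.map Finset.card).sum = (z'.map Finset.card).sum)
    (hw : ∀ i, 1 ≤ i → i < n → weight i z = weight i z') {i : ℕ} (hi : i ∈ Finset.Icc 1 n) :
    mult i z = mult i z' := by
  have h1 : ∀ k, 1 ≤ k → k ≤ n → (mult k z : ℤ) - mult k z' = mult 1 z - mult 1 z' := by
    intro k hk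
    induction k, hk using Nat.le_induction with
    | base => simp
    | succ k hk ih =>
      intro hkn
      have h2 := hw k hk (by omega)
      have h3 := ih (by omega)
      unfold weight at h2
      omega
  have h2 : ∑ k ∈ Finset.Icc 1 n, ((mult k z : ℤ) - mult k z') = 0 := by
    rw [Finset.sum_sub_distrib, ← Nat.cast_sum, ← Nat.cast_sum, sum_mult hz, sum_mult hz', hc,
      sub_self]
  rw [Finset.sum_congr rfl fun k hk => h1 k (Finset.mem_Icc.1 hk).1 (Finset.mem_Icc.1 hk).2,
    Finset.sum_const, Nat.card_Icc, nsmul_eq_mul] at h2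
  rw [Finset.mem_Icc] at hi
  have h3 := h1 i hi.1 hi.2
  rcases mul_eq_zero.1 h2 with h | h
  · norm_cast at h; omega
  · omega

/-- The elements of `x` form an initial segment of the positive integers. -/
def IsInitial (x : Finset ℕ) : Prop := ∀ i, 1 ≤ i → i + 1 ∈ x → i ∈ x

theorem IsInitial.eq_Icc {x : Finset ℕ} {n : ℕ} (h : IsInitial x) (hx : x ⊆ Finset.Icc 1 n) :
    x = Finset.Icc 1 x.card := by
  have h1 : ∀ k a, 1 ≤ a → a + k ∈ x → a ∈ x := by
    intro k
    induction k with
    | zero => exact fun a _ h => h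
    | succ k ih => exact fun a ha hk => ih a ha (h (a + k) (by omega) hk)
  have h2 : x = Finset.Icc 1 (x.sup id) := by
    ext a
    rw [Finset.mem_Icc]
    refine ⟨fun ha => ⟨(Finset.mem_Icc.1 (hx ha)).1, Finset.le_sup (f := id) ha⟩, fun ha => ?_⟩
    have hne : x.Nonempty := by
      by_contra h0
      rw [Finset.not_nonempty_iff_eq_empty] at h0
      simp [h0] at ha
      omega
    obtain ⟨b, hb, hs⟩ := Finset.exists_mem_eq_sup x hne id
    refine h1 (b - a) a ha.1 ?_
    rw [hs] at ha
    have := ha.2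
    simp only [id] at this
    rwa [Nat.add_sub_cancel' this]
  have h3 : x.card = x.sup id := by rw [h2, Nat.card_Icc, ← h2]; simp
  rw [h3]; exact h2

/-- A `-` in the leftmost factor has nothing to its left that could cancel it. -/
theorem IsHighest.isInitial {n : ℕ} {x : Finset ℕ} {v : ColProd} (h : IsHighest n (x :: v))
    (hx : x ⊆ Finset.Icc 1 n) : IsInitial x := by
  intro i hi hx'
  have h1 := h i hi (by have := Finset.mem_Icc.1 (hx hx'); omega)
  by_contra hc
  rw [eps, if_pos ⟨hx', hc⟩] at h1
  omega

/-- `A` is stable under the crystal operators. -/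
def IsStable (n : ℕ) (A : Set ColProd) : Prop :=
  ∀ i, 1 ≤ i → i < n → ∀ z ∈ A, ∀ z', raise i z = some z' ∨ lower i z = some z' → z' ∈ A

theorem IsHighest.exists_raise {n : ℕ} {z : ColProd} (h : ¬ IsHighest n z) :
    ∃ i, 1 ≤ i ∧ i < n ∧ ∃ z', raise i z = some z' := by
  unfold IsHighest at h
  push Not at h
  obtain ⟨i, h1, h2, h3⟩ := h
  exact ⟨i, h1, h2, Option.ne_none_iff_exists'.1 (mt (raise_eq_none i z).1 h3)⟩

/-- `eps` is the number of times `raise` can be applied, so it is visible to any isomorphism. -/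
theorem IsCrystalIso.eps_eq {n i : ℕ} {A B : Set ColProd} {φ : ColProd → ColProd}
    (h : IsCrystalIso n A B φ) (hA : IsStable n A) (h1 : 1 ≤ i) (hn : i < n) {z : ColProd}
    (hz : z ∈ A) : eps i (φ z) = eps i z := by
  induction hk : eps i z generalizing z with
  | zero =>
    have := h.map_raise i h1 hn z hz
    rw [(raise_eq_none i z).2 hk] at this
    exact (raise_eq_none _ _).1 this
  | succ k ih =>
    obtain ⟨w, hw⟩ := Option.ne_none_iff_exists'.1 (mt (raise_eq_none i z).1 (by omega))
    have h2 := h.map_raise i h1 hn z hz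
    rw [hw] at h2
    have h3 := eps_of_raise h2
    have h4 := eps_of_raise hw
    rw [← h3, ih (hA i h1 hn z hz w (.inl hw)) (by omega)]

theorem IsCrystalIso.isHighest {n : ℕ} {A B : Set ColProd} {φ : ColProd → ColProd}
    (h : IsCrystalIso n A B φ) (hA : IsStable n A) {z : ColProd} (hz : z ∈ A)
    (hh : IsHighest n z) : IsHighest n (φ z) :=
  fun i h1 hn => (h.eps_eq hA h1 hn hz).trans (hh i h1 hn)

/-- Isomorphisms that agree on highest weight elements agree. -/
theorem IsCrystalIso.eqOn {n : ℕ} {A B C : Set ColProd} {φ ψ : ColProd → ColProd}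
    (hφ : IsCrystalIso n A B φ) (hψ : IsCrystalIso n A C ψ) (hA : IsStable n A)
    (h : ∀ z ∈ A, IsHighest n z → φ z = ψ z) {z : ColProd} (hz : z ∈ A) : φ z = ψ z := by
  induction hk : letterSum z using Nat.strong_induction_on generalizing z with
  | _ k ih =>
    by_cases hh : IsHighest n z
    · exact h z hz hh
    · obtain ⟨i, h1, hn, w, hw⟩ := IsHighest.exists_raise hh
      have hwA := hA i h1 hn z hz w (.inl hw)
      have h2 := ih _ (hk ▸ letterSum_of_raise hw) hwA rfl
      have h3 := hφ.map_lower i h1 hn w hwA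
      have h4 := hψ.map_lower i h1 hn w hwA
      rw [lower_of_raise hw] at h3 h4
      rw [h2, h4] at h3
      exact (Option.some.inj h3).symm

theorem IsCrystalIso.symm {n : ℕ} {A B : Set ColProd} {φ : ColProd → ColProd}
    (h : IsCrystalIso n A B φ) (hA : IsStable n A) :
    IsCrystalIso n B A (Function.invFunOn φ A) := by
  have inv : ∀ y ∈ B, Function.invFunOn φ A y ∈ A ∧ φ (Function.invFunOn φ A y) = y := fun y hy =>
    Function.invFunOn_pos (h.bijOn.surjOn hy)
  have inv' : ∀ x ∈ A, Function.invFunOn φ A (φ x) = x := fun x hx =>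
    h.bijOn.injOn.leftInvOn_invFunOn hx
  refine ⟨⟨fun y hy => (inv y hy).1, fun y hy y' hy' he => ?_, fun x hx =>
    ⟨φ x, h.bijOn.mapsTo hx, inv' x hx⟩⟩, ?_, ?_, ?_⟩
  · rw [← (inv y hy).2, he, (inv y' hy').2]
  · intro i h1 hn y hy
    obtain ⟨h2, h3⟩ := inv y hy
    have h4 := h.map_lower i h1 hn _ h2
    rw [h3] at h4
    rcases hl : lower i (Function.invFunOn φ A y) with _ | w
    · rw [h4, hl]; rfl
    · rw [h4, hl]
      exact congrArg some (inv' w (hA i h1 hn _ h2 w (.inr hl))).symm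
  · intro i h1 hn y hy
    obtain ⟨h2, h3⟩ := inv y hy
    have h4 := h.map_raise i h1 hn _ h2
    rw [h3] at h4
    rcases hl : raise i (Function.invFunOn φ A y) with _ | w
    · rw [h4, hl]; rfl
    · rw [h4, hl]
      exact congrArg some (inv' w (hA i h1 hn _ h2 w (.inl hl))).symm
  · intro i h1 hn y hy
    obtain ⟨h2, h3⟩ := inv y hy
    rw [← h.map_weight i h1 hn _ h2, h3]

theorem IsCrystalIso.comp {n : ℕ} {A B C : Set ColProd} {φ ψ : ColProd → ColProd}
    (hψ : IsCrystalIso n B C ψ) (hφ : IsCrystalIso n A B φ) : IsCrystalIso n A C (ψ ∘ φ) := by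
  refine ⟨hψ.bijOn.comp hφ.bijOn, ?_, ?_, ?_⟩
  · intro i h1 hn x hx
    rw [Function.comp, hψ.map_lower i h1 hn _ (hφ.bijOn.mapsTo hx), hφ.map_lower i h1 hn x hx,
      Option.map_map]
  · intro i h1 hn x hx
    rw [Function.comp, hψ.map_raise i h1 hn _ (hφ.bijOn.mapsTo hx), hφ.map_raise i h1 hn x hx,
      Option.map_map]
  · intro i h1 hn x hx
    rw [Function.comp, hψ.map_weight i h1 hn _ (hφ.bijOn.mapsTo hx), hφ.map_weight i h1 hn x hx]

theorem isCrystalIso_id (n : ℕ) (A : Set ColProd) : IsCrystalIso n A A id :=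
  ⟨Set.bijOn_id A, by simp, by simp, by simp⟩

/-! ## The combinatorial `R`-matrix -/

theorem mem_twoCols {m p q : ℕ} {d : ColProd} : d ∈ twoCols m p q ↔
    ∃ x y, d = [x, y] ∧ x ⊆ Finset.Icc 1 m ∧ y ⊆ Finset.Icc 1 m ∧ x.card = p ∧ y.card = q := by
  simp only [twoCols, Set.mem_ofPred_eq, Finset.mem_powersetCard]
  constructor
  · rintro ⟨x, hx, y, hy, rfl⟩; exact ⟨x, y, rfl, hx.1, hy.1, hx.2, hy.2⟩
  · rintro ⟨x, y, rfl, h1, h2, h3, h4⟩; exact ⟨x, ⟨h1, h3⟩, y, ⟨h2, h4⟩, rfl⟩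

theorem mem_twoCols_iff {m p q : ℕ} {d : ColProd} : d ∈ twoCols m p q ↔
    Bounded m d ∧ d.map Finset.card = [p, q] := by
  rw [mem_twoCols]
  constructor
  · rintro ⟨x, y, rfl, h1, h2, rfl, rfl⟩
    simp [Bounded, h1, h2]
  · rintro ⟨h1, h2⟩
    rcases d with _ | ⟨x, _ | ⟨y, _ | ⟨z, d⟩⟩⟩ <;> simp at h2
    exact ⟨x, y, rfl, h1 x (by simp), h1 y (by simp), h2.1, h2.2⟩

theorem isStable_twoCols (m p q : ℕ) : IsStable m (twoCols m p q) := by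
  intro i h1 hn z hz z' h
  rw [mem_twoCols_iff] at hz ⊢
  rcases h with h | h
  · exact ⟨hz.1.raise h1 hn h, (map_card_of_raise h).trans hz.2⟩
  · exact ⟨hz.1.lower hn h, (map_card_of_lower h).trans hz.2⟩

/-- The tensor product of two column crystals is multiplicity free: the left column of a highest
weight element is the initial segment of its size, and the multiplicities then give the right one.
This makes the R-matrix unique. -/
theorem twoCols_highest_ext {m p q : ℕ} {z z' : ColProd} (hz : z ∈ twoCols m p q)
    (hz' : z' ∈ twoCols m p q) (hh : IsHighest m z) (hh' : IsHighest m z')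
    (hw : ∀ i, 1 ≤ i → i < m → weight i z = weight i z') : z = z' := by
  have hb := (mem_twoCols_iff.1 hz).1
  have hb' := (mem_twoCols_iff.1 hz').1
  obtain ⟨x, y, rfl, h1, h2, h3, h4⟩ := mem_twoCols.1 hz
  obtain ⟨x', y', rfl, h1', h2', h3', h4'⟩ := mem_twoCols.1 hz'
  have hx : x = x' := by
    rw [(hh.isInitial h1).eq_Icc h1, (hh'.isInitial h1').eq_Icc h1', h3, h3']
  subst hx
  have hy : y = y' := by
    ext a
    by_cases ha : a ∈ Finset.Icc 1 m
    · have := mult_eq_of_weight hb hb' (by simp [h4, h4']) hw ha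
      simp only [mult, List.countP_cons, List.countP_nil] at this
      by_cases h5 : a ∈ y <;> by_cases h6 : a ∈ y' <;> simp [h5, h6] at this ⊢
    · exact ⟨fun h => absurd (h2 h) ha, fun h => absurd (h2' h) ha⟩
  rw [hy]

theorem moved_subset {m θ : ℕ} {x y : Finset ℕ} : moved m θ x y ⊆ x := fun _ ha =>
  (mem_moved.1 ha).2.1.1

theorem disjoint_moved {m θ : ℕ} {x y : Finset ℕ} : Disjoint y (moved m θ x y) :=
  Finset.disjoint_right.2 fun _ ha => (mem_moved.1 ha).2.1.2

theorem card_slideL {m θ : ℕ} {x y : Finset ℕ} :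
    (slideL m θ x y).card + (moved m θ x y).card = x.card :=
  Finset.card_sdiff_add_card_eq_card moved_subset

theorem card_slideR {m θ : ℕ} {x y : Finset ℕ} :
    (slideR m θ x y).card = y.card + (moved m θ x y).card :=
  Finset.card_union_of_disjoint disjoint_moved

theorem slideL_subset {m θ : ℕ} {x y s : Finset ℕ} (hx : x ⊆ s) : slideL m θ x y ⊆ s :=
  Finset.sdiff_subset.trans hx

theorem slideR_subset {m θ : ℕ} {x y s : Finset ℕ} (hx : x ⊆ s) (hy : y ⊆ s) :
    slideR m θ x y ⊆ s := Finset.union_subset hy (moved_subset.trans hx)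

/-- The number of letters of `y` with no partner in `x` is a fixed point of the gap function. -/
theorem gap_fixed {m : ℕ} {x y : Finset ℕ} (hx : x ⊆ Finset.Icc 1 m) (hy : y ⊆ Finset.Icc 1 m)
    (h : y.card ≤ x.card) : gap (gap 0 x y m) x y m = gap 0 x y m := by
  have h1 := gap_add hx hy (gap 0 x y m) m
  rw [cnt_eq_card hx le_rfl, cnt_eq_card hy le_rfl] at h1
  omega

/-- At the fixed point the gap contributes nothing to `card_moved`, so the slide exchanges the two
column sizes. -/
theorem card_moved_fixed {m : ℕ} {x y : Finset ℕ} (hx : x ⊆ Finset.Icc 1 m)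
    (hy : y ⊆ Finset.Icc 1 m) (h : y.card ≤ x.card) :
    (moved m (gap 0 x y m) x y).card = x.card - y.card := by
  have h1 := card_moved (θ := gap 0 x y m) m hx hy
  rw [cnt_eq_card hx le_rfl, cnt_eq_card hy le_rfl, gap_fixed hx hy h] at h1
  omega

/-- The `R`-matrix on pairs of columns whose left factor is the larger one. -/
def slide (m : ℕ) : ColProd → ColProd
  | [x, y] => [slideL m (gap 0 x y m) x y, slideR m (gap 0 x y m) x y]
  | d => d

theorem lower_slide_pair {m i : ℕ} {x y : Finset ℕ} (h1 : 1 ≤ i) (hm : i < m) :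
    lower i (slide m [x, y]) = (lower i [x, y]).map (slide m) := by
  rcases h : lower i [x, y] with _ | z
  · rw [Option.map_none, lower_eq_none, slide, (eps_phi_slide x y h1 hm).2]
    exact (lower_eq_none _ _).1 h
  · obtain ⟨x', y', rfl, h2, -⟩ := lower_slide (θ := 0) h1 hm h
    obtain ⟨x'', y'', h3, -, h4⟩ := lower_slide (θ := gap 0 x y m) h1 hm h
    simp only [List.cons.injEq, and_true] at h3
    obtain ⟨rfl, rfl⟩ := h3
    simp only [slide, h4, Option.map_some, h2]

theorem raise_slide_pair {m i : ℕ} {x y : Finset ℕ} (h1 : 1 ≤ i) (hm : i < m) :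
    raise i (slide m [x, y]) = (raise i [x, y]).map (slide m) := by
  rcases h : raise i [x, y] with _ | z
  · rw [Option.map_none, raise_eq_none, slide, (eps_phi_slide x y h1 hm).1]
    exact (raise_eq_none _ _).1 h
  · have h2 := length_of_raise h
    rcases z with _ | ⟨x', _ | ⟨y', _ | ⟨z, d⟩⟩⟩ <;> simp at h2
    have h3 := lower_slide_pair (x := x') (y := y') h1 hm
    rw [lower_of_raise h] at h3
    exact raise_of_lower h3

/-- Injectivity is checked on highest weight elements, which their weights separate. Surjectivity
follows because both sides have `(m choose p) * (m choose q)` elements. -/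
theorem slide_isCrystalIso {m p q : ℕ} (hq : q ≤ p) :
    IsCrystalIso m (twoCols m p q) (twoCols m q p) (slide m) := by
  have maps : Set.MapsTo (slide m) (twoCols m p q) (twoCols m q p) := by
    intro z hz
    obtain ⟨x, y, rfl, hx, hy, rfl, rfl⟩ := mem_twoCols.1 hz
    have hc := card_moved_fixed hx hy hq
    have h3 := card_slideL (m := m) (θ := gap 0 x y m) (x := x) (y := y)
    have h4 := card_slideR (m := m) (θ := gap 0 x y m) (x := x) (y := y)
    exact mem_twoCols.2 ⟨_, _, rfl, slideL_subset hx, slideR_subset hx hy, by omega, by omega⟩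
  have hlow : ∀ i, 1 ≤ i → i < m → ∀ z ∈ twoCols m p q,
      lower i (slide m z) = (lower i z).map (slide m) := by
    intro i h1 hm z hz
    obtain ⟨x, y, rfl, -⟩ := mem_twoCols.1 hz
    exact lower_slide_pair h1 hm
  have hrai : ∀ i, 1 ≤ i → i < m → ∀ z ∈ twoCols m p q,
      raise i (slide m z) = (raise i z).map (slide m) := by
    intro i h1 hm z hz
    obtain ⟨x, y, rfl, -⟩ := mem_twoCols.1 hz
    exact raise_slide_pair h1 hm
  have heps : ∀ i, 1 ≤ i → i < m → ∀ z ∈ twoCols m p q,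
      eps i (slide m z) = eps i z ∧ weight i (slide m z) = weight i z := by
    intro i h1 hm z hz
    obtain ⟨x, y, rfl, -⟩ := mem_twoCols.1 hz
    rw [weight_eq, weight_eq, slide, (eps_phi_slide x y h1 hm).1, (eps_phi_slide x y h1 hm).2]
    exact ⟨rfl, rfl⟩
  have inj : Set.InjOn (slide m) (twoCols m p q) := by
    intro z hz z' hz' he
    induction hk : letterSum z using Nat.strong_induction_on generalizing z z' with
    | _ k ih =>
      by_cases hh : IsHighest m z
      · refine twoCols_highest_ext hz hz' hh (fun i h1 hm => ?_) fun i h1 hm => ?_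
        · rw [← (heps i h1 hm z' hz').1, ← he, (heps i h1 hm z hz).1, hh i h1 hm]
        · rw [← (heps i h1 hm z' hz').2, ← he, (heps i h1 hm z hz).2]
      · obtain ⟨i, h1, hm, w, hw⟩ := IsHighest.exists_raise hh
        have h2 := hrai i h1 hm z hz
        rw [he, hrai i h1 hm z' hz', hw, Option.map_some, Option.map_eq_some_iff] at h2
        obtain ⟨w', hw', h3⟩ := h2
        have h4 := ih _ (hk ▸ letterSum_of_raise hw)
          (isStable_twoCols m p q i h1 hm z hz w (.inl hw))
          (isStable_twoCols m p q i h1 hm z' hz' w' (.inl hw')) h3.symm rfl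
        subst h4
        exact Option.some.inj ((lower_of_raise hw).symm.trans (lower_of_raise hw'))
  have ncard : ∀ a b, (twoCols m a b).ncard = m.choose a * m.choose b ∧ (twoCols m a b).Finite := by
    intro a b
    have : twoCols m a b = (fun w : Finset ℕ × Finset ℕ => [w.1, w.2]) ''
        (((Finset.Icc 1 m).powersetCard a ×ˢ (Finset.Icc 1 m).powersetCard b :
          Finset (Finset ℕ × Finset ℕ)) : Set (Finset ℕ × Finset ℕ)) := by
      ext z
      simp only [twoCols, Set.mem_ofPred_eq, Set.mem_image, Finset.mem_coe, Finset.mem_product]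
      constructor
      · rintro ⟨x, hx, y, hy, rfl⟩; exact ⟨(x, y), ⟨hx, hy⟩, rfl⟩
      · rintro ⟨⟨x, y⟩, ⟨hx, hy⟩, rfl⟩; exact ⟨x, hx, y, hy, rfl⟩
    rw [this]
    refine ⟨?_, (Finset.finite_toSet _).image _⟩
    rw [Set.ncard_image_of_injective, Set.ncard_coe_finset, Finset.card_product]
    · simp
    · rintro ⟨x, y⟩ ⟨x', y'⟩ h
      simpa using h
  refine ⟨⟨maps, inj, ?_⟩, hlow, hrai, fun i h1 hm z hz => (heps i h1 hm z hz).2⟩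
  refine (Set.eq_of_subset_of_ncard_le maps.image_subset ?_ (ncard q p).2).ge
  rw [inj.ncard_image, (ncard p q).1, (ncard q p).1, mul_comm]

/-- Existence, which gives the `epsilon` choice its meaning: a slide if the left column is the
larger one, the inverse of a slide otherwise. -/
theorem rMatrix_isCrystalIso (m p q : ℕ) :
    IsCrystalIso m (twoCols m p q) (twoCols m q p) (rMatrix m p q) := by
  refine Classical.epsilon_spec (p := IsCrystalIso m (twoCols m p q) (twoCols m q p)) ?_
  rcases le_total q p with h | h
  · exact ⟨_, slide_isCrystalIso h⟩
  · exact ⟨_, (slide_isCrystalIso h).symm (isStable_twoCols m q p)⟩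

theorem IsCrystalIso.eq_of_twoCols {m p q : ℕ} {A : Set ColProd} {φ ψ : ColProd → ColProd}
    (hA : IsStable m A)
    (hφ : IsCrystalIso m A (twoCols m p q) φ) (hψ : IsCrystalIso m A (twoCols m p q) ψ)
    {z : ColProd} (hz : z ∈ A) : φ z = ψ z := by
  refine hφ.eqOn hψ hA (fun w hw hh => ?_) hz
  refine twoCols_highest_ext (hφ.bijOn.mapsTo hw) (hψ.bijOn.mapsTo hw) (hφ.isHighest hA hw hh)
    (hψ.isHighest hA hw hh) fun i h1 hn => ?_
  rw [hφ.map_weight i h1 hn w hw, hψ.map_weight i h1 hn w hw]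

theorem rMatrix_of_le {m : ℕ} {x y : Finset ℕ} (hx : x ⊆ Finset.Icc 1 m) (hy : y ⊆ Finset.Icc 1 m)
    (h : y.card ≤ x.card) : rMatrix m x.card y.card [x, y] =
      [slideL m (gap 0 x y m) x y, slideR m (gap 0 x y m) x y] :=
  (rMatrix_isCrystalIso m _ _).eq_of_twoCols (isStable_twoCols m _ _) (slide_isCrystalIso h)
    (mem_twoCols.2 ⟨x, y, rfl, hx, hy, rfl, rfl⟩)

/-- The composite is an automorphism, hence the identity by uniqueness. -/
theorem rMatrix_rMatrix {m p q : ℕ} {z : ColProd} (hz : z ∈ twoCols m p q) :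
    rMatrix m q p (rMatrix m p q z) = z :=
  ((rMatrix_isCrystalIso m q p).comp (rMatrix_isCrystalIso m p q)).eq_of_twoCols
    (isStable_twoCols m _ _) (isCrystalIso_id m _) hz

/-- The left factor of the image of `x ⊗ y` under the `R`-matrix. -/
noncomputable def rLeft (m : ℕ) (x y : Finset ℕ) : Finset ℕ :=
  factor (rMatrix m x.card y.card [x, y]) 1

/-- The right factor of the image of `x ⊗ y` under the `R`-matrix. -/
noncomputable def rRight (m : ℕ) (x y : Finset ℕ) : Finset ℕ :=
  factor (rMatrix m x.card y.card [x, y]) 2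

section pair

variable {m : ℕ} {x y : Finset ℕ}

theorem rMatrix_pair_aux (hx : x ⊆ Finset.Icc 1 m) (hy : y ⊆ Finset.Icc 1 m) :
    rMatrix m x.card y.card [x, y] = [rLeft m x y, rRight m x y] ∧
      rLeft m x y ⊆ Finset.Icc 1 m ∧ rRight m x y ⊆ Finset.Icc 1 m ∧
      (rLeft m x y).card = y.card ∧ (rRight m x y).card = x.card := by
  have h := (rMatrix_isCrystalIso m _ _).bijOn.mapsTo
    (mem_twoCols.2 ⟨x, y, rfl, hx, hy, rfl, rfl⟩)
  obtain ⟨x', y', h1, h2, h3, h4, h5⟩ := mem_twoCols.1 h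
  simp only [rLeft, rRight, h1, factor]
  simp [h2, h3, h4, h5]

theorem rMatrix_pair (hx : x ⊆ Finset.Icc 1 m) (hy : y ⊆ Finset.Icc 1 m) :
    rMatrix m x.card y.card [x, y] = [rLeft m x y, rRight m x y] := (rMatrix_pair_aux hx hy).1

theorem rLeft_subset (hx : x ⊆ Finset.Icc 1 m) (hy : y ⊆ Finset.Icc 1 m) :
    rLeft m x y ⊆ Finset.Icc 1 m := (rMatrix_pair_aux hx hy).2.1

theorem rRight_subset (hx : x ⊆ Finset.Icc 1 m) (hy : y ⊆ Finset.Icc 1 m) :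
    rRight m x y ⊆ Finset.Icc 1 m := (rMatrix_pair_aux hx hy).2.2.1

theorem card_rLeft (hx : x ⊆ Finset.Icc 1 m) (hy : y ⊆ Finset.Icc 1 m) :
    (rLeft m x y).card = y.card := (rMatrix_pair_aux hx hy).2.2.2.1

theorem card_rRight (hx : x ⊆ Finset.Icc 1 m) (hy : y ⊆ Finset.Icc 1 m) :
    (rRight m x y).card = x.card := (rMatrix_pair_aux hx hy).2.2.2.2

theorem rPair_of_le (hx : x ⊆ Finset.Icc 1 m) (hy : y ⊆ Finset.Icc 1 m) (h : y.card ≤ x.card) :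
    rLeft m x y = slideL m (gap 0 x y m) x y ∧ rRight m x y = slideR m (gap 0 x y m) x y := by
  have := rMatrix_of_le hx hy h
  rw [rMatrix_pair hx hy] at this
  simpa using this

theorem rPair_rPair (hx : x ⊆ Finset.Icc 1 m) (hy : y ⊆ Finset.Icc 1 m) :
    rLeft m (rLeft m x y) (rRight m x y) = x ∧ rRight m (rLeft m x y) (rRight m x y) = y := by
  have h := rMatrix_rMatrix (mem_twoCols.2 ⟨x, y, rfl, hx, hy, rfl, rfl⟩ :
    [x, y] ∈ twoCols m x.card y.card)
  rw [rMatrix_pair hx hy] at h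
  have h2 := rMatrix_pair (rLeft_subset hx hy) (rRight_subset hx hy)
  rw [card_rLeft hx hy, card_rRight hx hy, h] at h2
  simpa [eq_comm] using h2

/-- A symmetric property of the `R`-matrix has to be checked only when the left factor is the
larger one. -/
theorem rPair_induction {P : Finset ℕ → Finset ℕ → Finset ℕ → Finset ℕ → Prop}
    (h1 : ∀ x y, x ⊆ Finset.Icc 1 m → y ⊆ Finset.Icc 1 m → y.card ≤ x.card →
      P x y (slideL m (gap 0 x y m) x y) (slideR m (gap 0 x y m) x y))
    (h2 : ∀ x y, x ⊆ Finset.Icc 1 m → y ⊆ Finset.Icc 1 m →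
      P x y (rLeft m x y) (rRight m x y) → P (rLeft m x y) (rRight m x y) x y)
    (hx : x ⊆ Finset.Icc 1 m) (hy : y ⊆ Finset.Icc 1 m) : P x y (rLeft m x y) (rRight m x y) := by
  have key : ∀ x y, x ⊆ Finset.Icc 1 m → y ⊆ Finset.Icc 1 m → y.card ≤ x.card →
      P x y (rLeft m x y) (rRight m x y) := by
    intro x y hx hy h
    rw [(rPair_of_le hx hy h).1, (rPair_of_le hx hy h).2]
    exact h1 x y hx hy h
  rcases le_total y.card x.card with h | h
  · exact key x y hx hy h
  · have h3 := rLeft_subset hx hy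
    have h4 := rRight_subset hx hy
    -- The image pair has its larger column on the left, and its image is the original pair.
    have h5 := h2 _ _ h3 h4 (key _ _ h3 h4 (by rw [card_rLeft hx hy, card_rRight hx hy]; exact h))
    rwa [(rPair_rPair hx hy).1, (rPair_rPair hx hy).2] at h5

theorem localEnergy_of_le (hx : x ⊆ Finset.Icc 1 m) (hy : y ⊆ Finset.Icc 1 m)
    (h : y.card ≤ x.card) : localEnergy m x y = gap 0 x y m := by
  rw [localEnergy, if_pos h, leg_eq hx hy]

theorem slide_of_card_eq (hx : x ⊆ Finset.Icc 1 m) (hy : y ⊆ Finset.Icc 1 m)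
    (h : x.card = y.card) :
    slideL m (gap 0 x y m) x y = x ∧ slideR m (gap 0 x y m) x y = y := by
  have h1 := card_moved_fixed hx hy h.ge
  rw [h, Nat.sub_self, Finset.card_eq_zero] at h1
  simp [slideL, slideR, h1]

/-- For different sizes this is how the local energy is extended to a smaller left column; for equal
sizes the R-matrix is the identity. -/
theorem localEnergy_rPair (hx : x ⊆ Finset.Icc 1 m) (hy : y ⊆ Finset.Icc 1 m) :
    localEnergy m (rLeft m x y) (rRight m x y) = localEnergy m x y := by
  refine rPair_induction (P := fun x y x' y' => localEnergy m x' y' = localEnergy m x y)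
    (fun x y hx hy h => ?_) (fun x y hx hy h => h.symm) hx hy
  rcases h.lt_or_eq with h | h
  · rw [← (rPair_of_le hx hy h.le).1, ← (rPair_of_le hx hy h.le).2]
    have h1 := card_rLeft hx hy
    have h2 := card_rRight hx hy
    rw [localEnergy, if_neg (by omega)]
    have h3 : factor (rMatrix m (rLeft m x y).card (rRight m x y).card
      [rLeft m x y, rRight m x y]) 1 = x := (rPair_rPair hx hy).1
    have h4 : factor (rMatrix m (rLeft m x y).card (rRight m x y).card
      [rLeft m x y, rRight m x y]) 2 = y := (rPair_rPair hx hy).2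
    rw [h3, h4, localEnergy, if_pos h.le]
  · rw [(slide_of_card_eq hx hy h.symm).1, (slide_of_card_eq hx hy h.symm).2]

theorem rPair_content (hx : x ⊆ Finset.Icc 1 m) (hy : y ⊆ Finset.Icc 1 m) (a : ℕ) :
    ((if a ∈ rLeft m x y then 1 else 0) + (if a ∈ rRight m x y then 1 else 0) : ℤ) =
      (if a ∈ x then 1 else 0) + (if a ∈ y then 1 else 0) := by
  refine rPair_induction (P := fun x y x' y' =>
    ((if a ∈ x' then 1 else 0) + (if a ∈ y' then 1 else 0) : ℤ) =
      (if a ∈ x then 1 else 0) + (if a ∈ y then 1 else 0))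
    (fun x y hx hy h => ?_) (fun x y hx hy h => h.symm) hx hy
  simp only [mem_slideL, mem_slideR]
  have h1 : a ∈ moved m (gap 0 x y m) x y → a ∈ x ∧ a ∉ y := fun h => (mem_moved.1 h).2.1
  by_cases h2 : a ∈ moved m (gap 0 x y m) x y
  · simp [h1 h2, h2]
  · simp [h2]

/-- If `y ⊆ x`, nobody ever waits: the gap stays zero, and all of `x \ y` is moved, which swaps the
columns. The other inclusion follows by applying the R-matrix again. -/
theorem rPair_of_subset (hx : x ⊆ Finset.Icc 1 m) (hy : y ⊆ Finset.Icc 1 m)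
    (h : x ⊆ y ∨ y ⊆ x) : rLeft m x y = y ∧ rRight m x y = x ∧ localEnergy m x y = 0 := by
  have key : ∀ x y, x ⊆ Finset.Icc 1 m → y ⊆ Finset.Icc 1 m → y ⊆ x →
      rLeft m x y = y ∧ rRight m x y = x ∧ localEnergy m x y = 0 := by
    intro x y hx hy h
    have h0 : ∀ a, gap 0 x y a = 0 := by
      intro a
      induction a with
      | zero => rfl
      | succ a ih =>
        rw [gap, ih]
        split_ifs with h1 h2
        · rfl
        · exact absurd (h h2.1) h2.2
        · rfl
    have hc := Finset.card_le_card h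
    have h1 : moved m (gap 0 x y m) x y = x \ y := by
      ext a
      rw [mem_moved, h0, h0, Finset.mem_sdiff]
      refine ⟨fun h => h.2.1, fun h => ⟨?_, h, rfl⟩⟩
      simpa using hx h.1
    rw [(rPair_of_le hx hy hc).1, (rPair_of_le hx hy hc).2, localEnergy_of_le hx hy hc, h0,
      slideL, slideR, ← h0 m, h1]
    refine ⟨?_, ?_, rfl⟩
    · rw [Finset.sdiff_sdiff_eq_self h]
    · exact Finset.union_sdiff_of_subset h
  rcases h with h | h
  · have h1 := key y x hy hx h
    have h2 := rPair_rPair hy hx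
    have h3 := localEnergy_rPair hy hx
    rw [h1.1, h1.2.1] at h2 h3
    exact ⟨h2.1, h2.2, h3.trans h1.2.2⟩
  · exact key x y hx hy h

/-! ### Independence of the bound on the entries. -/

theorem gap_succ_of_subset (hx : x ⊆ Finset.Icc 1 m) (hy : y ⊆ Finset.Icc 1 m) (θ : ℕ) :
    gap θ x y (m + 1) = gap θ x y m := by
  have h1 : m + 1 ∉ x := fun h => by simpa using hx h
  have h2 : m + 1 ∉ y := fun h => by simpa using hy h
  simp [gap, h1, h2]

theorem moved_succ_of_subset (hx : x ⊆ Finset.Icc 1 m) (θ : ℕ) :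
    moved (m + 1) θ x y = moved m θ x y := by
  ext a
  rw [mem_moved, mem_moved]
  refine ⟨fun h => ⟨?_, h.2⟩, fun h => ⟨?_, h.2⟩⟩
  · simpa using hx h.2.1.1
  · omega

/-- The `R`-matrix and the local energy do not depend on the bound on the entries. -/
theorem rPair_succ (hx : x ⊆ Finset.Icc 1 m) (hy : y ⊆ Finset.Icc 1 m) :
    rLeft (m + 1) x y = rLeft m x y ∧ rRight (m + 1) x y = rRight m x y ∧
      localEnergy (m + 1) x y = localEnergy m x y := by
  have hs : Finset.Icc 1 m ⊆ Finset.Icc 1 (m + 1) := Finset.Icc_subset_Icc_right (by omega)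
  refine rPair_induction (P := fun x y x' y' => rLeft (m + 1) x y = x' ∧ rRight (m + 1) x y = y' ∧
    localEnergy (m + 1) x y = localEnergy m x y)
    (fun x y hx hy h => ?_) (fun x y hx hy h => ?_) hx hy
  · rw [(rPair_of_le (hx.trans hs) (hy.trans hs) h).1,
      (rPair_of_le (hx.trans hs) (hy.trans hs) h).2,
      localEnergy_of_le hx hy h, localEnergy_of_le (hx.trans hs) (hy.trans hs) h,
      gap_succ_of_subset hx hy, slideL, slideL, slideR, slideR, moved_succ_of_subset hx]
    exact ⟨rfl, rfl, rfl⟩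
  · have h2 := rPair_rPair (hx.trans hs) (hy.trans hs)
    have h3 := localEnergy_rPair (hx.trans hs) (hy.trans hs)
    rw [h.1, h.2.1] at h2 h3
    exact ⟨h2.1, h2.2, by rw [h3, h.2.2, localEnergy_rPair hx hy]⟩

/-! ## Promotion -/

/-- The promotion `a ↦ a + 1` modulo `m` on columns with entries in `{1, …, m}`. -/
def promote (m : ℕ) (x : Finset ℕ) : Finset ℕ := x.image fun a => if a = m then 1 else a + 1

theorem one_mem_promote (hx : x ⊆ Finset.Icc 1 m) : 1 ∈ promote m x ↔ m ∈ x := by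
  rw [promote, Finset.mem_image]
  constructor
  · rintro ⟨a, ha, h⟩
    have := Finset.mem_Icc.1 (hx ha)
    split_ifs at h with h1
    · rwa [← h1]
    · omega
  · exact fun h => ⟨m, h, by simp⟩

theorem succ_mem_promote {a : ℕ} (ha1 : 1 ≤ a) (ham : a < m) :
    a + 1 ∈ promote m x ↔ a ∈ x := by
  rw [promote, Finset.mem_image]
  constructor
  · rintro ⟨b, hb, h⟩
    split_ifs at h with h1
    · omega
    · rwa [← Nat.succ.inj h]
  · exact fun h => ⟨a, h, by rw [if_neg (by omega)]⟩

theorem promote_subset (hx : x ⊆ Finset.Icc 1 m) : promote m x ⊆ Finset.Icc 1 m := by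
  intro b hb
  obtain ⟨a, ha, rfl⟩ := Finset.mem_image.1 hb
  have := Finset.mem_Icc.1 (hx ha)
  rw [Finset.mem_Icc]
  split_ifs <;> omega

theorem card_promote (hx : x ⊆ Finset.Icc 1 m) : (promote m x).card = x.card := by
  refine Finset.card_image_of_injOn fun a ha b hb h => ?_
  have h1 := Finset.mem_Icc.1 (hx ha)
  have h2 := Finset.mem_Icc.1 (hx hb)
  split_ifs at h <;> omega

/-- A fixed point makes the reading periodic. Promotion brings the letter `m` to the first place, so
the promoted reading starts with the gap that holds just before `m`. -/
theorem gap_promote (hm : 1 ≤ m) (hx : x ⊆ Finset.Icc 1 m) (hy : y ⊆ Finset.Icc 1 m) {θ : ℕ}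
    (hθ : gap θ x y m = θ) {a : ℕ} (ha : a < m) :
    gap (gap θ x y (m - 1)) (promote m x) (promote m y) (a + 1) = gap θ x y a := by
  induction a with
  | zero =>
    simp only [gap, zero_add, one_mem_promote hx, one_mem_promote hy]
    rw [← gap_self hm, hθ]
  | succ a ih =>
    rw [gap, ih (by omega), gap]
    simp only [succ_mem_promote (x := x) (Nat.succ_pos a) ha,
      succ_mem_promote (x := y) (Nat.succ_pos a) ha]

theorem gap_promote_fixed (hm : 1 ≤ m) (hx : x ⊆ Finset.Icc 1 m) (hy : y ⊆ Finset.Icc 1 m) {θ : ℕ}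
    (hθ : gap θ x y m = θ) :
    gap (gap θ x y (m - 1)) (promote m x) (promote m y) m = gap θ x y (m - 1) := by
  have := gap_promote hm hx hy hθ (a := m - 1) (by omega)
  rwa [Nat.sub_add_cancel hm] at this

theorem gap_unpromote {η a : ℕ} (ha : a < m) : gap (gap η (promote m x) (promote m y) 1) x y a =
      gap η (promote m x) (promote m y) (a + 1) := by
  induction a with
  | zero => rw [gap]
  | succ a ih =>
    rw [gap, ih (by omega), gap.eq_2 _ _ _ (a + 1)]
    simp only [succ_mem_promote (x := x) (Nat.succ_pos a) ha,
      succ_mem_promote (x := y) (Nat.succ_pos a) ha]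

/-- The number of unmatched letters of the promoted pair. -/
theorem gap_zero_promote (hm : 1 ≤ m) (hx : x ⊆ Finset.Icc 1 m) (hy : y ⊆ Finset.Icc 1 m)
    (h : y.card ≤ x.card) : gap 0 (promote m x) (promote m y) m =
      gap (gap 0 x y m) x y (m - 1) := by
  set θ := gap 0 x y m with hθ
  have fθ : gap θ x y m = θ := gap_fixed hx hy h
  set η := gap 0 (promote m x) (promote m y) m with hη
  have fη : gap η (promote m x) (promote m y) m = η :=
    gap_fixed (promote_subset hx) (promote_subset hy) (by rwa [card_promote hx, card_promote hy])
  -- Starting from zero, one reading ends at the smallest fixed point. Fixed points of the two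
  -- readings correspond to each other, so both bounds come from monotonicity in the starting value.
  refine le_antisymm ?_ ?_
  · rw [← gap_promote_fixed hm hx hy fθ]
    exact gap_mono (Nat.zero_le _) _
  · have h1 := gap_unpromote (m := m) (x := x) (y := y) (η := η) (a := m - 1) (by omega)
    rw [Nat.sub_add_cancel hm, fη] at h1
    have h2 : gap (gap η (promote m x) (promote m y) 1) x y m =
        gap η (promote m x) (promote m y) 1 := by
      rw [gap_self hm, h1]
      simp only [gap, zero_add, one_mem_promote hx, one_mem_promote hy]
    rw [← h1]
    refine gap_mono ?_ _
    rw [← h2, hθ]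
    exact gap_mono (Nat.zero_le _) _

theorem eq_promote (hx : x ⊆ Finset.Icc 1 m) {s : Finset ℕ}
    (hs : s ⊆ Finset.Icc 1 m) (h1 : 1 ∈ s ↔ m ∈ x)
    (h2 : ∀ a, 1 ≤ a → a < m → (a + 1 ∈ s ↔ a ∈ x)) : s = promote m x := by
  ext b
  rcases Nat.lt_or_ge b 1 with hb | hb
  · exact ⟨fun h => by have := Finset.mem_Icc.1 (hs h); omega,
      fun h => by have := Finset.mem_Icc.1 (promote_subset hx h); omega⟩
  · rcases Nat.lt_or_ge m b with hb' | hb'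
    · exact ⟨fun h => by have := Finset.mem_Icc.1 (hs h); omega,
        fun h => by have := Finset.mem_Icc.1 (promote_subset hx h); omega⟩
    · rcases hb.eq_or_lt with rfl | hb
      · rw [h1, one_mem_promote hx]
      · obtain ⟨a, rfl⟩ := Nat.exists_eq_add_of_le' hb
        rw [show a + Nat.succ 1 = (a + 1) + 1 by omega] at *
        rw [h2 _ (by omega) (by omega), succ_mem_promote (by omega) (by omega)]

theorem moved_promote (hm : 1 ≤ m) (hx : x ⊆ Finset.Icc 1 m) (hy : y ⊆ Finset.Icc 1 m) {θ : ℕ}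
    (hθ : gap θ x y m = θ) :
    moved m (gap θ x y (m - 1)) (promote m x) (promote m y) = promote m (moved m θ x y) := by
  refine eq_promote (moved_subset.trans hx)
    (moved_subset.trans (promote_subset hx)) ?_ fun a h1 h2 => ?_
  · rw [mem_moved, mem_moved, one_mem_promote hx, one_mem_promote hy]
    simp [gap, hm]
  · rw [mem_moved, mem_moved, succ_mem_promote h1 h2, succ_mem_promote h1 h2]
    obtain ⟨c, rfl⟩ := Nat.exists_eq_add_of_le' h1
    rw [Nat.add_sub_cancel, Nat.add_sub_cancel, gap_promote hm hx hy hθ (by omega)]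
    refine and_congr_left fun _ => ?_
    omega

theorem rPair_promote (hm : 1 ≤ m) (hx : x ⊆ Finset.Icc 1 m) (hy : y ⊆ Finset.Icc 1 m) :
    rLeft m (promote m x) (promote m y) = promote m (rLeft m x y) ∧
      rRight m (promote m x) (promote m y) = promote m (rRight m x y) := by
  refine rPair_induction (P := fun x y x' y' =>
    rLeft m (promote m x) (promote m y) = promote m x' ∧
      rRight m (promote m x) (promote m y) = promote m y')
    (fun x y hx hy h => ?_) (fun x y hx hy h => ?_) hx hy
  · have h0 : (promote m y).card ≤ (promote m x).card := by rwa [card_promote hx, card_promote hy]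
    have h1 := rPair_of_le (promote_subset hx) (promote_subset hy) h0
    have h2 := moved_promote hm hx hy (gap_fixed hx hy h)
    rw [h1.1, h1.2, gap_zero_promote hm hx hy h]
    constructor
    · refine eq_promote (slideL_subset hx)
        (slideL_subset (promote_subset hx)) ?_ fun a h3 h4 => ?_
      · rw [mem_slideL, h2, mem_slideL, one_mem_promote hx,
          one_mem_promote (moved_subset.trans hx)]
      · rw [mem_slideL, h2, mem_slideL, succ_mem_promote h3 h4, succ_mem_promote h3 h4]
    · refine eq_promote (slideR_subset hx hy)
        (slideR_subset (promote_subset hx) (promote_subset hy)) ?_ fun a h3 h4 => ?_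
      · rw [mem_slideR, h2, mem_slideR, one_mem_promote hy,
          one_mem_promote (moved_subset.trans hx)]
      · rw [mem_slideR, h2, mem_slideR, succ_mem_promote h3 h4, succ_mem_promote h3 h4]
  · have h1 := rPair_rPair (promote_subset hx) (promote_subset hy)
    rwa [h.1, h.2] at h1

/-- For a larger left column, both local energies are gaps of one cyclic reading, after and before
the letter `m`. Reading `m` adds one if it is only in `y`, and subtracts one if it is only in `x`
and not moved, which means that it stays in the left factor. -/
theorem localEnergy_promote (hm : 1 ≤ m) (hx : x ⊆ Finset.Icc 1 m) (hy : y ⊆ Finset.Icc 1 m) :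
    (localEnergy m (promote m x) (promote m y) : ℤ) = localEnergy m x y +
      (if m ∈ rLeft m x y then 1 else 0) - (if m ∈ y then 1 else 0) := by
  refine rPair_induction (P := fun x y x' _ =>
    (localEnergy m (promote m x) (promote m y) : ℤ) = localEnergy m x y +
      (if m ∈ x' then 1 else 0) - (if m ∈ y then 1 else 0))
    (fun x y hx hy h => ?_) (fun x y hx hy h => ?_) hx hy
  · have h0 : (promote m y).card ≤ (promote m x).card := by rwa [card_promote hx, card_promote hy]
    rw [localEnergy_of_le hx hy h, localEnergy_of_le (promote_subset hx) (promote_subset hy) h0,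
      gap_zero_promote hm hx hy h]
    have h1 := gap_fixed hx hy h
    generalize gap 0 x y m = θ at h1 ⊢
    rw [gap_self hm] at h1
    simp only [mem_slideL, mem_moved]
    by_cases h2 : m ∈ x <;> by_cases h3 : m ∈ y <;> by_cases h4 : gap θ x y (m - 1) = 0 <;>
      simp [h2, h3, h4, hm] at h1 ⊢ <;> omega
  · have h1 := localEnergy_rPair (promote_subset hx) (promote_subset hy)
    rw [(rPair_promote hm hx hy).1, (rPair_promote hm hx hy).2] at h1
    rw [h1, h, localEnergy_rPair hx hy]
    -- Exchanging the pair with its image exchanges the correction terms; they agree because the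
    -- letter `m` occurs equally often in both.
    have := rPair_content hx hy m
    omega

end pair

/-! ## The energy as a recursion -/

/-- The energy collected by the column `y` when it is moved to the left through the columns of the
reversed list `r`. -/
noncomputable def passEnergy (m : ℕ) : ColProd → Finset ℕ → ℕ
  | [], _ => 0
  | x :: r, y => localEnergy m x y + passEnergy m r (rLeft m x y)

/-- The first factor obtained by moving `y` to the left through the reversed list `r`. -/
noncomputable def front (m : ℕ) : ColProd → Finset ℕ → Finset ℕ
  | [], y => y
  | x :: r, y => front m r (rLeft m x y)

/-- The energy of a reversed list. -/
noncomputable def revEnergy (m : ℕ) : ColProd → ℕ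
  | [] => 0
  | y :: r => passEnergy m r y + revEnergy m r

theorem exists_split_pair {d : ColProd} {j : ℕ} (h1 : 1 ≤ j) (h2 : j + 1 ≤ d.length) :
    ∃ u x y v, d = u ++ x :: y :: v ∧ j = u.length + 1 := by
  refine ⟨d.take (j - 1), d[j - 1], d[j], d.drop (j + 1), ?_, ?_⟩
  · have h3 : d.drop (j - 1) = d[j - 1] :: d.drop j := by
      rw [List.drop_eq_getElem_cons (by omega), Nat.sub_add_cancel h1]
    rw [← List.drop_eq_getElem_cons, ← h3, List.take_append_drop]
  · rw [List.length_take]; omega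

theorem applyR_split {m : ℕ} {u v : ColProd} {x y : Finset ℕ} (hx : x ⊆ Finset.Icc 1 m)
    (hy : y ⊆ Finset.Icc 1 m) : applyR m (u.length + 1) (u ++ x :: y :: v) =
      u ++ rLeft m x y :: rRight m x y :: v := by
  have h1 : factor (u ++ x :: y :: v) (u.length + 1) = x := by
    simp [factor, List.getD_eq_getElem?_getD]
  have h2 : factor (u ++ x :: y :: v) (u.length + 1 + 1) = y := by
    simp [factor, List.getD_eq_getElem?_getD]
  rw [applyR, h1, h2, rMatrix_pair hx hy]
  rw [List.drop_append, List.drop_eq_nil_of_le (by omega),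
    show u.length + 1 + 1 - u.length = 2 by omega]
  simp

theorem applyR_append {m j : ℕ} {d v : ColProd} (hd : Bounded m d) (h1 : 1 ≤ j)
    (h2 : j + 1 ≤ d.length) : applyR m j (d ++ v) = applyR m j d ++ v ∧
      (applyR m j d).length = d.length ∧ Bounded m (applyR m j d) := by
  obtain ⟨u, x, y, w, rfl, rfl⟩ := exists_split_pair h1 h2
  have hx : x ⊆ Finset.Icc 1 m := hd x (by simp)
  have hy : y ⊆ Finset.Icc 1 m := hd y (by simp)
  rw [applyR_split hx hy, List.append_assoc, List.cons_append, List.cons_append,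
    applyR_split hx hy]
  refine ⟨by simp, by simp, fun c hc => ?_⟩
  simp only [List.mem_append, List.mem_cons] at hc
  rcases hc with hc | rfl | rfl | hc
  · exact hd c (by simp [hc])
  · exact rLeft_subset hx hy
  · exact rRight_subset hx hy
  · exact hd c (by simp [hc])

theorem foldr_applyR_append {m : ℕ} {ks : List ℕ} {d v : ColProd} (hd : Bounded m d)
    (hk : ∀ k ∈ ks, 1 ≤ k ∧ k + 1 ≤ d.length) :
    ks.foldr (applyR m) (d ++ v) = ks.foldr (applyR m) d ++ v ∧
      (ks.foldr (applyR m) d).length = d.length ∧ Bounded m (ks.foldr (applyR m) d) := by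
  induction ks with
  | nil => simp [hd]
  | cons k ks ih =>
    obtain ⟨h1, h2, h3⟩ := ih fun k hk' => hk k (by simp [hk'])
    have h4 := hk k (by simp)
    obtain ⟨h5, h6, h7⟩ := applyR_append (v := v) h3 h4.1 (by omega)
    simp only [List.foldr_cons, h1]
    exact ⟨h5, by omega, h7⟩

theorem factor_append {d v : ColProd} {i : ℕ} (h1 : 1 ≤ i) (h2 : i ≤ d.length) :
    factor (d ++ v) i = factor d i := by
  rw [factor, factor, List.getD_append _ _ _ _ (by omega)]

theorem factor_length_succ (d v : ColProd) (y : Finset ℕ) :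
    factor (d ++ y :: v) (d.length + 1) = y := by
  simp [factor, List.getD_eq_getElem?_getD]

theorem movedFactor_append {m i j : ℕ} {d v : ColProd} (hd : Bounded m d) (hij : i < j)
    (hj : j ≤ d.length) : movedFactor m i j (d ++ v) = movedFactor m i j d := by
  obtain ⟨h1, h2, h3⟩ := foldr_applyR_append (v := v) (ks := List.range' (i + 1) (j - 1 - i)) hd
    fun k hk => by simp [List.mem_range'_1] at hk; omega
  rw [movedFactor, movedFactor, h1, factor_append (by omega) (by omega)]

/-- For the last index `j`, the terms are the local energies met by the last factor on its way to
the front. -/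
theorem sum_passEnergy {m : ℕ} {d : ColProd} {y : Finset ℕ} (hd : Bounded m (d ++ [y])) :
    ∑ i ∈ Finset.Ico 1 (d.length + 1), localEnergy m (factor (d ++ [y]) i)
      (movedFactor m i (d.length + 1) (d ++ [y])) = passEnergy m d.reverse y := by
  induction d using List.reverseRecOn generalizing y with
  | nil => simp [passEnergy]
  | append_singleton d x ih =>
    have hx : x ⊆ Finset.Icc 1 m := hd x (by simp)
    have hy : y ⊆ Finset.Icc 1 m := hd y (by simp)
    have hd' : Bounded m (d ++ [rLeft m x y]) := by
      intro c hc
      rcases List.mem_append.1 hc with hc | hc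
      · exact hd c (by simp [hc])
      · rw [List.mem_singleton.1 hc]; exact rLeft_subset hx hy
    have hlen : (d ++ [x]).length = d.length + 1 := by simp
    rw [hlen, Finset.sum_Ico_succ_top (by omega), List.reverse_append, List.reverse_singleton,
      List.singleton_append, passEnergy, ← ih hd', add_comm]
    congr 1
    · congr 1
      · rw [factor_append (by omega) (by simp), factor_length_succ]
      · rw [movedFactor, show d.length + 1 + 1 - 1 - (d.length + 1) = 0 by omega]
        have := factor_length_succ (d ++ [x]) [] y
        rw [hlen] at this
        exact this
    · refine Finset.sum_congr rfl fun i hi => ?_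
      rw [Finset.mem_Ico] at hi
      congr 1
      · rw [factor_append (by omega) (by simp; omega), factor_append (by omega) (by omega),
          factor_append (by omega) (by omega)]
      -- `foldr` applies the last operator of the list first. That one exchanges `x` and `y`, and
      -- the others do not reach the new last factor.
      · rw [movedFactor, show d.length + 1 + 1 - 1 - i = (d.length - i) + 1 by omega,
          List.range'_concat, List.foldr_append, 
          show i + 1 + 1 * (d.length - i) = d.length + 1 by omega]
        have h1 : applyR m (d.length + 1) (d ++ [x] ++ [y]) =
            (d ++ [rLeft m x y]) ++ [rRight m x y] := by
          have := applyR_split (u := d) (v := []) hx hy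
          simpa using this
        obtain ⟨h2, h3, -⟩ := foldr_applyR_append (v := [rRight m x y])
          (ks := List.range' (i + 1) (d.length - i)) hd' fun k hk => by
            simp [List.mem_range'_1] at hk ⊢; omega
        rw [List.foldr_cons, List.foldr_nil, h1, h2, factor_append (by omega) (by simp [h3]; omega),
          movedFactor, show d.length + 1 - 1 - i = d.length - i by omega]

/-- The terms of index `j` involve only the first `j` factors, so the last factor can be split off.
-/
theorem energy_eq_revEnergy {m : ℕ} {d : ColProd} (hd : Bounded m d) :
    energy m d = revEnergy m d.reverse := by
  induction d using List.reverseRecOn with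
  | nil => simp [energy, revEnergy]
  | append_singleton d y ih =>
    have hd' : Bounded m d := fun c hc => hd c (by simp [hc])
    have hlen : (d ++ [y]).length = d.length + 1 := by simp
    rw [List.reverse_append, List.reverse_singleton, List.singleton_append, revEnergy, ← ih hd',
      ← sum_passEnergy hd, energy, hlen, Finset.sum_Icc_succ_top (by omega), add_comm, energy]
    congr 1
    refine Finset.sum_congr rfl fun j hj => Finset.sum_congr rfl fun i hi => ?_
    rw [Finset.mem_Icc] at hj
    rw [Finset.mem_Ico] at hi
    rw [factor_append (by omega) (by omega), movedFactor_append hd' hi.2 hj.2]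

/-! ## Elementary properties of the energy -/

theorem Bounded.of_cons {m : ℕ} {x : Finset ℕ} {r : ColProd} (h : Bounded m (x :: r)) :
    x ⊆ Finset.Icc 1 m ∧ Bounded m r := ⟨h x (by simp), fun c hc => h c (by simp [hc])⟩

theorem Bounded.cons {m : ℕ} {x : Finset ℕ} {r : ColProd} (hx : x ⊆ Finset.Icc 1 m)
    (h : Bounded m r) : Bounded m (x :: r) := by
  intro c hc
  rcases List.mem_cons.1 hc with rfl | hc
  · exact hx
  · exact h c hc

theorem bounded_append {m : ℕ} {u v : ColProd} :
    Bounded m (u ++ v) ↔ Bounded m u ∧ Bounded m v := by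
  simp only [Bounded, List.mem_append]
  exact ⟨fun h => ⟨fun c hc => h c (.inl hc), fun c hc => h c (.inr hc)⟩,
    fun h c hc => hc.elim (h.1 c) (h.2 c)⟩

theorem bounded_reverse {m : ℕ} {u : ColProd} : Bounded m u.reverse ↔ Bounded m u := by
  simp [Bounded]

theorem passEnergy_succ {m : ℕ} {r : ColProd} {y : Finset ℕ} (hr : Bounded m r)
    (hy : y ⊆ Finset.Icc 1 m) : passEnergy (m + 1) r y = passEnergy m r y := by
  induction r generalizing y with
  | nil => rfl
  | cons x r ih =>
    obtain ⟨hx, hr⟩ := hr.of_cons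
    obtain ⟨h1, -, h3⟩ := rPair_succ hx hy
    rw [passEnergy, passEnergy, h1, h3, ih hr (rLeft_subset hx hy)]

theorem revEnergy_succ {m : ℕ} {r : ColProd} (hr : Bounded m r) :
    revEnergy (m + 1) r = revEnergy m r := by
  induction r with
  | nil => rfl
  | cons x r ih =>
    obtain ⟨hx, hr⟩ := hr.of_cons
    rw [revEnergy, revEnergy, passEnergy_succ hr hx, ih hr]

/-- The energy does not depend on the bound on the entries. -/
theorem energy_succ {m : ℕ} {d : ColProd} (hd : Bounded m d) :
    energy (m + 1) d = energy m d := by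
  have hs : Bounded (m + 1) d := fun c hc =>
    (hd c hc).trans (Finset.Icc_subset_Icc_right (by omega))
  rw [energy_eq_revEnergy hs, energy_eq_revEnergy hd, revEnergy_succ (bounded_reverse.2 hd)]

theorem passEnergy_eq_zero {m : ℕ} {r : ColProd} {y : Finset ℕ} (hr : Bounded m r)
    (hy : y ⊆ Finset.Icc 1 m) (h : ∀ x ∈ r, x ⊆ y ∨ y ⊆ x) : passEnergy m r y = 0 := by
  induction r generalizing y with
  | nil => rfl
  | cons x r ih =>
    obtain ⟨hx, hr⟩ := hr.of_cons
    obtain ⟨h1, -, h3⟩ := rPair_of_subset hx hy (h x (by simp))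
    rw [passEnergy, h1, h3, ih hr hy fun z hz => h z (by simp [hz])]

/-- The energy of a chain of columns for inclusion vanishes. -/
theorem energy_eq_zero {m : ℕ} {d : ColProd} (hd : Bounded m d)
    (h : ∀ x ∈ d, ∀ y ∈ d, x ⊆ y ∨ y ⊆ x) : energy m d = 0 := by
  rw [energy_eq_revEnergy hd]
  replace hd := bounded_reverse.2 hd
  replace h : ∀ x ∈ d.reverse, ∀ y ∈ d.reverse, x ⊆ y ∨ y ⊆ x := by simpa using h
  generalize d.reverse = e at hd h ⊢
  induction e with
  | nil => rfl
  | cons y r ih =>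
    obtain ⟨hy, hr⟩ := hd.of_cons
    rw [revEnergy, ih hr fun x hx z hz => h x (by simp [hx]) z (by simp [hz]),
      passEnergy_eq_zero hr hy fun x hx => h x (by simp [hx]) y (by simp)]

/-- Every column is contained in the full one, so the travelling column crosses it unchanged and at
no cost. -/
theorem passEnergy_full {m : ℕ} {r r' : ColProd} {y : Finset ℕ} (hr : Bounded m r)
    (hy : y ⊆ Finset.Icc 1 m) :
    passEnergy m (r ++ Finset.Icc 1 m :: r') y = passEnergy m (r ++ r') y := by
  induction r generalizing y with
  | nil =>
    obtain ⟨h1, -, h3⟩ := rPair_of_subset (subset_refl (Finset.Icc 1 m)) hy (.inr hy)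
    rw [List.nil_append, passEnergy, h1, h3, zero_add, List.nil_append]
  | cons x r ih =>
    obtain ⟨hx, hr⟩ := hr.of_cons
    rw [List.cons_append, passEnergy, ih hr (rLeft_subset hx hy), List.cons_append, passEnergy]

/-- A full column does not contribute to the energy. -/
theorem energy_full {m : ℕ} {u v : ColProd} (hu : Bounded m u) (hv : Bounded m v) :
    energy m (u ++ Finset.Icc 1 m :: v) = energy m (u ++ v) := by
  rw [energy_eq_revEnergy (bounded_append.2 ⟨hu, Bounded.cons subset_rfl hv⟩),
    energy_eq_revEnergy (bounded_append.2 ⟨hu, hv⟩)]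
  replace hu := bounded_reverse.2 hu
  replace hv := bounded_reverse.2 hv
  simp only [List.reverse_append, List.reverse_cons, List.append_assoc, List.singleton_append]
  generalize v.reverse = e at hv ⊢
  induction e with
  | nil =>
    rw [List.nil_append, List.nil_append, revEnergy, passEnergy_eq_zero hu subset_rfl, zero_add]
    exact fun x hx => .inl (hu x hx)
  | cons y r ih =>
    obtain ⟨hy, hr⟩ := hv.of_cons
    rw [List.cons_append, List.cons_append, revEnergy, revEnergy, ih hr, passEnergy_full hr hy]

/-! ## Invariance of the energy under the crystal operators -/

theorem lower_append_cases {i : ℕ} {u v w : ColProd} (h : lower i (u ++ v) = some w) :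
    (eps i v < phi i u ∧ ∃ u', lower i u = some u' ∧ w = u' ++ v) ∨
      (¬ eps i v < phi i u ∧ ∃ v', lower i v = some v' ∧ w = u ++ v') := by
  rw [lower_append] at h
  split_ifs at h with h1
  · obtain ⟨u', hu, rfl⟩ := Option.map_eq_some_iff.1 h
    exact .inl ⟨h1, u', hu, rfl⟩
  · obtain ⟨v', hv, rfl⟩ := Option.map_eq_some_iff.1 h
    exact .inr ⟨h1, v', hv, rfl⟩

/-- Equality up to one lowering operator. -/
def LowerStep (i : ℕ) (d d' : ColProd) : Prop := d' = d ∨ lower i d = some d'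

/-- A lowering operator acts on one side of a tensor product only. Allowing equality makes the
relation pass to both sides, as an induction over the factors requires. -/
theorem LowerStep.of_append {i : ℕ} {u v u' v' : ColProd} (h : LowerStep i (u ++ v) (u' ++ v'))
    (hu : u'.length = u.length) : LowerStep i u u' ∧ LowerStep i v v' := by
  rcases h with h | h
  · obtain ⟨rfl, rfl⟩ := List.append_inj h hu
    exact ⟨.inl rfl, .inl rfl⟩
  · rcases lower_append_cases h with ⟨-, w, hw, h1⟩ | ⟨-, w, hw, h1⟩
    · obtain ⟨rfl, rfl⟩ := List.append_inj h1 (by rw [hu, length_of_lower hw])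
      exact ⟨.inr hw, .inl rfl⟩
    · obtain ⟨rfl, rfl⟩ := List.append_inj h1 hu
      exact ⟨.inl rfl, .inr hw⟩

section pair

variable {m i : ℕ} {x y x' y' : Finset ℕ}

theorem eps_rPair (hx : x ⊆ Finset.Icc 1 m) (hy : y ⊆ Finset.Icc 1 m) (h1 : 1 ≤ i) (hm : i < m) :
    eps i [rLeft m x y, rRight m x y] = eps i [x, y] := by
  rw [← rMatrix_pair hx hy]
  exact (rMatrix_isCrystalIso m _ _).eps_eq (isStable_twoCols m _ _) h1 hm
    (mem_twoCols.2 ⟨x, y, rfl, hx, hy, rfl, rfl⟩)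

theorem lower_rPair (hx : x ⊆ Finset.Icc 1 m) (hy : y ⊆ Finset.Icc 1 m) (h1 : 1 ≤ i) (hm : i < m)
    (h : lower i [x, y] = some [x', y']) :
    lower i [rLeft m x y, rRight m x y] = some [rLeft m x' y', rRight m x' y'] := by
  have h2 := (rMatrix_isCrystalIso m _ _).map_lower i h1 hm [x, y]
    (mem_twoCols.2 ⟨x, y, rfl, hx, hy, rfl, rfl⟩)
  have h3 := map_card_of_lower h
  have h4 : Bounded m [x', y'] :=
    (Bounded.cons hx (Bounded.cons hy (by simp [Bounded]))).lower hm h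
  simp only [List.map_cons, List.map_nil, List.cons.injEq, and_true] at h3
  rw [rMatrix_pair hx hy, h, Option.map_some, ← h3.1, ← h3.2,
    rMatrix_pair (h4 x' (by simp)) (h4 y' (by simp))] at h2
  exact h2

/-- When the left column is the larger one, the local energy is the final gap, which `lower_slide`
preserves; the R-matrix reduces the other case to this one. -/
theorem localEnergy_lower (hx : x ⊆ Finset.Icc 1 m) (hy : y ⊆ Finset.Icc 1 m) (h1 : 1 ≤ i)
    (hm : i < m) (h : lower i [x, y] = some [x', y']) :
    localEnergy m x' y' = localEnergy m x y := by
  have key : ∀ x y x' y', x ⊆ Finset.Icc 1 m → y ⊆ Finset.Icc 1 m → y.card ≤ x.card →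
      lower i [x, y] = some [x', y'] → localEnergy m x' y' = localEnergy m x y := by
    intro x y x' y' hx hy hc h
    have h3 := map_card_of_lower h
    have h4 : Bounded m [x', y'] :=
      (Bounded.cons hx (Bounded.cons hy (by simp [Bounded]))).lower hm h
    simp only [List.map_cons, List.map_nil, List.cons.injEq, and_true] at h3
    rw [localEnergy_of_le hx hy hc, localEnergy_of_le (h4 x' (by simp)) (h4 y' (by simp))
      (by rwa [h3.1, h3.2])]
    obtain ⟨x'', y'', h5, h6, -⟩ := lower_slide (θ := 0) h1 hm h
    simp only [List.cons.injEq, and_true] at h5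
    rw [h5.1, h5.2, h6]
  have h4 : Bounded m [x', y'] :=
    (Bounded.cons hx (Bounded.cons hy (by simp [Bounded]))).lower hm h
  rcases le_total y.card x.card with hc | hc
  · exact key x y x' y' hx hy hc h
  · rw [← localEnergy_rPair hx hy, ← localEnergy_rPair (h4 x' (by simp)) (h4 y' (by simp))]
    exact key _ _ _ _ (rLeft_subset hx hy) (rRight_subset hx hy)
      (by rwa [card_rLeft hx hy, card_rRight hx hy]) (lower_rPair hx hy h1 hm h)

/-- The R-matrix preserves `eps`, so the tensor product rule selects the same side before and after.
-/
theorem LowerStep.rPair {u u' : ColProd} (hx : x ⊆ Finset.Icc 1 m) (hy : y ⊆ Finset.Icc 1 m)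
    (h1 : 1 ≤ i) (hm : i < m) (hu : u'.length = u.length)
    (h : LowerStep i (u ++ [x, y]) (u' ++ [x', y'])) :
    LowerStep i (u ++ [rLeft m x y, rRight m x y]) (u' ++ [rLeft m x' y', rRight m x' y']) := by
  rcases h with h | h
  · obtain ⟨rfl, h2⟩ := List.append_inj h hu
    simp only [List.cons.injEq, and_true] at h2
    rw [h2.1, h2.2]
    exact .inl rfl
  · right
    rw [lower_append, eps_rPair hx hy h1 hm]
    rcases lower_append_cases h with ⟨h2, w, hw, h3⟩ | ⟨h2, w, hw, h3⟩
    · obtain ⟨rfl, h4⟩ := List.append_inj h3 (by rw [hu, length_of_lower hw])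
      simp only [List.cons.injEq, and_true] at h4
      rw [if_pos h2, hw, h4.1, h4.2]
      rfl
    · obtain ⟨rfl, rfl⟩ := List.append_inj h3 hu
      rw [if_neg h2, lower_rPair hx hy h1 hm hw]
      rfl

end pair

theorem passEnergy_lower {m i : ℕ} {r r' : ColProd} {y y' : Finset ℕ} (hr : Bounded m r)
    (hy : y ⊆ Finset.Icc 1 m) (h1 : 1 ≤ i) (hm : i < m) (hl : r'.length = r.length)
    (h : LowerStep i (r.reverse ++ [y]) (r'.reverse ++ [y'])) :
    passEnergy m r' y' = passEnergy m r y := by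
  induction r generalizing r' y y' with
  | nil => rw [List.length_eq_zero_iff.1 hl]; rfl
  | cons x r ih =>
    obtain ⟨hx, hr⟩ := hr.of_cons
    rcases r' with _ | ⟨x', r'⟩
    · simp at hl
    have hl' : r'.length = r.length := by simpa using hl
    simp only [List.reverse_cons, List.append_assoc, List.singleton_append] at h
    have h2 := (h.of_append (by simp [hl'])).2
    have h3 := h.rPair hx hy h1 hm (by simp [hl'])
    have h4 : LowerStep i (r.reverse ++ [rLeft m x y]) (r'.reverse ++ [rLeft m x' y']) := by
      refine (LowerStep.of_append (v := [rRight m x y]) (v' := [rRight m x' y']) ?_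
        (by simp [hl'])).1
      simpa using h3
    rw [passEnergy, passEnergy, ih hr (rLeft_subset hx hy) hl' h4]
    congr 1
    rcases h2 with h2 | h2
    · simp only [List.cons.injEq, and_true] at h2
      rw [h2.1, h2.2]
    · exact localEnergy_lower hx hy h1 hm h2

theorem revEnergy_lower {m i : ℕ} {r r' : ColProd} (hr : Bounded m r) (h1 : 1 ≤ i) (hm : i < m)
    (hl : r'.length = r.length) (h : LowerStep i r.reverse r'.reverse) :
    revEnergy m r' = revEnergy m r := by
  induction r generalizing r' with
  | nil => rw [List.length_eq_zero_iff.1 hl]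
  | cons y r ih =>
    obtain ⟨hy, hr⟩ := hr.of_cons
    rcases r' with _ | ⟨y', r'⟩
    · simp at hl
    have hl' : r'.length = r.length := by simpa using hl
    rw [List.reverse_cons, List.reverse_cons] at h
    rw [revEnergy, revEnergy, passEnergy_lower hr hy h1 hm hl' h,
      ih hr hl' (h.of_append (by simp [hl'])).1]

/-- The energy is constant on the connected components. -/
theorem energy_lower {m i : ℕ} {d d' : ColProd} (hd : Bounded m d) (h1 : 1 ≤ i) (hm : i < m)
    (h : lower i d = some d') : energy m d' = energy m d := by
  rw [energy_eq_revEnergy hd, energy_eq_revEnergy (hd.lower hm h)]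
  exact revEnergy_lower (bounded_reverse.2 hd) h1 hm (by simp [length_of_lower h])
    (.inr (by simpa using h))

/-! ## The energy and promotion -/

/-- A telescoping sum of `localEnergy_promote`: the left factor produced by one exchange is the
right factor of the next. -/
theorem passEnergy_promote {m : ℕ} (hm : 1 ≤ m) {r : ColProd} {y : Finset ℕ} (hr : Bounded m r)
    (hy : y ⊆ Finset.Icc 1 m) :
    (passEnergy m (r.map (promote m)) (promote m y) : ℤ) + (if m ∈ y then 1 else 0) =
      passEnergy m r y + (if m ∈ front m r y then 1 else 0) := by
  induction r generalizing y with
  | nil => rfl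
  | cons x r ih =>
    obtain ⟨hx, hr⟩ := hr.of_cons
    have h1 := ih hr (rLeft_subset hx hy)
    have h2 := localEnergy_promote hm hx hy
    rw [List.map_cons, passEnergy, passEnergy, front, (rPair_promote hm hx hy).1]
    push_cast
    omega

theorem IsHighest.of_append {m : ℕ} {u v : ColProd} (h : IsHighest m (u ++ v)) :
    IsHighest m u := by
  intro i h1 hm
  have := h i h1 hm
  rw [eps_append] at this
  omega

theorem IsHighest.rPair {m : ℕ} {u : ColProd} {x y : Finset ℕ} (hx : x ⊆ Finset.Icc 1 m)
    (hy : y ⊆ Finset.Icc 1 m) (h : IsHighest m (u ++ [x, y])) :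
    IsHighest m (u ++ [rLeft m x y, rRight m x y]) := by
  intro i h1 hm
  have := h i h1 hm
  rwa [eps_append, eps_rPair hx hy h1 hm, ← eps_append]

/-- Exchanges preserve highest weights and carry the size of `y` to the front, where the factor must
be an initial segment. -/
theorem front_eq {m : ℕ} {r : ColProd} {y : Finset ℕ} (hr : Bounded m r)
    (hy : y ⊆ Finset.Icc 1 m) (h : IsHighest m (r.reverse ++ [y])) :
    front m r y = Finset.Icc 1 y.card := by
  induction r generalizing y with
  | nil => exact (h.isInitial hy).eq_Icc hy
  | cons x r ih =>
    obtain ⟨hx, hr⟩ := hr.of_cons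
    simp only [List.reverse_cons, List.append_assoc, List.singleton_append] at h
    have h2 := h.rPair hx hy
    rw [front, ih hr (rLeft_subset hx hy), card_rLeft hx hy]
    refine IsHighest.of_append (v := [rRight m x y]) ?_
    simpa using h2

/-- The front reached by a non-full factor `y` misses `m`, so its passage loses one unit exactly
when `m ∈ y`. -/
theorem energy_promote {m : ℕ} (hm : 1 ≤ m) {d : ColProd} (hd : Bounded m d) (h : IsHighest m d)
    (hf : ∀ c ∈ d, c.card < m) :
    energy m (d.map (promote m)) + mult m d = energy m d := by
  have hd' : Bounded m (d.map (promote m)) := by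
    intro c hc
    obtain ⟨c', hc', rfl⟩ := List.mem_map.1 hc
    exact promote_subset (hd c' hc')
  rw [energy_eq_revEnergy hd', energy_eq_revEnergy hd, ← List.map_reverse,
    show mult m d = mult m d.reverse by simp [mult]]
  replace hd := bounded_reverse.2 hd
  replace hf : ∀ c ∈ d.reverse, c.card < m := by simpa using hf
  rw [← List.reverse_reverse d] at h
  generalize d.reverse = r at hd hf h ⊢
  induction r with
  | nil => simp [revEnergy, mult]
  | cons y r ih =>
    obtain ⟨hy, hr⟩ := hd.of_cons
    rw [List.reverse_cons] at h
    have h1 := ih hr (fun c hc => hf c (by simp [hc])) h.of_append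
    have h2 := passEnergy_promote hm hr hy
    have h3 := hf y (by simp)
    have h5 : m ∉ front m r y := by
      rw [front_eq hr hy h, Finset.mem_Icc]
      omega
    rw [if_neg h5] at h2
    rw [List.map_cons, revEnergy, revEnergy]
    simp only [mult, List.countP_cons] at h1 ⊢
    by_cases h4 : m ∈ y <;> simp only [h4] at h2 ⊢ <;> simp at h2 ⊢ <;> omega

/-! ## Duality -/

/-- The factor `d(i)` of the dual of `b`. -/
def row (b : ColProd) (i : ℕ) : Finset ℕ := (Finset.Icc 1 b.length).filter fun j => i ∈ col b j

theorem dual_eq (n : ℕ) (b : ColProd) : dual n b = (List.range' 1 n).map (row b) := rfl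

theorem mem_row {b : ColProd} {i j : ℕ} :
    j ∈ row b i ↔ (1 ≤ j ∧ j ≤ b.length) ∧ i ∈ col b j := by simp [row]

theorem col_append (u v : ColProd) (c : Finset ℕ) : col (u ++ c :: v) (v.length + 1) = c := by
  simp [col, List.getD_eq_getElem?_getD]

theorem mem_row_append {u v : ColProd} {c : Finset ℕ} {i : ℕ} :
    v.length + 1 ∈ row (u ++ c :: v) i ↔ i ∈ c := by
  rw [mem_row, col_append]
  simp

theorem col_length_sub {b : ColProd} {k : ℕ} (hk : k < b.length) :
    col b (b.length - k) = b[k] := by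
  rw [col, List.getD_eq_getElem?_getD, List.getElem?_reverse (by omega),
    show b.length - 1 - (b.length - k - 1) = k by omega]
  simp [hk]

theorem bounded_dual (n : ℕ) (b : ColProd) : Bounded b.length (dual n b) := by
  intro c hc
  obtain ⟨i, -, rfl⟩ := List.mem_map.1 hc
  exact Finset.filter_subset _ _

theorem dual_injective {n : ℕ} {b b' : ColProd} (hb : Bounded n b) (hb' : Bounded n b')
    (hl : b.length = b'.length) (h : dual n b = dual n b') : b = b' := by
  rw [dual_eq, dual_eq, List.map_inj_left] at h
  refine List.ext_getElem hl fun k h1 h2 => ?_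
  ext i
  by_cases hi : i ∈ Finset.Icc 1 n
  · have h3 := h i (by rw [List.mem_range'_1]; rw [Finset.mem_Icc] at hi; omega)
    have h4 : b.length - k ∈ row b i ↔ b.length - k ∈ row b' i := by rw [h3]
    rw [mem_row, mem_row, col_length_sub h1, hl, col_length_sub h2] at h4
    have h5 : 1 ≤ b'.length - k := by omega
    simpa [h5] using h4
  · exact ⟨fun h3 => absurd (hb _ (List.getElem_mem h1) h3) hi,
      fun h3 => absurd (hb' _ (List.getElem_mem h2) h3) hi⟩

section link

variable {j n : ℕ} {x y : Finset ℕ} {f : ℕ → Finset ℕ}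

theorem map_range'_succ (a : ℕ) :
    (List.range' 1 (a + 1)).map f = (List.range' 1 a).map f ++ [f (a + 1)] := by
  rw [List.range'_concat]
  simp [add_comm]

/-- Here `x` and `y` play the roles of the columns `c_{j+1}` and `c_j`. The factor `f i` is a `-` if
`i` is only in `x` and a `+` if `i` is only in `y`, so bracketing the two columns and cancelling
signs are the same process. The gap counts the surviving `+`, the running maximum the surviving `-`.
-/
theorem phi_map_range' (hx : ∀ i, 1 ≤ i → (j + 1 ∈ f i ↔ i ∈ x))
    (hy : ∀ i, 1 ≤ i → (j ∈ f i ↔ i ∈ y)) (a : ℕ) :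
    phi j ((List.range' 1 a).map f) = gap 0 x y a := by
  induction a with
  | zero => rfl
  | succ a ih =>
    rw [map_range'_succ, phi_append, ih, gap]
    have h1 := hx (a + 1) (by omega)
    have h2 := hy (a + 1) (by omega)
    simp only [phi, eps, IsPlus, IsMinus, h1, h2]
    by_cases h3 : a + 1 ∈ x <;> by_cases h4 : a + 1 ∈ y <;> simp [h3, h4] <;> omega

theorem eps_map_range' (hxn : x ⊆ Finset.Icc 1 n) (hyn : y ⊆ Finset.Icc 1 n)
    (hx : ∀ i, 1 ≤ i → (j + 1 ∈ f i ↔ i ∈ x))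
    (hy : ∀ i, 1 ≤ i → (j ∈ f i ↔ i ∈ y)) (a : ℕ) :
    (eps j ((List.range' 1 a).map f) : ℤ) = gap 0 x y a + cnt x a - cnt y a := by
  induction a with
  | zero => simp [eps, gap, cnt_zero hxn, cnt_zero hyn]
  | succ a ih =>
    rw [map_range'_succ, eps_append, phi_map_range' hx hy, gap, cnt_succ, cnt_succ]
    have h1 := hx (a + 1) (by omega)
    have h2 := hy (a + 1) (by omega)
    simp only [eps, IsPlus, IsMinus, h1, h2]
    by_cases h3 : a + 1 ∈ x <;> by_cases h4 : a + 1 ∈ y <;> simp [h3, h4] <;> omega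

/-- By `gap_add`, a floor not exceeding the running maximum has no effect in the end. -/
theorem gap_eq_of_le_eps (hxn : x ⊆ Finset.Icc 1 n) (hyn : y ⊆ Finset.Icc 1 n)
    (hx : ∀ i, 1 ≤ i → (j + 1 ∈ f i ↔ i ∈ x))
    (hy : ∀ i, 1 ≤ i → (j ∈ f i ↔ i ∈ y)) {a θ : ℕ} (h : θ ≤ eps j ((List.range' 1 a).map f)) :
    gap θ x y a = gap 0 x y a := by
  have h1 := gap_add hxn hyn θ a
  have h2 := eps_map_range' hxn hyn hx hy a
  omega

/-- Raising the dual amounts to sliding one letter. -/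
theorem raise_map_range' (hxn : x ⊆ Finset.Icc 1 n) (hyn : y ⊆ Finset.Icc 1 n)
    (hx : ∀ i, 1 ≤ i → (j + 1 ∈ f i ↔ i ∈ x))
    (hy : ∀ i, 1 ≤ i → (j ∈ f i ↔ i ∈ y)) {a : ℕ}
    (h : eps j ((List.range' 1 a).map f) ≠ 0) :
    raise j ((List.range' 1 a).map f) = some ((List.range' 1 a).map fun i =>
      if i ∈ moved a (eps j ((List.range' 1 a).map f) - 1) x y then up j (f i) else f i) := by
  -- The starting value `eps - 1` lets only the last rise of the running maximum through, which is
  -- the letter carrying the rightmost surviving `-`.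
  induction a with
  | zero => exact absurd rfl h
  | succ a ih =>
    have h1 := hx (a + 1) (by omega)
    have h2 := hy (a + 1) (by omega)
    have hphi := phi_map_range' hx hy a
    have heps := eps_map_range' hxn hyn hx hy a
    have hgap := fun θ => gap_eq_of_le_eps hxn hyn hx hy (a := a) (θ := θ)
    have hcard := card_moved (θ := eps j ((List.range' 1 a).map f)) a hxn hyn
    have hg2 := hgap _ le_rfl
    have hg1 := hgap (eps j ((List.range' 1 a).map f) - 1) (by omega)
    rw [map_range'_succ, eps_append, hphi] at h ⊢
    rw [raise_append, hphi, map_range'_succ]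
    have hlt : ∀ i ∈ List.range' 1 a, i ≠ a + 1 := by
      intro i hi; rw [List.mem_range'_1] at hi; omega
    have hnm : ∀ θ, a + 1 ∉ moved a θ x y := fun θ => by simp [mem_moved]
    by_cases hM : a + 1 ∈ x ∧ a + 1 ∉ y
    · have hM' : IsMinus j (f (a + 1)) := ⟨h1.2 hM.1, fun h => hM.2 (h2.1 h)⟩
      have e1 : eps j [f (a + 1)] = 1 := by simp [eps, hM']
      rw [e1] at h ⊢
      by_cases hg : gap 0 x y a = 0
      · have hr : raise j [f (a + 1)] = some [up j (f (a + 1))] := by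
          simp [raise_cons, hM', eps]
        rw [if_neg (by omega), hr, hg, Option.map_some, moved_succ,
          show eps j ((List.range' 1 a).map f) + (1 - 0) - 1 = eps j ((List.range' 1 a).map f) by
            omega, hg2, if_pos ⟨hM, hg⟩, if_pos (Finset.mem_insert_self _ _)]
        -- The rise at `a + 1` is the last one; with the floor at the previous maximum no earlier
        -- letter moves.
        have hem : moved a (eps j ((List.range' 1 a).map f)) x y = ∅ := by
          rw [← Finset.card_eq_zero]; omega
        rw [hem]
        congr 2
        refine List.map_congr_left fun i hi => ?_
        rw [if_neg (by simpa using hlt i hi)]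
      · rw [if_pos (by omega), show eps j ((List.range' 1 a).map f) + (1 - gap 0 x y a) =
          eps j ((List.range' 1 a).map f) by omega, ih (by omega), Option.map_some, moved_succ,
          hg1, if_neg (fun h => hg h.2), if_neg (hnm _)]
    · have hM' : ¬ IsMinus j (f (a + 1)) := fun h => hM ⟨h1.1 h.1, fun h' => h.2 (h2.2 h')⟩
      have e1 : eps j [f (a + 1)] = 0 := by simp [eps, hM']
      rw [e1] at h ⊢
      rw [if_pos (by omega), show eps j ((List.range' 1 a).map f) + (0 - gap 0 x y a) =
          eps j ((List.range' 1 a).map f) by omega, ih (by omega), Option.map_some, moved_succ,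
          if_neg (fun h => hM h.1), if_neg (hnm _)]

end link

/-! ## Sliding one letter between adjacent columns -/

/-- The number of letters of `x` that can be slid to `y`. -/
def slideCount (n : ℕ) (x y : Finset ℕ) : ℕ := gap 0 x y n + x.card - y.card

theorem mem_row_pair {u v : ColProd} {x y : Finset ℕ} (i : ℕ) :
    (v.length + 1 + 1 ∈ row (u ++ x :: y :: v) i ↔ i ∈ x) ∧
      (v.length + 1 ∈ row (u ++ x :: y :: v) i ↔ i ∈ y) := by
  constructor
  · exact mem_row_append (v := y :: v)
  · have := mem_row_append (u := u ++ [x]) (v := v) (c := y) (i := i)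
    simpa using this

theorem eps_dual {n : ℕ} {u v : ColProd} {x y : Finset ℕ} (hx : x ⊆ Finset.Icc 1 n)
    (hy : y ⊆ Finset.Icc 1 n) :
    eps (v.length + 1) (dual n (u ++ x :: y :: v)) = slideCount n x y := by
  have h := eps_map_range' (f := row (u ++ x :: y :: v)) hx hy (fun i _ => (mem_row_pair i).1)
    (fun i _ => (mem_row_pair i).2) n
  rw [cnt_eq_card hx le_rfl, cnt_eq_card hy le_rfl] at h
  rw [dual_eq, slideCount]
  omega

theorem col_congr {u v : ColProd} {x y x' y' : Finset ℕ} {k : ℕ} (hk : 1 ≤ k)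
    (h1 : k ≠ v.length + 1) (h2 : k ≠ v.length + 1 + 1) :
    col (u ++ x' :: y' :: v) k = col (u ++ x :: y :: v) k := by
  simp only [col, List.reverse_append, List.reverse_cons, List.append_assoc,
    List.singleton_append, List.getD_eq_getElem?_getD]
  congr 1
  rcases Nat.lt_or_ge (k - 1) v.length with h | h
  · rw [List.getElem?_append_left (by simpa using h), List.getElem?_append_left (by simpa using h)]
  · obtain ⟨c, rfl⟩ : ∃ c, k = v.length + (c + 2) + 1 := ⟨k - v.length - 3, by omega⟩
    rw [Nat.add_sub_cancel, List.getElem?_append_right (l₂ := [y', x'] ++ _) (by simp),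
      List.getElem?_append_right (l₂ := [y, x] ++ _) (by simp)]
    simp [show v.length + (c + 2) - v.length = c + 2 by omega]

/-- The bridge between the two crystals: an operator on `b^*` is a slide between adjacent columns of
`b`, and slides commute with the operators on `b`. -/
theorem raise_dual {n : ℕ} {u v : ColProd} {x y : Finset ℕ} (hx : x ⊆ Finset.Icc 1 n)
    (hy : y ⊆ Finset.Icc 1 n) (h : slideCount n x y ≠ 0) :
    raise (v.length + 1) (dual n (u ++ x :: y :: v)) =
      some (dual n (u ++ slideL n (slideCount n x y - 1) x y ::
        slideR n (slideCount n x y - 1) x y :: v)) := by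
  rw [← eps_dual (u := u) (v := v) hx hy] at h ⊢
  rw [dual_eq] at h ⊢
  rw [raise_map_range' hx hy (fun i _ => (mem_row_pair i).1) (fun i _ => (mem_row_pair i).2) h]
  generalize eps (v.length + 1) ((List.range' 1 n).map (row (u ++ x :: y :: v))) - 1 = θ
  congr 1
  rw [dual_eq]
  refine List.map_congr_left fun i _ => ?_
  ext k
  by_cases hk1 : k = v.length + 1
  · subst hk1
    rw [(mem_row_pair i).2, mem_slideR]
    split_ifs with hi
    · simp [mem_up, hi]
    · rw [(mem_row_pair i).2]; simp [hi]
  · by_cases hk2 : k = v.length + 1 + 1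
    · subst hk2
      rw [(mem_row_pair i).1, mem_slideL]
      split_ifs with hi
      · simp [mem_up, hi]
      · rw [(mem_row_pair i).1]; simp [hi]
    · have h3 : k ∈ row (u ++ x :: y :: v) i ↔
          k ∈ row (u ++ slideL n θ x y :: slideR n θ x y :: v) i := by
        rw [mem_row, mem_row]
        have hl : (u ++ slideL n θ x y :: slideR n θ x y :: v).length =
            (u ++ x :: y :: v).length := by simp
        rw [hl]
        exact and_congr_right fun hk => by rw [col_congr hk.1 hk1 hk2]
      rw [← h3]
      split_ifs with hi
      · simp [mem_up, hk1, hk2]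
      · rfl

/-- Sliding preserves `eps` and `phi` of the pair, so inside a longer product `lower` still chooses
the same part to act on. -/
theorem lower_replace {n i : ℕ} {u v w : ColProd} {x y : Finset ℕ} (h1 : 1 ≤ i) (hn : i < n)
    (h : lower i (u ++ x :: y :: v) = some w) :
    ∃ u' x' y' v', w = u' ++ x' :: y' :: v' ∧ u'.length = u.length ∧ v'.length = v.length ∧
      slideCount n x' y' = slideCount n x y ∧
      ∀ θ, lower i (u ++ slideL n θ x y :: slideR n θ x y :: v) =
        some (u' ++ slideL n θ x' y' :: slideR n θ x' y' :: v') := by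
  have e1 : ∀ x y, eps i (x :: y :: v) = eps i [x, y] + (eps i v - phi i [x, y]) := fun x y =>
    eps_append i [x, y] v
  have e2 : ∀ x y, lower i (x :: y :: v) = _ := fun x y => lower_append i [x, y] v
  have key : ∀ θ, lower i (u ++ slideL n θ x y :: slideR n θ x y :: v) = _ := fun θ =>
    lower_append i u _
  simp only [e1, e2, (eps_phi_slide x y h1 hn).1, (eps_phi_slide x y h1 hn).2] at key
  rw [lower_append, e1, e2] at h
  split_ifs at h with h2 h3
  · obtain ⟨u', hu, rfl⟩ := Option.map_eq_some_iff.1 h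
    refine ⟨u', x, y, v, rfl, length_of_lower hu, rfl, rfl, fun θ => ?_⟩
    rw [key, if_pos h2, hu]; rfl
  · rw [Option.map_map] at h
    obtain ⟨w', hw, rfl⟩ := Option.map_eq_some_iff.1 h
    obtain ⟨x', y', rfl, h4, -⟩ := lower_slide (θ := 0) h1 hn hw
    have h5 := map_card_of_lower hw
    simp only [List.map_cons, List.map_nil, List.cons.injEq, and_true] at h5
    refine ⟨u, x', y', v, rfl, rfl, rfl, by rw [slideCount, h4, h5.1, h5.2]; rfl, fun θ => ?_⟩
    obtain ⟨x'', y'', h6, -, h7⟩ := lower_slide (θ := θ) h1 hn hw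
    simp only [List.cons.injEq, and_true] at h6
    rw [key, if_neg h2, if_pos h3, h7, h6.1, h6.2]; rfl
  · rw [Option.map_map] at h
    obtain ⟨v', hv, rfl⟩ := Option.map_eq_some_iff.1 h
    refine ⟨u, x, y, v', rfl, rfl, length_of_lower hv, rfl, fun θ => ?_⟩
    rw [key, if_neg h2, if_neg h3, hv]; rfl

theorem lower_eq_none_replace {n i : ℕ} {u v : ColProd} {x y : Finset ℕ} (h1 : 1 ≤ i) (hn : i < n)
    (θ : ℕ) : eps i (u ++ slideL n θ x y :: slideR n θ x y :: v) = eps i (u ++ x :: y :: v) ∧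
      phi i (u ++ slideL n θ x y :: slideR n θ x y :: v) = phi i (u ++ x :: y :: v) := by
  have e1 : ∀ x y, eps i (x :: y :: v) = eps i [x, y] + (eps i v - phi i [x, y]) := fun x y =>
    eps_append i [x, y] v
  have e2 : ∀ x y, phi i (x :: y :: v) = phi i v + (phi i [x, y] - eps i v) := fun x y =>
    phi_append i [x, y] v
  simp only [eps_append, phi_append, e1, e2, (eps_phi_slide x y h1 hn).1,
    (eps_phi_slide x y h1 hn).2, and_self]

/-- The statistics of the dual crystal are constant on components. -/
theorem eps_dual_lower {n i j : ℕ} {b b' : ColProd} (hb : Bounded n b) (h1 : 1 ≤ i) (hn : i < n)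
    (h : lower i b = some b') (hj1 : 1 ≤ j) (hj : j < b.length) :
    eps j (dual n b') = eps j (dual n b) := by
  obtain ⟨u, x, y, v, rfl, h2⟩ := exists_split_pair (d := b) (j := b.length - j) (by omega)
    (by omega)
  have h3 : j = v.length + 1 := by simp at h2 hj; omega
  have hb' := hb.lower hn h
  obtain ⟨u', x', y', v', rfl, h4, h5, h6, -⟩ := lower_replace h1 hn h
  rw [h3, eps_dual (hb x (by simp)) (hb y (by simp)), ← h5,
    eps_dual (hb' x' (by simp)) (hb' y' (by simp)), h6]

/-- Slide the last letter possible from the factor at position `k` (counted from `0`) to the next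
one. -/
def slideAt (n : ℕ) : ℕ → ColProd → ColProd
  | 0, x :: y :: v =>
    slideL n (slideCount n x y - 1) x y :: slideR n (slideCount n x y - 1) x y :: v
  | k + 1, c :: v => c :: slideAt n k v
  | _, b => b

theorem slideAt_append {n : ℕ} {u v : ColProd} {x y : Finset ℕ} :
    slideAt n u.length (u ++ x :: y :: v) = u ++ slideL n (slideCount n x y - 1) x y ::
      slideR n (slideCount n x y - 1) x y :: v := by
  induction u with
  | nil => rfl
  | cons c u ih => rw [List.length_cons, List.cons_append, slideAt, ih, List.cons_append]

theorem exists_split_at {b : ColProd} {k : ℕ} (h : k + 2 ≤ b.length) :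
    ∃ u x y v, b = u ++ x :: y :: v ∧ u.length = k := by
  obtain ⟨u, x, y, v, h1, h2⟩ := exists_split_pair (d := b) (j := k + 1) (by omega) (by omega)
  exact ⟨u, x, y, v, h1, by omega⟩

theorem lower_slideAt {n i k : ℕ} {b : ColProd} (h1 : 1 ≤ i) (hn : i < n) (hk : k + 2 ≤ b.length) :
    lower i (slideAt n k b) = (lower i b).map (slideAt n k) := by
  obtain ⟨u, x, y, v, rfl, rfl⟩ := exists_split_at hk
  rw [slideAt_append]
  rcases h : lower i (u ++ x :: y :: v) with _ | w
  · rw [Option.map_none, lower_eq_none, (lower_eq_none_replace h1 hn _).2]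
    exact (lower_eq_none _ _).1 h
  · obtain ⟨u', x', y', v', rfl, h4, -, h6, h7⟩ := lower_replace h1 hn h
    rw [h7, Option.map_some, ← h4, slideAt_append, h6]

theorem eps_slideAt {n i k : ℕ} {b : ColProd} (h1 : 1 ≤ i) (hn : i < n) (hk : k + 2 ≤ b.length) :
    eps i (slideAt n k b) = eps i b ∧ phi i (slideAt n k b) = phi i b := by
  obtain ⟨u, x, y, v, rfl, rfl⟩ := exists_split_at hk
  rw [slideAt_append]
  exact lower_eq_none_replace h1 hn _

theorem raise_slideAt {n i k : ℕ} {b : ColProd} (h1 : 1 ≤ i) (hn : i < n) (hk : k + 2 ≤ b.length) :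
    raise i (slideAt n k b) = (raise i b).map (slideAt n k) := by
  rcases h : raise i b with _ | w
  · rw [Option.map_none, raise_eq_none, (eps_slideAt h1 hn hk).1]
    exact (raise_eq_none _ _).1 h
  · have h2 := lower_slideAt (b := w) (k := k) h1 hn (by rwa [length_of_raise h])
    rw [lower_of_raise h] at h2
    exact raise_of_lower h2

/-- Position `k` from the left, counted from zero, holds `c_{ℓ-k}`, and its right neighbour is
`c_{ℓ-k-1}`; hence the index `ℓ - 1 - k`. -/
theorem raise_dual_slideAt {n k : ℕ} {b : ColProd} (hb : Bounded n b) (hk : k + 2 ≤ b.length)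
    (h : eps (b.length - 1 - k) (dual n b) ≠ 0) :
    raise (b.length - 1 - k) (dual n b) = some (dual n (slideAt n k b)) := by
  obtain ⟨u, x, y, v, rfl, rfl⟩ := exists_split_at hk
  have h3 : (u ++ x :: y :: v).length - 1 - u.length = v.length + 1 := by simp
  rw [h3] at h ⊢
  have hx := hb x (by simp)
  have hy := hb y (by simp)
  rw [eps_dual hx hy] at h
  rw [raise_dual hx hy h, slideAt_append]

/-! ## Connected components -/

theorem component_induction {n : ℕ} {b : ColProd} {P : ColProd → Prop} (h0 : P b)
    (hl : ∀ i, 1 ≤ i → i < n → ∀ z ∈ component n b, P z → ∀ z', lower i z = some z' → P z')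
    (hr : ∀ i, 1 ≤ i → i < n → ∀ z ∈ component n b, P z → ∀ z', raise i z = some z' → P z')
    {z : ColProd} (hz : z ∈ component n b) : P z := by
  have hz' : Relation.EqvGen (fun y z => ∃ i, 1 ≤ i ∧ i < n ∧ lower i y = some z) b z := hz
  rw [← Relation.EqvGen.reflTransGen_symmGen] at hz'
  induction hz' with
  | refl => exact h0
  | @tail y _ h1 h2 ih =>
    have h1' : y ∈ component n b := by
      rw [Relation.EqvGen.reflTransGen_symmGen] at h1
      exact h1
    rcases h2 with ⟨i, hi, hn, h⟩ | ⟨i, hi, hn, h⟩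
    · exact hl i hi hn _ h1' (ih h1') _ h
    · exact hr i hi hn _ h1' (ih h1') _ (raise_of_lower h)

theorem mem_component_self (n : ℕ) (b : ColProd) : b ∈ component n b := Relation.EqvGen.refl b

theorem isStable_component (n : ℕ) (b : ColProd) : IsStable n (component n b) := by
  rintro i h1 hn z hz z' (h | h)
  · exact Relation.EqvGen.trans _ _ _ hz
      (Relation.EqvGen.symm _ _ (Relation.EqvGen.rel _ _ ⟨i, h1, hn, lower_of_raise h⟩))
  · exact Relation.EqvGen.trans _ _ _ hz (Relation.EqvGen.rel _ _ ⟨i, h1, hn, h⟩)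

/-- By the last clause, being a tableau and admitting a slide at a given place are properties of the
whole component. -/
theorem component_bounded {n : ℕ} {b z : ColProd} (hb : Bounded n b) (hz : z ∈ component n b) :
    Bounded n z ∧ z.map Finset.card = b.map Finset.card ∧ z.length = b.length ∧
      ∀ j, 1 ≤ j → j < b.length → eps j (dual n z) = eps j (dual n b) := by
  refine component_induction (P := fun z => Bounded n z ∧ z.map Finset.card = b.map Finset.card ∧
    z.length = b.length ∧ ∀ j, 1 ≤ j → j < b.length → eps j (dual n z) = eps j (dual n b))
    ⟨hb, rfl, rfl, fun _ _ _ => rfl⟩ ?_ ?_ hz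
  · rintro i h1 hn z - ⟨h2, h3, h4, h5⟩ z' h
    refine ⟨h2.lower hn h, (map_card_of_lower h).trans h3, (length_of_lower h).trans h4,
      fun j hj1 hj => ?_⟩
    rw [eps_dual_lower h2 h1 hn h hj1 (by omega), h5 j hj1 hj]
  · rintro i h1 hn z - ⟨h2, h3, h4, h5⟩ z' h
    refine ⟨h2.raise h1 hn h, (map_card_of_raise h).trans h3, (length_of_raise h).trans h4,
      fun j hj1 hj => ?_⟩
    rw [← h5 j hj1 hj, eps_dual_lower (h2.raise h1 hn h) h1 hn (lower_of_raise h) hj1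
      (by rw [length_of_raise h]; omega)]

/-- An injective map that commutes with the crystal operators is an isomorphism of connected
components. -/
theorem component_isCrystalIso {n : ℕ} {b : ColProd} {φ : ColProd → ColProd}
    (hl : ∀ i, 1 ≤ i → i < n → ∀ z ∈ component n b, lower i (φ z) = (lower i z).map φ)
    (hr : ∀ i, 1 ≤ i → i < n → ∀ z ∈ component n b, raise i (φ z) = (raise i z).map φ)
    (hw : ∀ i, 1 ≤ i → i < n → ∀ z ∈ component n b, weight i (φ z) = weight i z)
    (hi : Set.InjOn φ (component n b)) :
    IsCrystalIso n (component n b) (component n (φ b)) φ := by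
  refine ⟨⟨fun z hz => ?_, hi, fun y hy => ?_⟩, hl, hr, hw⟩
  · refine component_induction (P := fun z => φ z ∈ component n (φ b))
      (mem_component_self n _) ?_ ?_ hz
    · intro i h1 hn z hz hP z' h
      have := hl i h1 hn z hz
      rw [h] at this
      exact isStable_component n _ i h1 hn _ hP _ (.inr this)
    · intro i h1 hn z hz hP z' h
      have := hr i h1 hn z hz
      rw [h] at this
      exact isStable_component n _ i h1 hn _ hP _ (.inl this)
  · refine component_induction (P := fun y => y ∈ φ '' component n b)
      ⟨b, mem_component_self n b, rfl⟩ ?_ ?_ hy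
    · rintro i h1 hn _ - ⟨z, hz, rfl⟩ y' h
      rw [hl i h1 hn z hz] at h
      obtain ⟨z', h2, rfl⟩ := Option.map_eq_some_iff.1 h
      exact ⟨z', isStable_component n _ i h1 hn _ hz _ (.inr h2), rfl⟩
    · rintro i h1 hn _ - ⟨z, hz, rfl⟩ y' h
      rw [hr i h1 hn z hz] at h
      obtain ⟨z', h2, rfl⟩ := Option.map_eq_some_iff.1 h
      exact ⟨z', isStable_component n _ i h1 hn _ hz _ (.inl h2), rfl⟩

/-- Injectivity comes from the dual side: there the slide is a raising operator, which lowering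
undoes, and the dual determines the element. -/
theorem slideAt_isCrystalIso {n k : ℕ} {b : ColProd} (hb : Bounded n b) (hk : k + 2 ≤ b.length)
    (h : eps (b.length - 1 - k) (dual n b) ≠ 0) :
    IsCrystalIso n (component n b) (component n (slideAt n k b)) (slideAt n k) := by
  have hlen : ∀ z ∈ component n b, k + 2 ≤ z.length := fun z hz => by
    rwa [(component_bounded hb hz).2.2.1]
  refine component_isCrystalIso (fun i h1 hn z hz => lower_slideAt h1 hn (hlen z hz))
    (fun i h1 hn z hz => raise_slideAt h1 hn (hlen z hz)) (fun i h1 hn z hz => ?_) ?_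
  · rw [weight_eq, weight_eq, (eps_slideAt h1 hn (hlen z hz)).1,
      (eps_slideAt h1 hn (hlen z hz)).2]
  · intro z hz z' hz' he
    obtain ⟨h2, -, h3, h4⟩ := component_bounded hb hz
    obtain ⟨h2', -, h3', h4'⟩ := component_bounded hb hz'
    refine dual_injective h2 h2' (h3.trans h3'.symm) ?_
    have h5 := raise_dual_slideAt h2 (hlen z hz) (by rw [h3, h4 _ (by omega) (by omega)]; exact h)
    have h5' := raise_dual_slideAt h2' (hlen z' hz')
      (by rw [h3', h4' _ (by omega) (by omega)]; exact h)
    rw [h3] at h5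
    rw [h3', ← he] at h5'
    exact Option.some.inj ((lower_of_raise h5).symm.trans (lower_of_raise h5'))

/-! ## Tableaux -/

/-- `slideCount` is the maximum of `cnt x - cnt y`, a number that is at least zero. -/
theorem rightOf_iff_slideCount {n : ℕ} {x y : Finset ℕ} (hx : x ⊆ Finset.Icc 1 n)
    (hy : y ⊆ Finset.Icc 1 n) : RightOf x y ↔ slideCount n x y = 0 := by
  rw [rightOf_iff, slideCount]
  constructor
  · intro h
    have := gap_le_of_cnt (k := n) (d := 0) hx hy le_rfl (fun t => by have := h t; omega)
    rw [cnt_eq_card hx le_rfl, cnt_eq_card hy le_rfl] at this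
    omega
  · intro h t
    rcases le_total t n with ht | ht
    · have := cnt_le_gap (y := y) hx 0 ht
      rw [cnt_eq_card hx le_rfl, cnt_eq_card hy le_rfl] at this
      omega
    · rw [cnt_eq_card hx ht, cnt_eq_card hy ht]; omega

/-- Semistandardness is a condition on adjacent columns, and for `c_j` and `c_{j+1}` it says that
the `j`-signature of the dual has no `-`. -/
theorem isTableau_iff {n : ℕ} {b : ColProd} (hb : Bounded n b) :
    IsTableau b ↔ IsHighest b.length (dual n b) := by
  constructor
  · intro h j h1 hj
    obtain ⟨u, x, y, v, rfl, h2⟩ := exists_split_pair (d := b) (j := b.length - j) (by omega)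
      (by omega)
    have h3 : j = v.length + 1 := by simp at h2 hj; omega
    have hx := hb x (by simp)
    have hy := hb y (by simp)
    rw [h3, eps_dual hx hy, ← rightOf_iff_slideCount hx hy]
    unfold IsTableau at h
    rw [List.isChain_append_cons_cons] at h
    exact h.2.1
  · intro h
    have key : ∀ u v x y, b = u ++ x :: y :: v → RightOf x y := by
      rintro u v x y rfl
      have hx := hb x (by simp)
      have hy := hb y (by simp)
      rw [rightOf_iff_slideCount hx hy, ← eps_dual (u := u) (v := v) hx hy]
      exact h _ (by omega) (by simp; omega)
    clear h hb
    unfold IsTableau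
    induction b with
    | nil => simp
    | cons x b ih =>
      rcases b with _ | ⟨y, v⟩
      · simp
      · rw [List.isChain_cons_cons]
        refine ⟨key [] v x y rfl, ih fun u v x' y' h => key (x :: u) v x' y' (by rw [h]; rfl)⟩

theorem cnt_Icc_one {a k : ℕ} (h : a ≤ k) : cnt (Finset.Icc 1 k) a = a := by
  have : (Finset.Icc 1 k).filter (· ≤ a) = Finset.Icc 1 a := by
    ext b; simp only [Finset.mem_filter, Finset.mem_Icc]; omega
  rw [cnt, this]; simp

theorem RightOf.Icc_subset {k n : ℕ} {y : Finset ℕ} (h : RightOf (Finset.Icc 1 k) y)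
    (hy : y ⊆ Finset.Icc 1 n) : Finset.Icc 1 k ⊆ y := by
  intro a ha
  rw [Finset.mem_Icc] at ha
  have h1 := (rightOf_iff _ _).1 h a
  rw [cnt_Icc_one ha.2] at h1
  have h2 : y.filter (· ≤ a) ⊆ Finset.Icc 1 a := by
    intro b hb
    rw [Finset.mem_filter] at hb
    have := Finset.mem_Icc.1 (hy hb.1)
    exact Finset.mem_Icc.2 ⟨this.1, hb.2⟩
  have h3 := Finset.eq_of_subset_of_card_le h2 (by simpa [cnt] using h1)
  have h4 : a ∈ y.filter (· ≤ a) := by rw [h3, Finset.mem_Icc]; exact ⟨ha.1, le_rfl⟩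
  exact (Finset.mem_filter.1 h4).1

/-- The columns of a highest weight tableau are nested initial segments. -/
theorem pairwise_subset_of_highest {n : ℕ} {z : ColProd} (hz : Bounded n z) (ht : IsTableau z)
    {k : ℕ} (hk : ∀ c ∈ z.head?, Finset.Icc 1 k ⊆ c) (he : ∀ i, k < i → i < n → eps i z = 0) :
    z.Pairwise (· ⊆ ·) ∧ ∀ c ∈ z, Finset.Icc 1 k ⊆ c := by
  -- Vanishing of `eps` is kept only for `i > k`: the `+` that a head `{1, …, k}` carries for `i =
  -- k` may cancel a `-` of the tail. The letters up to `k` are controlled by the tableau condition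
  -- instead.
  induction z generalizing k with
  | nil => simp
  | cons c r ih =>
    obtain ⟨hc, hr⟩ := hz.of_cons
    have hkc : Finset.Icc 1 k ⊆ c := hk c rfl
    have hi : IsInitial c := by
      intro i h1 h2
      by_cases hik : i ≤ k
      · exact hkc (Finset.mem_Icc.2 ⟨h1, hik⟩)
      · by_contra h3
        have h4 := he i (by omega) (by have := Finset.mem_Icc.1 (hc h2); omega)
        rw [eps, if_pos ⟨h2, h3⟩] at h4
        omega
    have hcc := hi.eq_Icc hc
    have hle : k ≤ c.card := by simpa using Finset.card_le_card hkc
    have h5 : ∀ d ∈ r.head?, Finset.Icc 1 c.card ⊆ d := by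
      intro d hd
      rcases r with _ | ⟨e, r⟩
      · simp at hd
      · obtain rfl : e = d := by simpa using hd
        unfold IsTableau at ht
        rw [List.isChain_cons_cons, hcc] at ht
        exact ht.1.Icc_subset (hr e (by simp))
    have h6 : ∀ i, c.card < i → i < n → eps i r = 0 := by
      intro i h1 h2
      have h3 := he i (by omega) h2
      have h7 : i ∉ c := by rw [hcc, Finset.mem_Icc]; omega
      have h8 : i + 1 ∉ c := by rw [hcc, Finset.mem_Icc]; omega
      rwa [eps, if_neg (fun h => h8 h.1), if_neg (fun h => h7 h.1)] at h3
    obtain ⟨h7, h8⟩ := ih hr (List.IsChain.tail ht) h5 h6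
    rw [← hcc] at h8
    refine ⟨List.pairwise_cons.2 ⟨h8, h7⟩, fun d hd => ?_⟩
    rcases List.mem_cons.1 hd with rfl | hd
    · exact hkc
    · exact hkc.trans (h8 d hd)

/-- The head of an increasing chain consists of the letters whose multiplicity is the length of the
chain, so the chain can be peeled off from its multiplicities. -/
theorem eq_of_pairwise_subset {n : ℕ} {z z' : ColProd} (hz : Bounded n z) (hz' : Bounded n z')
    (hl : z.length = z'.length) (hp : z.Pairwise (· ⊆ ·)) (hp' : z'.Pairwise (· ⊆ ·))
    (hm : ∀ i ∈ Finset.Icc 1 n, mult i z = mult i z') : z = z' := by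
  induction z generalizing z' with
  | nil => exact (List.length_eq_zero_iff.1 hl.symm).symm
  | cons c r ih =>
    rcases z' with _ | ⟨c', r'⟩
    · simp at hl
    have key : ∀ (c : Finset ℕ) (r : ColProd), (c :: r).Pairwise (· ⊆ ·) → ∀ i,
        i ∈ c ↔ mult i (c :: r) = (c :: r).length := by
      intro c r hp i
      rw [mult, List.countP_eq_length]
      refine ⟨fun hi d hd => ?_, fun h => by simpa using h c (by simp)⟩
      rcases List.mem_cons.1 hd with rfl | hd
      · simpa using hi
      · simpa using (List.pairwise_cons.1 hp).1 d hd hi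
    obtain ⟨hc, hr⟩ := hz.of_cons
    obtain ⟨hc', hr'⟩ := hz'.of_cons
    have hcc : c = c' := by
      ext i
      by_cases hi : i ∈ Finset.Icc 1 n
      · rw [key c r hp, key c' r' hp', hm i hi, hl]
      · exact ⟨fun h => absurd (hc h) hi, fun h => absurd (hc' h) hi⟩
    subst hcc
    rw [ih hr hr' (by simpa using hl) hp.tail hp'.tail fun i hi => ?_]
    have := hm i hi
    simpa only [mult, List.countP_cons, Nat.add_right_cancel_iff] using this

theorem tableau_highest_ext {n : ℕ} {z z' : ColProd} (hz : Bounded n z) (hz' : Bounded n z')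
    (ht : IsTableau z) (ht' : IsTableau z') (hh : IsHighest n z) (hh' : IsHighest n z')
    (hl : z.length = z'.length) (hc : (z.map Finset.card).sum = (z'.map Finset.card).sum)
    (hw : ∀ i, 1 ≤ i → i < n → weight i z = weight i z') : z = z' :=
  eq_of_pairwise_subset hz hz' hl
    (pairwise_subset_of_highest hz ht (k := 0) (by simp) fun i h1 h2 => hh i h1 h2).1
    (pairwise_subset_of_highest hz' ht' (k := 0) (by simp) fun i h1 h2 => hh' i h1 h2).1
    fun _ hi => mult_eq_of_weight hz hz' hc hw hi

theorem IsTableau.component {n : ℕ} {t z : ColProd} (ht : IsTableau t) (hb : Bounded n t)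
    (hz : z ∈ component n t) : IsTableau z := by
  obtain ⟨h1, -, h3, h4⟩ := component_bounded hb hz
  rw [isTableau_iff h1]
  intro j hj hj'
  rw [h4 j hj (by omega)]
  exact (isTableau_iff hb).1 ht j hj (by omega)

theorem slideAt_bounded {n k : ℕ} {b : ColProd} (hb : Bounded n b) (hk : k + 2 ≤ b.length) :
    Bounded n (slideAt n k b) ∧ (slideAt n k b).length = b.length ∧
      ((slideAt n k b).map Finset.card).sum = (b.map Finset.card).sum := by
  obtain ⟨u, x, y, v, rfl, rfl⟩ := exists_split_at hk
  rw [slideAt_append]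
  obtain ⟨h1, h2⟩ := bounded_append.1 hb
  obtain ⟨hx, h3⟩ := h2.of_cons
  obtain ⟨hy, hv⟩ := h3.of_cons
  refine ⟨bounded_append.2 ⟨h1, (hv.cons (slideR_subset hx hy)).cons (slideL_subset hx)⟩,
    by simp, ?_⟩
  have h4 := card_slideL (m := n) (θ := slideCount n x y - 1) (x := x) (y := y)
  simp only [List.map_append, List.map_cons, List.sum_append, List.sum_cons, card_slideR]
  omega

/-- Every tensor product of columns is connected to a tableau by sliding letters; this does not
change the energy of the dual. -/
theorem exists_tableau {n : ℕ} {b : ColProd} (hb : Bounded n b) :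
    ∃ t φ, IsCrystalIso n (component n b) (component n t) φ ∧ φ b = t ∧ IsTableau t ∧
      Bounded n t ∧ t.length = b.length ∧ (t.map Finset.card).sum = (b.map Finset.card).sum ∧
      energy b.length (dual n t) = energy b.length (dual n b) := by
  -- Each slide raises the dual and so lowers its letter sum; the climb ends at a tableau.
  induction hk : letterSum (dual n b) using Nat.strong_induction_on generalizing b with
  | _ N ih =>
    by_cases ht : IsTableau b
    · exact ⟨b, id, isCrystalIso_id n _, rfl, ht, hb, rfl, rfl, rfl⟩
    · rw [isTableau_iff hb] at ht
      obtain ⟨j, h1, h2, d, hd⟩ := IsHighest.exists_raise ht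
      have hj : b.length - 1 - (b.length - 1 - j) = j := by omega
      have hk2 : b.length - 1 - j + 2 ≤ b.length := by omega
      have he : eps (b.length - 1 - (b.length - 1 - j)) (dual n b) ≠ 0 := by
        rw [hj, ← eps_of_raise hd]; omega
      have hr := raise_dual_slideAt hb hk2 he
      have hiso := slideAt_isCrystalIso hb hk2 he
      obtain ⟨hb', hl', hs'⟩ := slideAt_bounded hb hk2
      obtain ⟨t, φ, h3, h4, h5, h6, h7, h8, h9⟩ :=
        ih _ (hk ▸ letterSum_of_raise hr) hb' rfl
      refine ⟨t, φ ∘ slideAt n (b.length - 1 - j), h3.comp hiso, h4, h5, h6, h7.trans hl',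
        h8.trans hs', ?_⟩
      rw [hl'] at h9
      have hbd := bounded_dual n (slideAt n (b.length - 1 - j) b)
      rw [hl'] at hbd
      rw [hj] at hr
      rw [h9, ← energy_lower hbd h1 h2 (lower_of_raise hr)]

theorem IsTableauOf.bounded {n : ℕ} {b t : ColProd} (h : IsTableauOf n b t) : Bounded n t :=
  h.1.2.1

theorem IsTableauOf.length_eq {n : ℕ} {b t : ColProd} (h : IsTableauOf n b t) :
    t.length = b.length := h.1.1

/-- The energy of the dual does not change when an element is replaced by its tableau. -/
theorem IsTableauOf.energy_eq {n : ℕ} {b t : ColProd} (h : IsTableauOf n b t)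
    (hb : Bounded n b) : energy b.length (dual n t) = energy b.length (dual n b) := by
  obtain ⟨⟨hl, hbt, hs⟩, ht, φ, hφ, hφb⟩ := h
  obtain ⟨t', ψ, hψ, hψb, ht', hbt', hl', hs', he⟩ := exists_tableau hb
  have hA := isStable_component n b
  -- The two isomorphisms agree on highest weight elements, whose images are highest weight tableaux
  -- of the same length, size and weight.
  have key : φ b = ψ b := by
    refine hφ.eqOn hψ hA (fun z hz hh => ?_) (mem_component_self n b)
    have h1 := hφ.bijOn.mapsTo hz
    have h2 := hψ.bijOn.mapsTo hz
    obtain ⟨h3, h4, h5, -⟩ := component_bounded hbt h1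
    obtain ⟨h3', h4', h5', -⟩ := component_bounded hbt' h2
    refine tableau_highest_ext h3 h3' (ht.component hbt h1) (ht'.component hbt' h2)
      (hφ.isHighest hA hz hh) (hψ.isHighest hA hz hh) ?_ ?_ fun i hi hn => ?_
    · rw [h5, h5', hl, hl']
    · rw [h4, h4', hs, hs']
    · rw [hφ.map_weight i hi hn z hz, hψ.map_weight i hi hn z hz]
  rw [← hφb, key, hψb, he]

theorem tableauOf_spec {n : ℕ} {b : ColProd} (hb : Bounded n b) :
    IsTableauOf n b (tableauOf n b) := by
  obtain ⟨t, φ, h1, h2, h3, h4, h5, h6, -⟩ := exists_tableau hb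
  exact Classical.epsilon_spec (p := IsTableauOf n b) ⟨t, ⟨h5, h4, h6⟩, h3, φ, h1, h2⟩

/-! ## The rules defining the charge -/

theorem col_cons_empty (b : ColProd) : col (∅ :: b) = col b := by
  funext j
  rw [col, col, List.reverse_cons]
  simp only [List.getD_eq_getElem?_getD, List.getElem?_append]
  split_ifs with h
  · rfl
  · rw [List.getElem?_eq_none (l := b.reverse) (by omega), List.getElem?_singleton]
    split_ifs <;> rfl

theorem col_eq_empty {b : ColProd} {j : ℕ} (h : b.length < j) : col b j = ∅ := by
  rw [col, List.getD_eq_default]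
  simp; omega

theorem col_mem {b : ColProd} {j : ℕ} (h1 : 1 ≤ j) (h2 : j ≤ b.length) : col b j ∈ b := by
  have := col_length_sub (b := b) (k := b.length - j) (by omega)
  rw [Nat.sub_sub_self h2] at this
  rw [this]
  exact List.getElem_mem _

/-- The empty column has the largest index, so the dual keeps its factors and only the bound on
their entries changes. -/
theorem energy_dual_cons_empty (n : ℕ) (b : ColProd) :
    energy (∅ :: b : ColProd).length (dual n (∅ :: b)) = energy b.length (dual n b) := by
  have h : dual n (∅ :: b) = dual n b := by
    rw [dual_eq, dual_eq]
    refine List.map_congr_left fun i _ => ?_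
    ext j
    rw [mem_row, mem_row, col_cons_empty, List.length_cons]
    constructor
    · rintro ⟨h1, h2⟩
      refine ⟨⟨h1.1, ?_⟩, h2⟩
      by_contra h3
      rw [col_eq_empty (by omega)] at h2
      simp at h2
    · rintro ⟨h1, h2⟩
      exact ⟨⟨h1.1, by omega⟩, h2⟩
  rw [h, List.length_cons, energy_succ (bounded_dual n b)]

/-- Only `c_1` can be nonempty, so all factors of the dual are `∅` or `{1}`, which form a chain. -/
theorem energy_dual_column (n : ℕ) {b : ColProd} (h : ∀ c ∈ b.dropLast, c = ∅) :
    energy b.length (dual n b) = 0 := by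
  have key : ∀ d ∈ dual n b, d = ∅ ∨ d = {1} := by
    intro d hd
    obtain ⟨i, -, rfl⟩ := List.mem_map.1 hd
    rw [← Finset.subset_singleton_iff]
    intro j hj
    obtain ⟨⟨h1, h2⟩, h3⟩ := mem_row.1 hj
    rw [Finset.mem_singleton]
    by_contra hne
    have h4 := col_length_sub (b := b) (k := b.length - j) (by omega)
    rw [Nat.sub_sub_self h2] at h4
    have h5 : b[b.length - j] ∈ b.dropLast := by
      rw [← List.getElem_dropLast (by rw [List.length_dropLast]; omega)]
      exact List.getElem_mem _
    rw [h4, h _ h5] at h3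
    simp at h3
  refine energy_eq_zero (bounded_dual n b) fun x hx y hy => ?_
  rcases key x hx with rfl | rfl <;> rcases key y hy with rfl | rfl <;> simp

/-- The cyclage gives `c_ℓ` the index `1` and every other `c_j` the index `j + 1`. -/
theorem row_cyclage {c : Finset ℕ} {r : ColProd} (i : ℕ) :
    row (r ++ [c]) i = promote (r.length + 1) (row (c :: r) i) := by
  have hs : ∀ b : ColProd, row b i ⊆ Finset.Icc 1 b.length := fun b => Finset.filter_subset _ _
  refine eq_promote (hs (c :: r)) (by simpa using hs (r ++ [c])) ?_ fun a h1 h2 => ?_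
  · have e1 := mem_row_append (u := r) (v := []) (c := c) (i := i)
    have e2 := mem_row_append (u := []) (v := r) (c := c) (i := i)
    rw [List.nil_append] at e2
    exact e1.trans e2.symm
  · have e1 : col (r ++ [c]) (a + 1) = col (c :: r) a := by
      obtain ⟨a, rfl⟩ := Nat.exists_eq_add_of_le' h1
      simp only [col, List.reverse_append, List.reverse_cons, List.reverse_nil, List.nil_append,
        List.singleton_append, List.getD_eq_getElem?_getD, Nat.add_sub_cancel,
        List.getElem?_cons_succ]
      rw [List.length_cons] at h2
      rw [List.getElem?_append_left (by rw [List.length_reverse]; omega)]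
    rw [mem_row, mem_row, e1]
    simp only [List.length_append, List.length_cons, List.length_nil] at h2 ⊢
    exact and_congr_left fun _ => by omega

theorem dual_cyclage (n : ℕ) (c : Finset ℕ) (r : ColProd) :
    dual n (cyclage (c :: r)) = (dual n (c :: r)).map (promote (r.length + 1)) := by
  have : cyclage (c :: r) = r ++ [c] := by simp [cyclage]
  rw [this, dual_eq, dual_eq, List.map_map]
  exact List.map_congr_left fun i _ => row_cyclage i

theorem mult_dual_cons {n : ℕ} {c : Finset ℕ} (hc : c ⊆ Finset.Icc 1 n) (r : ColProd) :
    mult (r.length + 1) (dual n (c :: r)) = c.card := by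
  have h1 : ∀ i, r.length + 1 ∈ row (c :: r) i ↔ i ∈ c := fun i =>
    mem_row_append (u := []) (v := r)
  rw [mult, dual_eq, List.countP_map]
  simp only [Function.comp_def, h1]
  rw [List.countP_eq_length_filter, ← List.toFinset_card_of_nodup
    ((List.nodup_range' (s := 1) (n := n)).filter _)]
  congr 1
  ext i
  simp only [List.mem_toFinset, List.mem_filter, List.mem_range'_1, decide_eq_true_eq]
  refine ⟨fun h => h.2, fun h => ⟨?_, h⟩⟩
  have := Finset.mem_Icc.1 (hc h)
  omega

theorem isFullLetter_iff {n i : ℕ} {b : ColProd} (hi : 1 ≤ i ∧ i ≤ n) :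
    IsFullLetter n b i ↔ row b i = Finset.Icc 1 b.length := by
  rw [IsFullLetter, Finset.mem_Icc]
  constructor
  · rintro ⟨-, h⟩
    ext j
    rw [mem_row, Finset.mem_Icc]
    exact ⟨fun h => h.1, fun hj => ⟨hj, h _ (col_mem hj.1 hj.2)⟩⟩
  · intro h
    refine ⟨hi, fun c hc => ?_⟩
    obtain ⟨k, hk, rfl⟩ := List.getElem_of_mem hc
    have h1 : b.length - k ∈ row b i := by rw [h, Finset.mem_Icc]; omega
    rw [mem_row, col_length_sub hk] at h1
    exact h1.2

/-- An authorised cyclage of a tableau lowers the energy of the dual by the size of the column that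
is moved. -/
theorem energy_dual_cyclage {n : ℕ} {c : Finset ℕ} {r : ColProd} (hb : Bounded n (c :: r))
    (ht : IsTableau (c :: r)) (hf : ¬ ∃ k, IsFullLetter n (c :: r) k) :
    energy (cyclage (c :: r)).length (dual n (cyclage (c :: r))) + c.card =
      energy (c :: r).length (dual n (c :: r)) := by
  have hl : (cyclage (c :: r)).length = r.length + 1 := by simp [cyclage]
  rw [hl, dual_cyclage, ← mult_dual_cons (hb c (by simp)) r, List.length_cons]
  refine energy_promote (by omega) (bounded_dual n (c :: r)) ((isTableau_iff hb).1 ht) ?_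
  -- A factor of the dual with `ℓ` elements would come from a letter present in every column.
  intro d hd
  have hs := bounded_dual n (c :: r) d hd
  have hle := Finset.card_le_card hs
  rw [Nat.card_Icc, List.length_cons, Nat.add_sub_cancel] at hle
  refine lt_of_le_of_ne hle fun he => hf ?_
  have h1 := Finset.eq_of_subset_of_card_le hs (by simp [he])
  obtain ⟨i, hi, rfl⟩ := List.mem_map.1 hd
  rw [List.mem_range'_1] at hi
  exact ⟨i, (isFullLetter_iff (by omega)).2 h1⟩

/-- Under condition (a), the letter `1` is at least as frequent as any other, so a full letter would
put `1` in every column, in particular in `c_ℓ`. -/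
theorem CyclageAuthorised.not_full {n : ℕ} {b : ColProd} (h : CyclageAuthorised n b)
    (hne : b ≠ []) : ¬ ∃ k, IsFullLetter n b k := by
  rcases h with ⟨hd, h1⟩ | ⟨-, h⟩
  · rintro ⟨k, hk, hf⟩
    rw [Finset.mem_Icc] at hk
    have h2 : mult k b ≤ mult 1 b := by
      have : ∀ j, 1 ≤ j → j ≤ n → mult j b ≤ mult 1 b := by
        intro j hj
        induction j, hj using Nat.le_induction with
        | base => exact fun _ => le_rfl
        | succ j hj ih => exact fun hjn => (hd j hj (by omega)).trans (ih (by omega))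
      exact this k hk.1 hk.2
    have h3 : mult k b = b.length := by
      rw [mult, List.countP_eq_length]
      exact fun c hc => by simpa using hf c hc
    have h4 : mult 1 b = b.length := le_antisymm (List.countP_le_length) (by omega)
    rw [mult, List.countP_eq_length] at h4
    rcases b with _ | ⟨c, r⟩
    · exact hne rfl
    · exact h1 (by simpa using h4 c (by simp))
  · exact h

/-! ### Reduction under duality. -/

theorem mem_deleteLetter {k i : ℕ} {c : Finset ℕ} :
    i ∈ (c.erase k).image (fun a => if k < a then a - 1 else a) ↔
      (if i < k then i else i + 1) ∈ c := by
  rw [Finset.mem_image]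
  constructor
  · rintro ⟨a, ha, rfl⟩
    obtain ⟨h1, h2⟩ := Finset.mem_erase.1 ha
    rcases lt_or_gt_of_ne h1 with h | h
    · rwa [if_neg (show ¬ k < a by omega), if_pos h]
    · rwa [if_pos (show k < a from h), if_neg (by omega), Nat.sub_add_cancel (by omega)]
  · intro h
    split_ifs at h with h1
    · exact ⟨i, Finset.mem_erase.2 ⟨by omega, h⟩, by rw [if_neg (by omega)]⟩
    · exact ⟨i + 1, Finset.mem_erase.2 ⟨by omega, h⟩, by rw [if_pos (by omega)]; rfl⟩

theorem row_deleteLetter (k i : ℕ) (b : ColProd) :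
    row (deleteLetter k b) i = row b (if i < k then i else i + 1) := by
  have h : ∀ j, col (deleteLetter k b) j =
      ((col b j).erase k).image (fun a => if k < a then a - 1 else a) := by
    intro j
    rw [col, col, deleteLetter, ← List.map_reverse]
    exact List.getD_map b.reverse (d := ∅)
      fun c : Finset ℕ => (c.erase k).image fun a => if k < a then a - 1 else a
  ext j
  rw [mem_row, mem_row, h, mem_deleteLetter, deleteLetter, List.length_map]

theorem bounded_deleteLetter {n k : ℕ} {b : ColProd} (hb : Bounded n b) (hk : 1 ≤ k ∧ k ≤ n) :
    Bounded (n - 1) (deleteLetter k b) := by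
  intro c hc
  obtain ⟨c, hc', rfl⟩ := List.mem_map.1 hc
  intro i hi
  have h1 := Finset.mem_Icc.1 (hb c hc' (mem_deleteLetter.1 hi))
  obtain ⟨a, ha, rfl⟩ := Finset.mem_image.1 hi
  obtain ⟨h2, h3⟩ := Finset.mem_erase.1 ha
  have h4 := Finset.mem_Icc.1 (hb c hc' h3)
  rw [Finset.mem_Icc]
  split_ifs at h1 ⊢ <;> omega

/-- Deleting the letter `k` removes the factor `d(k)` from the dual. This factor is full, so the
energy does not notice. -/
theorem energy_dual_deleteLetter {n k : ℕ} {b : ColProd} (hk : IsFullLetter n b k) :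
    energy (deleteLetter k b).length (dual (n - 1) (deleteLetter k b)) =
      energy b.length (dual n b) := by
  have hk1 := Finset.mem_Icc.1 hk.1
  have e1 : List.range' 1 n = List.range' 1 (k - 1) ++ k :: List.range' (k + 1) (n - k) := by
    have h := List.range'_append_1 (s := 1) (m := k - 1) (n := n - k + 1)
    rwa [show 1 + (k - 1) = k by omega, show k - 1 + (n - k + 1) = n by omega, List.range'_succ,
      eq_comm] at h
  have e2 : List.range' 1 (n - 1) = List.range' 1 (k - 1) ++ List.range' k (n - k) := by
    have h := List.range'_append_1 (s := 1) (m := k - 1) (n := n - k)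
    rwa [show 1 + (k - 1) = k by omega, show k - 1 + (n - k) = n - 1 by omega, eq_comm] at h
  have e3 : List.range' (k + 1) (n - k) = (List.range' k (n - k)).map (1 + ·) := by
    rw [List.map_add_range', Nat.add_comm]
  have hd : dual n b = (List.range' 1 (k - 1)).map (row b) ++ Finset.Icc 1 b.length ::
      (List.range' (k + 1) (n - k)).map (row b) := by
    rw [dual_eq, e1, List.map_append, List.map_cons, (isFullLetter_iff hk1).1 hk]
  have hd' : dual (n - 1) (deleteLetter k b) = (List.range' 1 (k - 1)).map (row b) ++
      (List.range' (k + 1) (n - k)).map (row b) := by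
    rw [dual_eq, e2, e3, List.map_append, List.map_map]
    congr 1
    · refine List.map_congr_left fun i hi => ?_
      rw [List.mem_range'_1] at hi
      rw [row_deleteLetter, if_pos (by omega)]
    · refine List.map_congr_left fun i hi => ?_
      rw [List.mem_range'_1] at hi
      rw [row_deleteLetter, if_neg (by omega), Function.comp_apply, Nat.add_comm]
  have hbd := bounded_dual n b
  rw [hd] at hbd ⊢
  obtain ⟨h1, h2⟩ := bounded_append.1 hbd
  rw [hd', deleteLetter, List.length_map, energy_full h1 h2.of_cons.2]

/-! ## Charge and energy -/

theorem bounded_cyclage {n : ℕ} {b : ColProd} (hb : Bounded n b) : Bounded n (cyclage b) := by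
  intro c hc
  exact hb c (by simpa [cyclage] using hc)

/-- Any value given by the rules is the energy of the dual. -/
theorem IsCharge.eq_energy {n m : ℕ} {b : ColProd} (h : IsCharge n b m) (hb : Bounded n b) :
    m = energy b.length (dual n b) := by
  induction h with
  | column n b h => exact (energy_dual_column n h).symm
  | dropEmpty n m b _ _ ih => rw [energy_dual_cons_empty, ← ih hb.of_cons.2]
  | cyclage n m b ht hne ha _ ih =>
    rcases b with _ | ⟨c, r⟩
    · exact absurd rfl hne
    · rw [← energy_dual_cyclage hb ht (ha.not_full (by simp)), ← ih (bounded_cyclage hb)]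
      rfl
  | reduction n m k b _ _ hk _ ih =>
    rw [← energy_dual_deleteLetter hk.1,
      ← ih (bounded_deleteLetter hb (Finset.mem_Icc.1 hk.1.1))]
  | general n m b _ ih =>
    have ht := tableauOf_spec hb
    rw [ih ht.bounded, ht.length_eq, ht.energy_eq hb]

/-- The rules give a value to every tensor product of columns. -/
theorem exists_isCharge {n : ℕ} {b : ColProd} (hb : Bounded n b) : ∃ m, IsCharge n b m := by
  -- Cyclage lowers the first summand, an empty column the second, reduction the third, each without
  -- changing the other two.
  induction hN : energy b.length (dual n b) + b.length + n using Nat.strong_induction_on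
    generalizing n b with
  | _ N ih =>
    have ht := tableauOf_spec hb
    -- Passing to the tableau leaves the measure unchanged, so it is done once, before one of the
    -- decreasing rules.
    suffices h : ∃ m, IsCharge n (tableauOf n b) m by
      obtain ⟨m, hm⟩ := h
      exact ⟨m, .general n m b hm⟩
    have hbt := ht.bounded
    rw [← ht.energy_eq hb, ← ht.length_eq] at hN
    have htab := ht.2.1
    clear ht
    generalize tableauOf n b = t at hbt hN htab
    rcases t with _ | ⟨c, r⟩
    · exact ⟨0, .column n [] (by simp)⟩
    · by_cases hc : c = ∅
      · subst hc
        obtain ⟨m, hm⟩ := ih _ (by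
          rw [energy_dual_cons_empty, List.length_cons] at hN; omega) hbt.of_cons.2 rfl
        exact ⟨m, .dropEmpty n m r htab hm⟩
      · by_cases hf : ∃ k, IsFullLetter n (c :: r) k
        · classical
          have hk : IsLeast {k | IsFullLetter n (c :: r) k} (Nat.find hf) :=
            ⟨Nat.find_spec hf, fun k hk => Nat.find_min' hf hk⟩
          have hk1 := Finset.mem_Icc.1 (Nat.find_spec hf).1
          obtain ⟨m, hm⟩ := ih _ (by
            rw [← energy_dual_deleteLetter hk.1] at hN
            have hl : (deleteLetter (Nat.find hf) (c :: r)).length = (c :: r).length := by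
              simp [deleteLetter]
            have h1 : 1 ≤ n := hk1.1.trans hk1.2
            rw [← hN, hl]
            exact Nat.add_lt_add_left (Nat.sub_lt h1 Nat.one_pos) _)
            (bounded_deleteLetter hbt hk1) rfl
          exact ⟨m, .reduction n m _ _ htab (by simp) hk hm⟩
        · have h1 := energy_dual_cyclage hbt htab hf
          have h2 : 0 < c.card := Finset.card_pos.2 (Finset.nonempty_iff_ne_empty.2 hc)
          have hl : (cyclage (c :: r)).length = (c :: r).length := by simp [cyclage]
          obtain ⟨m, hm⟩ := ih _ (by rw [← hN, ← h1, hl]; omega) (bounded_cyclage hbt) rfl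
          exact ⟨_, .cyclage n m _ htab hc (.inr ⟨htab, hf⟩) hm⟩

end ColumnCrystal

theorem mainTheorem3 (n ℓ s : ℕ) (hn : 2 ≤ n) (hℓ : 2 ≤ ℓ)
    (b : ColumnCrystal.ColProd) (hb : b ∈ ColumnCrystal.Fock n ℓ s) :
    (∃! m, ColumnCrystal.IsCharge n b m) ∧
      ColumnCrystal.charge n b = ColumnCrystal.energy ℓ (ColumnCrystal.dual n b) := by
  obtain ⟨rfl, hbd, -⟩ := hb
  obtain ⟨m, hm⟩ := ColumnCrystal.exists_isCharge hbd
  refine ⟨⟨m, hm, fun m' hm' => (hm'.eq_energy hbd).trans (hm.eq_energy hbd).symm⟩, ?_⟩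
  exact ColumnCrystal.IsCharge.eq_energy
    (Classical.epsilon_spec (p := ColumnCrystal.IsCharge n b) ⟨m, hm⟩) hbd
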